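/- Let $\Omega\subset\mathbb R^N$ be a compact smooth embedded submanifold of dimension $d$ with (possibly empty) smooth boundary, carrying the Riemannian metric induced by $\mathbb R^N$ and the Riemannian volume $dx$. Let $f\in C^1(\Omega)$, let $p\in C^\infty(\Omega)$ be a probability density with respect to $dx$ with $0<a\le p(x)\le b<\infty$ on $\Omega$, let $X_1,X_2,\dots$ be i.i.d. random points with density $p$, and let $\alpha\in\mathbb R$. For $t>0$ and $n\ge 1$ put $$w_t(x,y)=t^{-d/2}e^{-\|x-y\|_{\mathbb R^N}^2/t},\qquad d_{t,n}(X_i)=\frac1n\sum_{j=1}^n w_t(X_i,X_j),\qquad W_{\alpha,t,n}(i,j)=\frac{w_t(X_i,X_j)}{[d_{t,n}(X_i)\,d_{t,n}(X_j)]^{\alpha}},$$ let $D_{\alpha,t,n}$ be the diagonal matrix with entries $\sum_{j=1}^n W_{\alpha,t,n}(i,j)$, and let $L^u_{\alpha,t,n}=D_{\alpha,t,n}-W_{\alpha,t,n}$ be the unnormalized graph Laplacian. In $f^TL^u_{\alpha,t,n}f$ write $f$ for the vector $(f(X_1),\dots,f(X_n))^T$, so that $f^TL^u_{\alpha,t,n}f=\frac12\sum_{i,j=1}^n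 W_{\alpha,t,n}(i,j)\,(f(X_i)-f(X_j))^2$. Then for every sequence $t=t_n>0$ with $t_n\to0$ and $n^2t_n^{d+2}\to\infty$ as $n\to\infty$, $$\frac1{n^2t_n}\,f^TL^u_{\alpha,t_n,n}f\;\longrightarrow\; C\int_\Omega\|\nabla f(x)\|^2\,[p(x)]^{2-2\alpha}\,dx\quad\text{in probability},\qquad C=\tfrac14\,\pi^{d(1/2-\alpha)},$$ where $\nabla f$ is the Riemannian gradient of $f$ on $\Omega$ and the integral on the right is finite. -/

import Mathlib

open MeasureTheory ProbabilityTheory Filter Topology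
open scoped ContDiff Matrix

namespace GraphLaplacian

/-- Local model, inside `ℝ^N`, of a `d`-dimensional submanifold with boundary: the half space
`{y | 0 ≤ y₀}` of the coordinate subspace `ℝ^d × {0}` (a single point when `d = 0`).
Points with `0 < y₀` are interior points, points with `y₀ = 0` are boundary points. -/
def halfSpaceModel (N d : ℕ) : Set (EuclideanSpace ℝ (Fin N)) :=
  {y | (∀ i : Fin N, d ≤ (i : ℕ) → y i = 0) ∧ (∀ i : Fin N, (i : ℕ) = 0 → 0 ≤ y i)}

/-- `M` is a smooth embedded `d`-dimensional submanifold of `ℝ^N` with (possibly empty) smooth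
boundary: around each of its points, a smooth diffeomorphism between open subsets of `ℝ^N`
straightens `M` to the half space model. -/
def IsSubmanifoldWithBoundary {N : ℕ} (d : ℕ) (M : Set (EuclideanSpace ℝ (Fin N))) : Prop :=
  d ≤ N ∧ ∀ x ∈ M,
    ∃ φ : OpenPartialHomeomorph (EuclideanSpace ℝ (Fin N)) (EuclideanSpace ℝ (Fin N)),
      x ∈ φ.source ∧ ContDiffOn ℝ ∞ φ φ.source ∧ ContDiffOn ℝ ∞ φ.symm φ.target ∧
        φ '' (M ∩ φ.source) = halfSpaceModel N d ∩ φ.target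

/-- The `d`-dimensional Riemannian volume of `M ⊆ ℝ^N` for the metric induced by `ℝ^N`:
the `d`-dimensional Hausdorff measure, normalized to agree with Lebesgue measure on `ℝ^d`,
restricted to `M`. -/
noncomputable def riemannianVolume {N : ℕ} (d : ℕ) (M : Set (EuclideanSpace ℝ (Fin N))) :
    Measure (EuclideanSpace ℝ (Fin N)) :=
  (Measure.euclideanHausdorffMeasure d).restrict M

/-- The tangent space of `M` at `x`, the linear span of the tangent cone (at a boundary point of
a submanifold the cone is not a linear space, but its span is the full tangent space). -/
noncomputable def tangentSpace {N : ℕ} (M : Set (EuclideanSpace ℝ (Fin N)))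
    (x : EuclideanSpace ℝ (Fin N)) : Submodule ℝ (EuclideanSpace ℝ (Fin N)) :=
  Submodule.span ℝ (tangentConeAt ℝ M x)

/-- The Riemannian gradient at `x` of a function on `M`: the vector of the tangent space that
represents the differential. All derivatives of `f` within `M` at `x` agree on the tangent space,
so this does not depend on the one that `fderivWithin` picks, nor on `f` outside `M`. -/
noncomputable def gradientOn {N : ℕ} (M : Set (EuclideanSpace ℝ (Fin N)))
    (f : EuclideanSpace ℝ (Fin N) → ℝ) (x : EuclideanSpace ℝ (Fin N)) : tangentSpace M x :=
  (InnerProductSpace.toDual ℝ (tangentSpace M x)).symm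
    ((fderivWithin ℝ f M x).comp (tangentSpace M x).subtypeL)

/-- The Gaussian weight `w_t(x, y) = t^{-d/2} exp (-‖x - y‖² / t)`. -/
noncomputable def gaussianWeight {N : ℕ} (d : ℕ) (t : ℝ) (x y : EuclideanSpace ℝ (Fin N)) : ℝ :=
  1 / t ^ ((d : ℝ) / 2) * Real.exp (-(‖x - y‖ ^ 2 / t))

/-- The weight matrix `W_{t,n}` of the points `x₁, …, xₙ`. -/
noncomputable def weightMatrix {N n : ℕ} (d : ℕ) (t : ℝ)
    (x : Fin n → EuclideanSpace ℝ (Fin N)) : Matrix (Fin n) (Fin n) ℝ :=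
  Matrix.of fun i j => gaussianWeight d t (x i) (x j)

/-- The empirical degree `d_{t,n}(x_i) = (1/n) ∑_j w_t(x_i, x_j)`. -/
noncomputable def empiricalDegree {N n : ℕ} (d : ℕ) (t : ℝ)
    (x : Fin n → EuclideanSpace ℝ (Fin N)) (i : Fin n) : ℝ :=
  1 / (n : ℝ) * ∑ j, weightMatrix d t x i j

/-- The normalized weight matrix `W_{α,t,n} = D_{t,n}^{-α} W_{t,n} D_{t,n}^{-α}`, with entries
`w_t(x_i, x_j) / (d_{t,n}(x_i) d_{t,n}(x_j))^α`. -/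
noncomputable def normalizedWeightMatrix {N n : ℕ} (d : ℕ) (α t : ℝ)
    (x : Fin n → EuclideanSpace ℝ (Fin N)) : Matrix (Fin n) (Fin n) ℝ :=
  Matrix.diagonal (fun i => empiricalDegree d t x i ^ (-α)) * weightMatrix d t x *
    Matrix.diagonal (fun i => empiricalDegree d t x i ^ (-α))

/-- The unnormalized graph Laplacian `L^u_{α,t,n} = D_{α,t,n} - W_{α,t,n}`, where `D_{α,t,n}` is
the diagonal matrix of the row sums of `W_{α,t,n}`. -/
noncomputable def unnormalizedLaplacian {N n : ℕ} (d : ℕ) (α t : ℝ)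
    (x : Fin n → EuclideanSpace ℝ (Fin N)) : Matrix (Fin n) (Fin n) ℝ :=
  Matrix.diagonal (fun i => ∑ j, normalizedWeightMatrix d α t x i j) -
    normalizedWeightMatrix d α t x

/-- The graph Laplacian regularizer `fᵀ L^u_{α,t,n} f`, with `f` the vector
`(f(x₁), …, f(xₙ))`. -/
noncomputable def regularizer {N n : ℕ} (d : ℕ) (α t : ℝ)
    (f : EuclideanSpace ℝ (Fin N) → ℝ) (x : Fin n → EuclideanSpace ℝ (Fin N)) : ℝ :=
  (fun i => f (x i)) ⬝ᵥ (unnormalizedLaplacian d α t x *ᵥ fun i => f (x i))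

end GraphLaplacian

/-! The regularizer divided by `n² t` is a double average, over pairs of sample points, of a kernel
`energyKernel` of Gaussian shape and width `√t`, weighted by powers `-α` of the empirical degrees.
Its convergence splits into a probabilistic and a geometric part.

Probability. Given `X_i`, a degree is a mean of i.i.d. terms (apart from the diagonal one) with
values in `[0, t^{-d/2}]` and bounded expectation. The variance of such a term is controlled by its
mean, so the Chernoff bound is `exp(-κ n t^{d/2})`. Since `n² t^{d+2} = (n t^{d/2} · t)²`,
eventually `n t^{d/2} ≥ 1/t`; then `n` is at most a power of `n t^{d/2}`, and a union bound over all
`n` points costs nothing. With high probability all degrees are thus relatively close to their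
means, which may replace them. The resulting double sum is treated by the same inequality, row by
row and then for the average of the row means (`measure_pi_regularizer_deviation_le`). What remains
is the limit of the expected energy.

Geometry. At an interior point `x`, orthogonal projection to the tangent space is bi-Lipschitz with
constants tending to 1, so Hausdorff measure and Gaussian weights may be compared with those of
`ℝ^d` without any Jacobian. Rescaling by `√t` gives the limits of the integrals
(`IsBlowUp.tendsto_lintegral`). The degree tends to `π^{d/2} p(x)`, jointly in the time and the
centre, and the local energy tends to `p (π^{d/2} p)^{-2α} · ½ ∫ e^{-|u|²} (df u)² du`, where the
last integral equals `π^{d/2} |∇f|² / 2`. Integrating against `p dx` gives the constant `¼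
π^{d(1/2-α)}` and the power `p^{2-2α}`.

Near the boundary the degrees need not have this limit, but they stay between positive constants
uniformly on `M` (`exists_degree_bounds`). As boundary points form a null set, dominated convergence
concludes. -/

namespace GraphLaplacian

/-! ### Concentration of empirical degrees. -/

/-- A random variable with values in `[0, 1]` has an exponential moment of Poisson type. -/
theorem lintegral_exp_le_one {E : Type*} [MeasurableSpace E] (ν : Measure E)
    [IsProbabilityMeasure ν] {g : E → ℝ} (hg : Measurable g) (h0 : ∀ y, 0 ≤ g y)
    (h1 : ∀ y, g y ≤ 1) {l : ℝ} (hl : |l| ≤ 1) :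
    ∫⁻ y, ENNReal.ofReal (Real.exp (l * g y - (l + l ^ 2) * ∫ z, g z ∂ν)) ∂ν ≤ 1 := by
  have hgi : Integrable g ν := by
    refine Integrable.of_bound hg.aestronglyMeasurable 1 (ae_of_all _ fun y => ?_)
    rw [Real.norm_eq_abs, abs_of_nonneg (h0 y)]
    exact h1 y
  have hlg : ∀ y, |l * g y| ≤ 1 := fun y => by
    rw [abs_mul, abs_of_nonneg (h0 y)]
    exact mul_le_one₀ hl (h0 y) (h1 y)
  have hei : Integrable (fun y => Real.exp (l * g y)) ν := by
    refine Integrable.of_bound (by fun_prop) (Real.exp 1) (ae_of_all _ fun y => ?_)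
    rw [Real.norm_eq_abs, Real.abs_exp]
    exact Real.exp_le_exp.2 ((le_abs_self _).trans (hlg y))
  set G := ∫ z, g z ∂ν
  have key : ∫ y, Real.exp (l * g y) ∂ν ≤ Real.exp ((l + l ^ 2) * G) := by
    calc ∫ y, Real.exp (l * g y) ∂ν ≤ ∫ y, (1 + (l + l ^ 2) * g y) ∂ν := by
          refine integral_mono hei ((integrable_const _).add (hgi.const_mul _)) fun y => ?_
          -- `e^u ≤ 1 + u + u²` for `|u| ≤ 1`, and `g² ≤ g`: the second-order term is paid for by
          -- the mean of `g`, not by the square of its range.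
          have h := (abs_le.1 (Real.abs_exp_sub_one_sub_id_le (hlg y))).2
          have h2 : (l * g y) ^ 2 ≤ l ^ 2 * g y := by
            rw [mul_pow]
            refine mul_le_mul_of_nonneg_left ?_ (sq_nonneg l)
            nlinarith [h0 y, h1 y]
          simp only
          linarith
      _ = (l + l ^ 2) * G + 1 := by
          rw [integral_add (integrable_const _) (hgi.const_mul _), integral_const_mul]
          simp [G, add_comm]
      _ ≤ _ := Real.add_one_le_exp _
  rw [← ofReal_integral_eq_lintegral_ofReal]
  · rw [ENNReal.ofReal_le_one]
    simp_rw [Real.exp_sub, integral_div]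
    rw [div_le_one (Real.exp_pos _)]
    exact key
  · simp_rw [Real.exp_sub]
    exact hei.div_const _
  · exact ae_of_all _ fun y => (Real.exp_pos _).le

/-- Conditionally on `x i` the other coordinates are independent, so Fubini turns the integral into
a product of factors covered by `lintegral_exp_le_one`. The map `i.succAbove` omits the diagonal
term, which is not independent of `x i`. -/
theorem lintegral_pi_exp_sum_le_one {E : Type*} [MeasurableSpace E] (ν : Measure E)
    [IsProbabilityMeasure ν] {g : E → E → ℝ} (hg : Measurable (Function.uncurry g))
    (h0 : ∀ x y, 0 ≤ g x y) (h1 : ∀ x y, g x y ≤ 1) {l : ℝ} (hl : |l| ≤ 1) {n : ℕ}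
    (i : Fin (n + 1)) :
    ∫⁻ x, ENNReal.ofReal (Real.exp (∑ j : Fin n,
      (l * g (x i) (x (i.succAbove j)) - (l + l ^ 2) * ∫ z, g (x i) z ∂ν)))
        ∂(Measure.pi fun _ : Fin (n + 1) => ν) ≤ 1 := by
  have hG : Measurable fun x => ∫ z, g x z ∂ν :=
    (hg.stronglyMeasurable.integral_prod_right (ν := ν)).measurable
  let F : E × (Fin n → E) → ENNReal := fun z => ENNReal.ofReal (Real.exp (∑ j : Fin n,
      (l * g z.1 (z.2 j) - (l + l ^ 2) * ∫ y, g z.1 y ∂ν)))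
  have hF : Measurable F := by
    refine (Real.measurable_exp.comp (Finset.measurable_fun_sum _ fun j _ => ?_)).ennreal_ofReal
    refine ((hg.comp (?_ : Measurable fun z : E × (Fin n → E) => (z.1, z.2 j))).const_mul l).sub
      ((hG.comp measurable_fst).const_mul _)
    fun_prop
  have := (measurePreserving_piFinSuccAbove (fun _ : Fin (n + 1) => ν) i).lintegral_comp hF
  calc _ = ∫⁻ x, F x ∂(ν.prod (Measure.pi fun _ : Fin n => ν)) := this
    _ = ∫⁻ x, ∫⁻ y, F (x, y) ∂(Measure.pi fun _ : Fin n => ν) ∂ν :=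
      lintegral_prod _ hF.aemeasurable
    _ ≤ ∫⁻ x, 1 ∂ν := by
      refine lintegral_mono fun x => ?_
      have hx : Measurable fun y : E =>
          ENNReal.ofReal (Real.exp (l * g x y - (l + l ^ 2) * ∫ z, g x z ∂ν)) := by
        have : Measurable (g x) := hg.comp measurable_prodMk_left
        fun_prop
      have hF' : (fun y => F (x, y)) = fun y : Fin n → E => ∏ j : Fin n,
          ENNReal.ofReal (Real.exp (l * g x (y j) - (l + l ^ 2) * ∫ z, g x z ∂ν)) := by
        ext y
        rw [← ENNReal.ofReal_prod_of_nonneg fun _ _ => (Real.exp_pos _).le, ← Real.exp_sum]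
      simp only [hF']
      rw [lintegral_prod_eq_prod_lintegral_of_indepFun (μ := Measure.pi fun _ : Fin n => ν)
        Finset.univ _ (iIndepFun_pi fun _ => hx.aemeasurable) fun j =>
          hx.comp (measurable_pi_apply j)]
      refine Finset.prod_le_one' fun j _ => ?_
      rw [(measurePreserving_eval (fun _ : Fin n => ν) j).lintegral_comp hx]
      exact lintegral_exp_le_one ν (hg.comp measurable_prodMk_left) (h0 x) (h1 x) hl
    _ = 1 := by simp

/-- Chernoff's method for `g / B` with exponents `±ε`. The three multiples of `ε * C` are the
second-order bias `l²` times the mean, the Chernoff threshold, and a term at most `B ≤ ε C n`: the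
diagonal entry for the upper bound, one missing copy of the mean for the lower bound. -/
theorem measure_pi_deviation_le {E : Type*} [MeasurableSpace E] (ν : Measure E)
    [IsProbabilityMeasure ν] {g : E → E → ℝ} (hg : Measurable (Function.uncurry g))
    {B C ε : ℝ} (hBpos : 0 < B) (hC : 0 < C) (hε : 0 < ε) (hε1 : ε ≤ 1)
    (h0 : ∀ x y, 0 ≤ g x y) (hB : ∀ x y, g x y ≤ B) (hGC : ∀ᵐ x ∂ν, ∫ y, g x y ∂ν ≤ C)
    {n : ℕ} (hn : B ≤ ε * C * n) (i : Fin n) :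
    (Measure.pi fun _ : Fin n => ν)
      {x | 3 * ε * C ≤ |1 / (n : ℝ) * ∑ j, g (x i) (x j) - ∫ y, g (x i) y ∂ν|} ≤
        2 * ENNReal.ofReal (Real.exp (-(ε ^ 2 * C * n / B))) := by
  obtain ⟨m, rfl⟩ : ∃ m, n = m + 1 := ⟨n - 1, by have := i.pos; omega⟩
  set Q := Measure.pi fun _ : Fin (m + 1) => ν
  set s : ℝ := ε ^ 2 * C * (m + 1 : ℕ) / B
  let g' : E → E → ℝ := fun x y => g x y / B
  have hg' : Measurable (Function.uncurry g') := hg.div_const B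
  have hG' : ∀ x, ∫ y, g' x y ∂ν = (∫ y, g x y ∂ν) / B := fun x => integral_div _ _
  let S : ℝ → (Fin (m + 1) → E) → ℝ := fun l x => ∑ j : Fin m,
      (l * g' (x i) (x (i.succAbove j)) - (l + l ^ 2) * ∫ z, g' (x i) z ∂ν)
  have hG : Measurable fun x => ∫ z, g' x z ∂ν :=
    (hg'.stronglyMeasurable.integral_prod_right (ν := ν)).measurable
  have hS : ∀ l, Measurable (S l) := fun l => by
    refine Finset.measurable_fun_sum _ fun j _ => ?_
    refine ((hg'.comp (?_ : Measurable fun z : Fin (m + 1) → E =>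
      (z i, z (i.succAbove j)))).const_mul l).sub
      ((hG.comp (measurable_pi_apply i)).const_mul _)
    fun_prop
  have markov : ∀ l, |l| ≤ 1 → Q {x | s ≤ S l x} ≤ ENNReal.ofReal (Real.exp (-s)) := by
    intro l hl
    have h1 := lintegral_pi_exp_sum_le_one ν hg' (fun x y => div_nonneg (h0 x y) hBpos.le)
      (fun x y => (div_le_one hBpos).2 (hB x y)) hl i
    have h2 := mul_meas_ge_le_lintegral₀ (μ := Q)
      (f := fun x => ENNReal.ofReal (Real.exp (S l x))) (by fun_prop) (ENNReal.ofReal (Real.exp s))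
    have h3 := h2.trans h1
    have h4 : {x | s ≤ S l x} ⊆
        {x | ENNReal.ofReal (Real.exp s) ≤ ENNReal.ofReal (Real.exp (S l x))} := fun x hx =>
      ENNReal.ofReal_le_ofReal (Real.exp_le_exp.2 hx)
    rw [Real.exp_neg, ENNReal.ofReal_inv_of_pos (Real.exp_pos _)]
    refine (measure_mono h4).trans ?_
    rw [ENNReal.le_inv_iff_mul_le, mul_comm]
    exact h3
  have hae : ∀ᵐ x ∂Q, ∫ y, g (x i) y ∂ν ≤ C :=
    (measurePreserving_eval (fun _ : Fin (m + 1) => ν) i).quasiMeasurePreserving.ae hGC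
  have hsub : ∀ᵐ x ∂Q, 3 * ε * C ≤
      |1 / ((m + 1 : ℕ) : ℝ) * ∑ j, g (x i) (x j) - ∫ y, g (x i) y ∂ν| →
      x ∈ {x | s ≤ S ε x} ∪ {x | s ≤ S (-ε) x} := by
    filter_upwards [hae] with x hx h3
    by_contra hcon
    simp only [Set.mem_union, Set.mem_ofPred_eq, not_or, not_le] at hcon
    obtain ⟨hp, hm⟩ := hcon
    have hSval : ∀ l, S l x * B = l * (∑ j : Fin m, g (x i) (x (i.succAbove j)))
        - (l + l ^ 2) * (m * ∫ y, g (x i) y ∂ν) := by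
      intro l
      simp only [S, Finset.sum_sub_distrib, ← Finset.mul_sum, hG', g', ← Finset.sum_div]
      simp only [Finset.sum_const, Finset.card_univ, Fintype.card_fin, nsmul_eq_mul]
      field_simp
    have hp' := mul_lt_mul_of_pos_right hp hBpos
    have hm' := mul_lt_mul_of_pos_right hm hBpos
    rw [hSval] at hp' hm'
    have hsB : s * B = ε ^ 2 * C * (m + 1) := by simp [s]; field_simp
    rw [hsB] at hp' hm'
    have hsum : ∑ j, g (x i) (x j) =
        g (x i) (x i) + ∑ j : Fin m, g (x i) (x (i.succAbove j)) :=
      Fin.sum_univ_succAbove _ i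
    rw [hsum] at h3
    set A := ∑ j : Fin m, g (x i) (x (i.succAbove j))
    set G := ∫ y, g (x i) y ∂ν with hGdef
    have hG0 : 0 ≤ G := integral_nonneg (h0 _)
    have hGB : G ≤ B := by
      have hi : Integrable (g (x i)) ν := by
        refine Integrable.of_bound (hg.comp measurable_prodMk_left).aestronglyMeasurable B
          (ae_of_all _ fun y => ?_)
        rw [Real.norm_eq_abs, abs_of_nonneg (h0 _ y)]
        exact hB _ y
      have := integral_mono hi (integrable_const B) (hB (x i))
      simpa using this
    have hgn := h0 (x i) (x i)
    have hgB := hB (x i) (x i)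
    have hm0 : (0 : ℝ) ≤ m := Nat.cast_nonneg m
    push_cast at h3 hn
    have hA1 : A < (1 + ε) * (m * G) + ε * C * (m + 1) := by
      have : ε * A < ε * ((1 + ε) * (m * G) + ε * C * (m + 1)) := by linarith
      exact lt_of_mul_lt_mul_left this hε.le
    have hA2 : (1 - ε) * (m * G) - ε * C * (m + 1) < A := by
      have : ε * ((1 - ε) * (m * G) - ε * C * (m + 1)) < ε * A := by linarith
      exact lt_of_mul_lt_mul_left this hε.le
    have hmG : ε * (m * G) ≤ ε * C * m := by
      have : (m : ℝ) * G ≤ m * C := mul_le_mul_of_nonneg_left hx hm0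
      nlinarith
    have hεC : 0 < ε * C := mul_pos hε hC
    have hn0 : (0 : ℝ) < m + 1 := by positivity
    refine absurd h3 (not_le.2 (abs_lt.2 ⟨?_, ?_⟩))
    · rw [neg_lt_sub_iff_lt_add, one_div, inv_mul_eq_div, ← sub_lt_iff_lt_add', lt_div_iff₀ hn0]
      linarith
    · rw [sub_lt_iff_lt_add, one_div, inv_mul_eq_div, div_lt_iff₀ hn0]
      linarith
  calc _ ≤ Q ({x | s ≤ S ε x} ∪ {x | s ≤ S (-ε) x}) := measure_mono_ae hsub
    _ ≤ Q {x | s ≤ S ε x} + Q {x | s ≤ S (-ε) x} := measure_union_le _ _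
    _ ≤ _ := by
      rw [two_mul]
      refine add_le_add (markov _ ?_) (markov _ ?_)
      · rwa [abs_of_pos hε]
      · rwa [abs_neg, abs_of_pos hε]

end GraphLaplacian

namespace GraphLaplacian

theorem measure_pi_exists_deviation_le {E : Type*} [MeasurableSpace E] (ν : Measure E)
    [IsProbabilityMeasure ν] {g : E → E → ℝ} (hg : Measurable (Function.uncurry g))
    {B C ε : ℝ} (hBpos : 0 < B) (hC : 0 < C) (hε : 0 < ε) (hε1 : ε ≤ 1)
    (h0 : ∀ x y, 0 ≤ g x y) (hB : ∀ x y, g x y ≤ B) (hGC : ∀ᵐ x ∂ν, ∫ y, g x y ∂ν ≤ C)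
    {n : ℕ} (hn : B ≤ ε * C * n) {κ : ℝ} (hκ : κ ≤ ε ^ 2 * C * n / B) :
    (Measure.pi fun _ : Fin n => ν) {x | ∃ i,
      3 * ε * C ≤ |1 / (n : ℝ) * ∑ j, g (x i) (x j) - ∫ y, g (x i) y ∂ν|} ≤
        ENNReal.ofReal (2 * (n * Real.exp (-κ))) := by
  rw [show {x : Fin n → E | ∃ i,
      3 * ε * C ≤ |1 / (n : ℝ) * ∑ j, g (x i) (x j) - ∫ y, g (x i) y ∂ν|} = ⋃ i, {x : Fin n → E |
      3 * ε * C ≤ |1 / (n : ℝ) * ∑ j, g (x i) (x j) - ∫ y, g (x i) y ∂ν|} by ext; simp]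
  calc _ ≤ ∑ i : Fin n, (Measure.pi fun _ : Fin n => ν) {x : Fin n → E |
      3 * ε * C ≤ |1 / (n : ℝ) * ∑ j, g (x i) (x j) - ∫ y, g (x i) y ∂ν|} :=
        measure_iUnion_fintype_le _ _
    _ ≤ ∑ i : Fin n, 2 * ENNReal.ofReal (Real.exp (-κ)) := by
      refine Finset.sum_le_sum fun i _ =>
        (measure_pi_deviation_le ν hg hBpos hC hε hε1 h0 hB hGC hn i).trans ?_
      gcongr
    _ = _ := by
      rw [Finset.sum_const, Finset.card_univ, Fintype.card_fin, nsmul_eq_mul,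
        ENNReal.ofReal_mul (by norm_num), ENNReal.ofReal_mul (by positivity)]
      simp
      ring

/-! ### Replacing empirical degrees by their means. -/

/-- Clamping to the interval `[c, C]`. -/
noncomputable def clamp (c C x : ℝ) : ℝ := max c (min C x)

theorem measurable_clamp (c C : ℝ) : Measurable (clamp c C) :=
  measurable_const.max (measurable_const.min measurable_id)

theorem clamp_of_mem {c C x : ℝ} (h1 : c ≤ x) (h2 : x ≤ C) : clamp c C x = x := by
  rw [clamp, min_eq_right h2, max_eq_right h1]

theorem le_clamp (c C x : ℝ) : c ≤ clamp c C x := le_max_left _ _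

theorem clamp_le {c C : ℝ} (h : c ≤ C) (x : ℝ) : clamp c C x ≤ C := max_le h (min_le_left _ _)

/-- The kernel `h`, renormalized by the clamped degrees of `w`. -/
noncomputable def renormKernel {E : Type*} [MeasurableSpace E] (ν : Measure E)
    (w h : E → E → ℝ) (α c C : ℝ) (x y : E) : ℝ :=
  h x y * (clamp c C (∫ z, w x z ∂ν) ^ (-α) * clamp c C (∫ z, w y z ∂ν) ^ (-α))

theorem measurable_renormKernel {E : Type*} [MeasurableSpace E] (ν : Measure E) [SFinite ν]
    {w h : E → E → ℝ} (hw : Measurable (Function.uncurry w)) (hh : Measurable (Function.uncurry h))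
    (α c C : ℝ) : Measurable (Function.uncurry (renormKernel ν w h α c C)) := by
  have hq : Measurable fun x => clamp c C (∫ z, w x z ∂ν) ^ (-α) :=
    ((measurable_clamp c C).comp
      (hw.stronglyMeasurable.integral_prod_right (ν := ν)).measurable).pow_const _
  exact hh.mul ((hq.comp measurable_fst).mul (hq.comp measurable_snd))

theorem exists_rpow_le {c C : ℝ} (hc : 0 < c) (α : ℝ) :
    ∃ D, 1 ≤ D ∧ ∀ u, c ≤ u → u ≤ C → u ^ (-α) ≤ D := by
  have : ContinuousOn (fun u : ℝ => u ^ (-α)) (Set.Icc c C) := fun u hu =>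
    (Real.continuousAt_rpow_const u _ (Or.inl (hc.trans_le hu.1).ne')).continuousWithinAt
  obtain ⟨D, hD⟩ := isCompact_Icc.bddAbove_image this
  exact ⟨max D 1, le_max_right _ _, fun u h1 h2 =>
    (hD ⟨u, ⟨h1, h2⟩, rfl⟩).trans (le_max_left _ _)⟩

/-- The error is relative: `e^{-α} = q^{-α} (e/q)^{-α}`, so every nonnegative summand changes by a
factor within `η` of 1, and so does their sum. No bound on the individual summands is needed. -/
theorem abs_sum_renorm_sub_le {n : ℕ} {h : Fin n → Fin n → ℝ} (h0 : ∀ i j, 0 ≤ h i j)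
    {q e : Fin n → ℝ} {α δ η : ℝ} (hq : ∀ i, 0 < q i) (he : ∀ i, |e i / q i - 1| ≤ δ)
    (hδ : δ < 1)
    (hη : ∀ u v : ℝ, |u - 1| ≤ δ → |v - 1| ≤ δ → |u ^ (-α) * v ^ (-α) - 1| ≤ η) :
    |∑ i, ∑ j, h i j * (e i ^ (-α) * e j ^ (-α)) - ∑ i, ∑ j, h i j * (q i ^ (-α) * q j ^ (-α))| ≤
      η * ∑ i, ∑ j, h i j * (q i ^ (-α) * q j ^ (-α)) := by
  rw [← Finset.sum_sub_distrib, Finset.mul_sum]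
  refine (Finset.abs_sum_le_sum_abs _ _).trans (Finset.sum_le_sum fun i _ => ?_)
  rw [← Finset.sum_sub_distrib, Finset.mul_sum]
  refine (Finset.abs_sum_le_sum_abs _ _).trans (Finset.sum_le_sum fun j _ => ?_)
  have hr : ∀ i, e i ^ (-α) = q i ^ (-α) * (e i / q i) ^ (-α) := fun i => by
    have : 0 ≤ e i / q i := by have := (abs_le.1 (he i)).1; linarith
    rw [← Real.mul_rpow (hq i).le this, mul_div_cancel₀ _ (hq i).ne']
  rw [hr i, hr j, show h i j * (q i ^ (-α) * (e i / q i) ^ (-α) * (q j ^ (-α) * (e j / q j) ^ (-α)))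
    - h i j * (q i ^ (-α) * q j ^ (-α)) = h i j * (q i ^ (-α) * q j ^ (-α)) *
      ((e i / q i) ^ (-α) * (e j / q j) ^ (-α) - 1) by ring, abs_mul, abs_of_nonneg, mul_comm]
  · refine mul_le_mul_of_nonneg_right (hη _ _ (he i) (he j)) ?_
    exact mul_nonneg (h0 i j) (mul_nonneg (Real.rpow_nonneg (hq i).le _)
      (Real.rpow_nonneg (hq j).le _))
  · exact mul_nonneg (h0 i j) (mul_nonneg (Real.rpow_nonneg (hq i).le _)
      (Real.rpow_nonneg (hq j).le _))

/-- Outside three rare events the degrees are close to their means, each row average of the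
renormalized kernel is close to its conditional mean `J`, and the average of `J` is close to its
integral. The last two steps treat the double sum by the scalar inequality alone. -/
theorem measure_pi_regularizer_deviation_le {E : Type*} [MeasurableSpace E] (ν : Measure E)
    [IsProbabilityMeasure ν] {w h : E → E → ℝ} (hw : Measurable (Function.uncurry w))
    (hh : Measurable (Function.uncurry h)) {B c C D ε α η : ℝ} (hB : 1 ≤ B) (hc : 0 < c)
    (hcC : c ≤ C) (hC : 1 ≤ C) (hD : 1 ≤ D) (hDα : ∀ u, c ≤ u → u ≤ C → u ^ (-α) ≤ D)
    (hε : 0 < ε) (hε1 : ε ≤ 1) (hεc : 3 * ε * C / c < 1)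
    (w0 : ∀ x y, 0 ≤ w x y) (wB : ∀ x y, w x y ≤ B)
    (h0 : ∀ x y, 0 ≤ h x y) (hhB : ∀ x y, h x y ≤ C * B)
    (hcq : ∀ᵐ x ∂ν, c ≤ ∫ y, w x y ∂ν) (hqC : ∀ᵐ x ∂ν, ∫ y, w x y ∂ν ≤ C)
    (hhC : ∀ᵐ x ∂ν, ∫ y, h x y ∂ν ≤ C)
    (hη : ∀ u v : ℝ, |u - 1| ≤ 3 * ε * C / c → |v - 1| ≤ 3 * ε * C / c →
      |u ^ (-α) * v ^ (-α) - 1| ≤ η)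
    {n : ℕ} (hn : B ≤ ε * n) :
    (Measure.pi fun _ : Fin n => ν) {x | 7 * (C * D ^ 2) * η + 6 * ε * (C * D ^ 2) <
      |1 / (n : ℝ) ^ 2 * ∑ i, ∑ j, h (x i) (x j) * ((1 / (n : ℝ) * ∑ k, w (x i) (x k)) ^ (-α) *
        (1 / (n : ℝ) * ∑ k, w (x j) (x k)) ^ (-α)) -
          ∫ x, ∫ y, renormKernel ν w h α c C x y ∂ν ∂ν|} ≤
      ENNReal.ofReal (6 * (n * Real.exp (-(ε ^ 2 * n / B)))) := by
  have hBpos : 0 < B := by linarith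
  have hnpos : (0 : ℝ) < n := by
    by_contra hneg
    have : (n : ℝ) = 0 := le_antisymm (not_lt.1 hneg) (Nat.cast_nonneg n)
    rw [this] at hn
    linarith
  have hnB : 0 ≤ ε ^ 2 * n / B := by positivity
  set Q := Measure.pi fun _ : Fin n => ν
  set K := renormKernel ν w h α c C with hK
  have hKm : Measurable (Function.uncurry K) := measurable_renormKernel ν hw hh α c C
  set q : E → ℝ := fun x => clamp c C (∫ z, w x z ∂ν) with hqdef
  have hqpos : ∀ x, 0 < q x := fun x => hc.trans_le (le_clamp _ _ _)
  have hqD : ∀ x, q x ^ (-α) ≤ D := fun x => hDα _ (le_clamp _ _ _) (clamp_le hcC _)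
  have hqα : ∀ x, 0 ≤ q x ^ (-α) := fun x => Real.rpow_nonneg (hqpos x).le _
  have hfac : ∀ x y, q x ^ (-α) * q y ^ (-α) ≤ D ^ 2 := fun x y => by
    rw [sq]
    exact mul_le_mul (hqD x) (hqD y) (hqα y) (by linarith)
  have hK0 : ∀ x y, 0 ≤ K x y := fun x y =>
    mul_nonneg (h0 x y) (mul_nonneg (hqα x) (hqα y))
  have hKh : ∀ x y, K x y ≤ h x y * D ^ 2 := fun x y =>
    mul_le_mul_of_nonneg_left (hfac x y) (h0 x y)
  have hKB : ∀ x y, K x y ≤ C * D ^ 2 * B := fun x y => by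
    refine (hKh x y).trans ?_
    nlinarith [hhB x y, sq_nonneg D]
  have hCD : 1 ≤ C * D ^ 2 := by nlinarith
  have hKi : ∀ x, Integrable (K x) ν := fun x => by
    refine Integrable.of_bound (hKm.comp measurable_prodMk_left).aestronglyMeasurable
      (C * D ^ 2 * B) (ae_of_all _ fun y => ?_)
    rw [Real.norm_eq_abs, abs_of_nonneg (hK0 _ y)]
    exact hKB _ y
  have hhi : ∀ x, Integrable (h x) ν := fun x => by
    refine Integrable.of_bound (hh.comp measurable_prodMk_left).aestronglyMeasurable
      (C * B) (ae_of_all _ fun y => ?_)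
    rw [Real.norm_eq_abs, abs_of_nonneg (h0 _ y)]
    exact hhB _ y
  have hKC : ∀ᵐ x ∂ν, ∫ y, K x y ∂ν ≤ C * D ^ 2 := by
    filter_upwards [hhC] with x hx
    calc ∫ y, K x y ∂ν ≤ ∫ y, h x y * D ^ 2 ∂ν :=
          integral_mono (hKi x) ((hhi x).mul_const _) (hKh x)
      _ = (∫ y, h x y ∂ν) * D ^ 2 := integral_mul_const _ _
      _ ≤ _ := mul_le_mul_of_nonneg_right hx (sq_nonneg D)
  have hKIm : Measurable fun x => ∫ y, K x y ∂ν :=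
    (hKm.stronglyMeasurable.integral_prod_right (ν := ν)).measurable
  -- The row mean is bounded by `C * D ^ 2` only almost everywhere; the cap makes the bound hold at
  -- every point, as `measure_pi_exists_deviation_le` demands of its kernel.
  set J : E → ℝ := fun x => min (∫ y, K x y ∂ν) (C * D ^ 2) with hJ
  have hJm : Measurable J := hKIm.min measurable_const
  have hJ0 : ∀ x, 0 ≤ J x := fun x => le_min (integral_nonneg (hK0 x)) (by linarith)
  have hJC : ∀ x, J x ≤ C * D ^ 2 := fun x => min_le_right _ _
  have hJK : ∀ᵐ x ∂ν, J x = ∫ y, K x y ∂ν := by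
    filter_upwards [hKC] with x hx using min_eq_left hx
  have hJint : ∫ x, J x ∂ν = ∫ x, ∫ y, K x y ∂ν ∂ν := integral_congr_ae hJK
  have hJi : Integrable J ν := by
    refine Integrable.of_bound hJm.aestronglyMeasurable (C * D ^ 2) (ae_of_all _ fun y => ?_)
    rw [Real.norm_eq_abs, abs_of_nonneg (hJ0 y)]
    exact hJC _
  have hJle : ∫ x, J x ∂ν ≤ C * D ^ 2 := by
    have := integral_mono hJi (integrable_const (C * D ^ 2)) hJC
    simpa using this
  have hεn : 0 < ε * n := by positivity
  have e1 := measure_pi_exists_deviation_le ν hw hBpos (by linarith) hε hε1 w0 wB hqC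
    (n := n) (κ := ε ^ 2 * n / B) (by nlinarith) (by gcongr; nlinarith [sq_nonneg ε])
  have e2 := measure_pi_exists_deviation_le ν hKm (B := C * D ^ 2 * B) (by positivity)
    (by linarith) hε hε1 hK0 hKB hKC (n := n) (κ := ε ^ 2 * n / B) (by nlinarith)
    (le_of_eq (by field_simp))
  have e3 := measure_pi_exists_deviation_le ν (g := fun _ y => J y)
    (hJm.comp measurable_snd) (B := C * D ^ 2) (C := C * D ^ 2) (by linarith)
    (by linarith) hε hε1 (fun _ => hJ0) (fun _ => hJC) (ae_of_all _ fun _ => hJle)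
    (n := n) (κ := ε ^ 2 * n / B) (by nlinarith)
    (by
      rw [show ε ^ 2 * (C * D ^ 2) * n / (C * D ^ 2) = ε ^ 2 * n by field_simp]
      exact div_le_self (by positivity) hB)
  have haeall : ∀ p : E → Prop, (∀ᵐ x ∂ν, p x) → ∀ᵐ x ∂Q, ∀ i, p (x i) := fun p hp =>
    ae_all_iff.2 fun i =>
      (measurePreserving_eval (fun _ : Fin n => ν) i).quasiMeasurePreserving.ae hp
  set S1 := {x : Fin n → E | ∃ i,
      3 * ε * C ≤ |1 / (n : ℝ) * ∑ j, w (x i) (x j) - ∫ y, w (x i) y ∂ν|}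
  set S2 := {x : Fin n → E | ∃ i,
      3 * ε * (C * D ^ 2) ≤ |1 / (n : ℝ) * ∑ j, K (x i) (x j) - ∫ y, K (x i) y ∂ν|}
  set S3 := {x : Fin n → E | ∃ _ : Fin n,
      3 * ε * (C * D ^ 2) ≤ |1 / (n : ℝ) * ∑ j, J (x j) - ∫ y, J y ∂ν|}
  calc _ ≤ Q (S1 ∪ S2 ∪ S3) := by
        refine measure_mono_ae ?_
        filter_upwards [haeall _ hcq, haeall _ hqC, haeall _ hJK] with x hxc hxC hxJ hx
        by_contra hcon
        change x ∉ S1 ∪ S2 ∪ S3 at hcon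
        simp only [Set.mem_union, not_or, S1, S2, S3, Set.mem_ofPred_eq, not_exists, not_le] at hcon
        obtain ⟨⟨f1, f2⟩, f3⟩ := hcon
        have f3 := f3 ⟨0, by exact_mod_cast hnpos⟩
        refine absurd hx (not_lt.2 ?_)
        have hqx : ∀ i, q (x i) = ∫ y, w (x i) y ∂ν := fun i => clamp_of_mem (hxc i) (hxC i)
        have hratio : ∀ i, |(1 / (n : ℝ) * ∑ k, w (x i) (x k)) / q (x i) - 1| ≤ 3 * ε * C / c := by
          intro i
          rw [div_sub_one (hqpos _).ne', abs_div, abs_of_pos (hqpos _)]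
          refine div_le_div₀ (by positivity) ?_ hc (le_clamp _ _ _)
          rw [hqx]
          exact (f1 i).le
        have hdev := abs_sum_renorm_sub_le (h := fun i j => h (x i) (x j)) (fun i j => h0 _ _)
          (fun i => hqpos (x i)) hratio hεc hη
        change |_ - ∑ i, ∑ j, K (x i) (x j)| ≤ η * ∑ i, ∑ j, K (x i) (x j) at hdev
        set R := ∑ i, ∑ j, h (x i) (x j) * ((1 / (n : ℝ) * ∑ k, w (x i) (x k)) ^ (-α) *
          (1 / (n : ℝ) * ∑ k, w (x j) (x k)) ^ (-α))
        set V := ∑ i, ∑ j, K (x i) (x j) with hV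
        rw [← hJint]
        have hVJ : |1 / (n : ℝ) ^ 2 * V - 1 / (n : ℝ) * ∑ j, J (x j)| ≤ 3 * ε * (C * D ^ 2) := by
          have : 1 / (n : ℝ) ^ 2 * V - 1 / (n : ℝ) * ∑ j, J (x j) =
              1 / (n : ℝ) * ∑ i, (1 / (n : ℝ) * ∑ j, K (x i) (x j) - J (x i)) := by
            rw [Finset.sum_sub_distrib, ← Finset.mul_sum, hV]
            field_simp
          rw [this, abs_mul, abs_of_pos (by positivity : 0 < 1 / (n : ℝ)), one_div,
            inv_mul_le_iff₀ hnpos]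
          refine (Finset.abs_sum_le_sum_abs _ _).trans ?_
          calc _ ≤ ∑ i : Fin n, 3 * ε * (C * D ^ 2) := by
                refine Finset.sum_le_sum fun i _ => ?_
                have := (f2 i).le
                rwa [← hxJ i, one_div] at this
            _ = _ := by simp
        have hη0 : 0 ≤ η := by
          have := hη 1 1 (by simpa using by positivity) (by simpa using by positivity)
          exact (abs_nonneg _).trans this
        have hRV : |1 / (n : ℝ) ^ 2 * R - 1 / (n : ℝ) ^ 2 * V| ≤ η * (1 / (n : ℝ) ^ 2 * V) := by
          rw [← mul_sub, abs_mul, abs_of_pos (by positivity : 0 < 1 / (n : ℝ) ^ 2), mul_left_comm]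
          exact mul_le_mul_of_nonneg_left hdev (by positivity)
        have f3 := abs_lt.1 f3
        have g1 := abs_le.1 hVJ
        have g2 := abs_le.1 hRV
        set v := 1 / (n : ℝ) ^ 2 * V
        -- The integral of `J` contributes 1, and the two deviations contribute 3 each because `ε ≤
        -- 1`.
        have hv : v ≤ 7 * (C * D ^ 2) := by
          have : ε * (C * D ^ 2) ≤ 1 * (C * D ^ 2) :=
            mul_le_mul_of_nonneg_right hε1 (by linarith)
          linarith
        have hηv : η * v ≤ 7 * (C * D ^ 2) * η := by
          rw [mul_comm]
          exact mul_le_mul_of_nonneg_right hv hη0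
        rw [abs_le]
        constructor <;> linarith
    _ ≤ Q S1 + Q S2 + Q S3 := (measure_union_le _ _).trans (by gcongr; exact measure_union_le _ _)
    _ ≤ _ := by
      rw [show 6 * ((n : ℝ) * Real.exp (-(ε ^ 2 * n / B))) =
        2 * (n * Real.exp (-(ε ^ 2 * n / B))) + 2 * (n * Real.exp (-(ε ^ 2 * n / B))) +
        2 * (n * Real.exp (-(ε ^ 2 * n / B))) by ring, ENNReal.ofReal_add (by positivity)
        (by positivity), ENNReal.ofReal_add (by positivity) (by positivity)]
      exact add_le_add (add_le_add e1 e2) e3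

/-- The renormalized energy of a sample converges in probability, as soon as its mean does. -/
theorem tendsto_measure_pi_regularizer {E : Type*} [MeasurableSpace E] (ν : Measure E)
    [IsProbabilityMeasure ν] {w h : ℕ → E → E → ℝ} (hw : ∀ n, Measurable (Function.uncurry (w n)))
    (hh : ∀ n, Measurable (Function.uncurry (h n))) {B : ℕ → ℝ} {c C α ℓ : ℝ}
    (hB : ∀ᶠ n in atTop, 1 ≤ B n) (hc : 0 < c) (hcC : c ≤ C) (hC : 1 ≤ C)
    (w0 : ∀ n x y, 0 ≤ w n x y) (wB : ∀ n x y, w n x y ≤ B n)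
    (h0 : ∀ n x y, 0 ≤ h n x y) (hhB : ∀ n x y, h n x y ≤ C * B n)
    (hcq : ∀ᶠ n in atTop, ∀ᵐ x ∂ν, c ≤ ∫ y, w n x y ∂ν)
    (hqC : ∀ᶠ n in atTop, ∀ᵐ x ∂ν, ∫ y, w n x y ∂ν ≤ C)
    (hhC : ∀ᶠ n in atTop, ∀ᵐ x ∂ν, ∫ y, h n x y ∂ν ≤ C)
    (hBn : Tendsto (fun n : ℕ => n / B n) atTop atTop)
    (hexp : ∀ κ : ℝ, 0 < κ → Tendsto (fun n : ℕ => n * Real.exp (-(κ * (n / B n)))) atTop (𝓝 0))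
    (hlim : Tendsto (fun n => ∫ x, ∫ y, renormKernel ν (w n) (h n) α c C x y ∂ν ∂ν) atTop (𝓝 ℓ))
    {θ : ℝ} (hθ : 0 < θ) :
    Tendsto (fun n : ℕ => (Measure.pi fun _ : Fin n => ν) {x | θ ≤
      |1 / (n : ℝ) ^ 2 * ∑ i, ∑ j, h n (x i) (x j) * ((1 / (n : ℝ) * ∑ k, w n (x i) (x k)) ^ (-α) *
        (1 / (n : ℝ) * ∑ k, w n (x j) (x k)) ^ (-α)) - ℓ|}) atTop (𝓝 0) := by
  obtain ⟨D, hD, hDα⟩ := exists_rpow_le (C := C) hc α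
  have hCD : 1 ≤ C * D ^ 2 := by nlinarith
  -- The error budget is `θ / 4` for the degrees, `θ / 4` for the two averages and `θ / 4` for the
  -- mean. First `η` is fixed, then `δ` by continuity of the power at 1, then `ε`.
  obtain ⟨η, hη0, hη⟩ : ∃ η, 0 < η ∧ 7 * (C * D ^ 2) * η ≤ θ / 4 :=
    ⟨θ / 4 / (7 * (C * D ^ 2)), by positivity, le_of_eq (by field_simp)⟩
  have hcont : ContinuousAt (fun z : ℝ × ℝ => z.1 ^ (-α) * z.2 ^ (-α)) (1, 1) := by
    have h1 : ContinuousAt (fun z : ℝ × ℝ => z.1 ^ (-α)) (1, 1) :=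
      ContinuousAt.rpow_const continuousAt_fst (Or.inl one_ne_zero)
    have h2 : ContinuousAt (fun z : ℝ × ℝ => z.2 ^ (-α)) (1, 1) :=
      ContinuousAt.rpow_const continuousAt_snd (Or.inl one_ne_zero)
    exact h1.mul h2
  obtain ⟨δ, hδ, hδη⟩ := Metric.continuousAt_iff.1 hcont η hη0
  obtain ⟨ε, hε, hε'⟩ : ∃ ε, 0 < ε ∧ ε ≤ 1 ∧ 3 * ε * C / c < 1 ∧ 3 * ε * C / c < δ ∧
      6 * ε * (C * D ^ 2) ≤ θ / 4 := by
    have h1 : Tendsto (fun ε : ℝ => 3 * ε * C / c) (𝓝[>] 0) (𝓝 0) := by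
      have : Continuous fun ε : ℝ => 3 * ε * C / c := by fun_prop
      simpa using (this.tendsto 0).mono_left nhdsWithin_le_nhds
    have h2 : Tendsto (fun ε : ℝ => 6 * ε * (C * D ^ 2)) (𝓝[>] 0) (𝓝 0) := by
      have : Continuous fun ε : ℝ => 6 * ε * (C * D ^ 2) := by fun_prop
      simpa using (this.tendsto 0).mono_left nhdsWithin_le_nhds
    have h3 : Tendsto (fun ε : ℝ => ε) (𝓝[>] 0) (𝓝 0) := nhdsWithin_le_nhds
    have := (eventually_mem_nhdsWithin (a := (0 : ℝ)) (s := Set.Ioi 0)).and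
      ((h3.eventually (ge_mem_nhds one_pos)).and
        ((h1.eventually (gt_mem_nhds one_pos)).and
          ((h1.eventually (gt_mem_nhds hδ)).and (h2.eventually (ge_mem_nhds
            (by positivity : 0 < θ / 4))))))
    exact this.exists
  obtain ⟨hε1, hεc, hεδ, hε2⟩ := hε'
  have hup : Tendsto (fun n : ℕ => ENNReal.ofReal
      (6 * (n * Real.exp (-(ε ^ 2 * (n / B n)))))) atTop (𝓝 0) := by
    have := ENNReal.tendsto_ofReal ((hexp (ε ^ 2) (by positivity)).const_mul 6)
    simpa using this
  refine tendsto_of_tendsto_of_tendsto_of_le_of_le' tendsto_const_nhds hup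
    (Eventually.of_forall fun _ => zero_le) ?_
  filter_upwards [hB, hcq, hqC, hhC, hBn.eventually_ge_atTop (1 / ε),
    Metric.tendsto_nhds.1 hlim (θ / 4) (by positivity)] with n n1 n2 n3 n4 n5 n6
  have hBpos : 0 < B n := by linarith
  have := measure_pi_regularizer_deviation_le ν (hw n) (hh n) n1 hc hcC hC hD hDα hε hε1 hεc
    (w0 n) (wB n) (h0 n) (hhB n) n2 n3 n4 (η := η) (fun u v hu hv => by
      have := hδη (x := (u, v)) (by
        rw [Prod.dist_eq, Real.dist_eq, Real.dist_eq]
        exact max_lt (hu.trans_lt hεδ) (hv.trans_lt hεδ))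
      rw [Real.dist_eq] at this
      simpa using this.le) (n := n) (by
        rw [div_le_div_iff₀ hε hBpos] at n5
        linarith)
  rw [← mul_div_assoc]
  refine (measure_mono fun x hx => ?_).trans this
  rw [Set.mem_ofPred_eq] at hx ⊢
  rw [Real.dist_eq] at n6
  have key := hx.trans (abs_sub_le _ (∫ x, ∫ y, renormKernel ν (w n) (h n) α c C x y ∂ν ∂ν) ℓ)
  linarith

end GraphLaplacian

/-! ### Hausdorff measure in bi-Lipschitz charts. -/

namespace GraphLaplacian

open scoped NNReal ENNReal

theorem euclideanHausdorffMeasure_image_le {X Y : Type*} [EMetricSpace X] [MeasurableSpace X]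
    [BorelSpace X] [EMetricSpace Y] [MeasurableSpace Y] [BorelSpace Y] {K : ℝ≥0} {f : X → Y}
    {s : Set X} (h : LipschitzOnWith K f s) (d : ℕ) :
    (Measure.euclideanHausdorffMeasure d : Measure Y) (f '' s) ≤
      (K : ℝ≥0∞) ^ d * (Measure.euclideanHausdorffMeasure d : Measure X) s := by
  simp_rw [Measure.euclideanHausdorffMeasure_def, Measure.smul_apply]
  have := h.hausdorffMeasure_image_le (Nat.cast_nonneg (α := ℝ) d)
  rw [ENNReal.rpow_natCast] at this
  rw [mul_smul_comm, ENNReal.smul_def, ENNReal.smul_def]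
  exact mul_le_mul_right this _

/-- `L` is bi-Lipschitz on `A`, with constants `K₁` for `L` and `K₂` for its inverse. -/
def IsBilipschitzOn {X Y : Type*} [PseudoMetricSpace X] [PseudoMetricSpace Y] (K₁ K₂ : ℝ≥0)
    (L : X → Y) (A : Set X) : Prop :=
  ∀ x ∈ A, ∀ y ∈ A, dist (L x) (L y) ≤ K₁ * dist x y ∧ dist x y ≤ K₂ * dist (L x) (L y)

namespace IsBilipschitzOn

variable {N d : ℕ} {K₁ K₂ : ℝ≥0} {L : EuclideanSpace ℝ (Fin N) → EuclideanSpace ℝ (Fin d)}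
  {A : Set (EuclideanSpace ℝ (Fin N))}

theorem lipschitzOnWith (h : IsBilipschitzOn K₁ K₂ L A) : LipschitzOnWith K₁ L A :=
  LipschitzOnWith.of_dist_le_mul fun x hx y hy => (h x hx y hy).1

theorem measure_le (h : IsBilipschitzOn K₁ K₂ L A) {B : Set (EuclideanSpace ℝ (Fin N))}
    (hB : B ⊆ A) : Measure.euclideanHausdorffMeasure d B ≤ (K₂ : ℝ≥0∞) ^ d * volume (L '' B) := by
  rcases B.eq_empty_or_nonempty with rfl | ⟨b, hb⟩
  · simp
  have : Nonempty (EuclideanSpace ℝ (Fin N)) := ⟨b⟩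
  have hinj : Set.InjOn L B := fun x hx y hy hxy => by
    have := (h x (hB hx) y (hB hy)).2
    rw [hxy, dist_self, mul_zero] at this
    exact dist_le_zero.1 this
  have hleft := hinj.leftInvOn_invFunOn
  have hlip : LipschitzOnWith K₂ (Function.invFunOn L B) (L '' B) := by
    refine LipschitzOnWith.of_dist_le_mul ?_
    rintro _ ⟨x, hx, rfl⟩ _ ⟨y, hy, rfl⟩
    rw [hleft hx, hleft hy]
    exact (h x (hB hx) y (hB hy)).2
  have := euclideanHausdorffMeasure_image_le hlip d
  rwa [hleft.image_image, EuclideanSpace.euclideanHausdorffMeasure_eq_volume] at this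

theorem volume_image_le (h : IsBilipschitzOn K₁ K₂ L A) {B : Set (EuclideanSpace ℝ (Fin N))}
    (hB : B ⊆ A) : volume (L '' B) ≤ (K₁ : ℝ≥0∞) ^ d * Measure.euclideanHausdorffMeasure d B := by
  have := euclideanHausdorffMeasure_image_le (h.lipschitzOnWith.mono hB) d
  rwa [EuclideanSpace.euclideanHausdorffMeasure_eq_volume] at this

theorem aemeasurable (h : IsBilipschitzOn K₁ K₂ L A) (hA : MeasurableSet A) :
    AEMeasurable L ((Measure.euclideanHausdorffMeasure d).restrict A) :=
  h.lipschitzOnWith.continuousOn.aemeasurable hA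

/-- The push-forward under `L` of Hausdorff measure on `A` is at most `K₂ ^ d` times Lebesgue
measure. With the converse `setLIntegral_le` this is a change of variables up to constant factors,
and serves instead of the area formula. -/
theorem lintegral_comp_le (h : IsBilipschitzOn K₁ K₂ L A) (hA : MeasurableSet A)
    {F : EuclideanSpace ℝ (Fin d) → ℝ≥0∞} (hF : Measurable F) :
    ∫⁻ x in A, F (L x) ∂Measure.euclideanHausdorffMeasure d ≤
      (K₂ : ℝ≥0∞) ^ d * ∫⁻ v, F v := by
  rw [← lintegral_map' hF.aemeasurable (h.aemeasurable hA), ← smul_eq_mul, ← lintegral_smul_measure]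
  refine lintegral_mono' (Measure.le_iff.2 fun s hs => ?_) le_rfl
  rw [Measure.map_apply_of_aemeasurable (h.aemeasurable hA) hs, Measure.restrict_apply' hA,
    Measure.smul_apply, smul_eq_mul]
  refine (h.measure_le Set.inter_subset_right).trans ?_
  gcongr
  rintro _ ⟨x, hx, rfl⟩
  exact hx.1

theorem setLIntegral_le (h : IsBilipschitzOn K₁ K₂ L A) (hA : MeasurableSet A)
    {V : Set (EuclideanSpace ℝ (Fin d))} (hV : V ⊆ L '' A)
    {F : EuclideanSpace ℝ (Fin d) → ℝ≥0∞} (hF : Measurable F) :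
    ∫⁻ v in V, F v ≤
      (K₁ : ℝ≥0∞) ^ d * ∫⁻ x in A, F (L x) ∂Measure.euclideanHausdorffMeasure d := by
  rw [← lintegral_map' hF.aemeasurable (h.aemeasurable hA), ← smul_eq_mul, ← lintegral_smul_measure]
  refine lintegral_mono' (Measure.le_iff.2 fun s hs => ?_) le_rfl
  rw [Measure.smul_apply, smul_eq_mul, Measure.map_apply_of_aemeasurable (h.aemeasurable hA) hs,
    Measure.restrict_apply' hA, Measure.restrict_apply hs]
  refine le_trans (measure_mono ?_) (h.volume_image_le Set.inter_subset_right)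
  rintro v ⟨hvs, hvV⟩
  obtain ⟨x, hx, rfl⟩ := hV hvV
  exact ⟨x, ⟨hvs, hx⟩, rfl⟩

end IsBilipschitzOn

/-- The half space `{v | 0 ≤ v₀}` of `ℝ^d` (a single point when `d = 0`). -/
def halfSpace (d : ℕ) : Set (EuclideanSpace ℝ (Fin d)) := {v | ∀ i : Fin d, (i : ℕ) = 0 → 0 ≤ v i}

theorem convex_halfSpace (d : ℕ) : Convex ℝ (halfSpace d) := by
  intro x hx y hy a b ha hb _ i hi
  simp only [PiLp.add_apply, PiLp.smul_apply, smul_eq_mul]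
  exact add_nonneg (mul_nonneg ha (hx i hi)) (mul_nonneg hb (hy i hi))

/-- `ψ` is a parametrization of `M ∩ U` by the part of the half space in `V`, with inverse `χ`. -/
structure IsLocalParam {N d : ℕ} (M U : Set (EuclideanSpace ℝ (Fin N)))
    (V : Set (EuclideanSpace ℝ (Fin d))) (χ : EuclideanSpace ℝ (Fin N) → EuclideanSpace ℝ (Fin d))
    (ψ : EuclideanSpace ℝ (Fin d) → EuclideanSpace ℝ (Fin N)) : Prop where
  isOpen_source : IsOpen U
  isOpen_target : IsOpen V
  contDiffOn : ContDiffOn ℝ 1 χ U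
  contDiffOn_symm : ContDiffOn ℝ 1 ψ V
  mem_target : ∀ x ∈ M ∩ U, χ x ∈ halfSpace d ∩ V
  left_inv : ∀ x ∈ M ∩ U, ψ (χ x) = x
  mem_source : ∀ v ∈ halfSpace d ∩ V, ψ v ∈ M ∩ U
  right_inv : ∀ v ∈ halfSpace d ∩ V, χ (ψ v) = v

/-- The inclusion of `ℝ^d` in `ℝ^N` as the first `d` coordinates. -/
noncomputable def coordIncl (N d : ℕ) : EuclideanSpace ℝ (Fin d) →L[ℝ] EuclideanSpace ℝ (Fin N) :=
  LinearMap.toContinuousLinearMap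
    { toFun := fun v => WithLp.toLp 2 fun i => if h : (i : ℕ) < d then v ⟨i, h⟩ else 0
      map_add' := fun u v => by ext i; by_cases h : (i : ℕ) < d <;> simp [h]
      map_smul' := fun c v => by ext i; by_cases h : (i : ℕ) < d <;> simp [h] }

/-- The projection of `ℝ^N` to its first `d` coordinates. -/
noncomputable def coordProj {N d : ℕ} (hd : d ≤ N) :
    EuclideanSpace ℝ (Fin N) →L[ℝ] EuclideanSpace ℝ (Fin d) :=
  LinearMap.toContinuousLinearMap
    { toFun := fun v => WithLp.toLp 2 fun i => v (Fin.castLE hd i)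
      map_add' := fun u v => by ext i; simp
      map_smul' := fun c v => by ext i; simp }

@[simp] theorem coordIncl_apply {N d : ℕ} (v : EuclideanSpace ℝ (Fin d)) (i : Fin N) :
    coordIncl N d v i = if h : (i : ℕ) < d then v ⟨i, h⟩ else 0 := rfl

@[simp] theorem coordProj_apply {N d : ℕ} (hd : d ≤ N) (v : EuclideanSpace ℝ (Fin N)) (i : Fin d) :
    coordProj hd v i = v (Fin.castLE hd i) := rfl

theorem coordProj_coordIncl {N d : ℕ} (hd : d ≤ N) (v : EuclideanSpace ℝ (Fin d)) :
    coordProj hd (coordIncl N d v) = v := by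
  ext i
  simp

theorem coordIncl_coordProj {N d : ℕ} (hd : d ≤ N) {y : EuclideanSpace ℝ (Fin N)}
    (hy : y ∈ halfSpaceModel N d) : coordIncl N d (coordProj hd y) = y := by
  ext i
  by_cases h : (i : ℕ) < d
  · simp only [coordIncl_apply, h, dite_true, coordProj_apply]
    rfl
  · simp [h, hy.1 i (not_lt.1 h)]

theorem coordIncl_mem {N d : ℕ} {v : EuclideanSpace ℝ (Fin d)} (hv : v ∈ halfSpace d) :
    coordIncl N d v ∈ halfSpaceModel N d := by
  refine ⟨fun i hi => by simp [not_lt.2 hi], fun i hi => ?_⟩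
  by_cases h : (i : ℕ) < d
  · simpa [h] using hv ⟨i, h⟩ hi
  · simp [h]

theorem coordProj_mem {N d : ℕ} (hd : d ≤ N) {y : EuclideanSpace ℝ (Fin N)}
    (hy : y ∈ halfSpaceModel N d) : coordProj hd y ∈ halfSpace d := fun i hi => by
  simpa using hy.2 (Fin.castLE hd i) (by simpa using hi)

theorem IsSubmanifoldWithBoundary.exists_isLocalParam {N d : ℕ}
    {M : Set (EuclideanSpace ℝ (Fin N))} (hM : IsSubmanifoldWithBoundary d M)
    {x : EuclideanSpace ℝ (Fin N)} (hx : x ∈ M) :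
    ∃ (U : Set (EuclideanSpace ℝ (Fin N))) (V : Set (EuclideanSpace ℝ (Fin d)))
      (χ : EuclideanSpace ℝ (Fin N) → EuclideanSpace ℝ (Fin d))
      (ψ : EuclideanSpace ℝ (Fin d) → EuclideanSpace ℝ (Fin N)), x ∈ U ∧ IsLocalParam M U V χ ψ := by
  obtain ⟨hd, hM⟩ := hM
  obtain ⟨φ, hxφ, h1, h2, himg⟩ := hM x hx
  have hto : ∀ y ∈ M ∩ φ.source, φ y ∈ halfSpaceModel N d ∩ φ.target := fun y hy =>
    himg ▸ Set.mem_image_of_mem φ hy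
  have hfrom : ∀ y ∈ halfSpaceModel N d ∩ φ.target, φ.symm y ∈ M ∩ φ.source := fun y hy => by
    obtain ⟨z, hz, rfl⟩ := himg.symm ▸ hy
    rwa [φ.left_inv hz.2]
  have hincl : ∀ v ∈ halfSpace d ∩ coordIncl N d ⁻¹' φ.target,
      coordIncl N d v ∈ halfSpaceModel N d ∩ φ.target := fun v hv => ⟨coordIncl_mem hv.1, hv.2⟩
  refine ⟨φ.source, coordIncl N d ⁻¹' φ.target, coordProj hd ∘ φ, φ.symm ∘ coordIncl N d, hxφ,
    φ.open_source, φ.open_target.preimage (coordIncl N d).continuous, ?_, ?_, ?_, ?_, ?_, ?_⟩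
  · exact (coordProj hd).contDiff.comp_contDiffOn (h1.of_le (by exact_mod_cast le_top))
  · exact (h2.of_le (by exact_mod_cast le_top)).comp (coordIncl N d).contDiff.contDiffOn
      fun _ h => h
  · intro y hy
    refine ⟨coordProj_mem hd (hto y hy).1, ?_⟩
    change coordIncl N d (coordProj hd (φ y)) ∈ φ.target
    rw [coordIncl_coordProj hd (hto y hy).1]
    exact (hto y hy).2
  · intro y hy
    simp only [Function.comp_apply]
    rw [coordIncl_coordProj hd (hto y hy).1, φ.left_inv hy.2]
  · exact fun v hv => hfrom _ (hincl v hv)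
  · intro v hv
    simp only [Function.comp_apply]
    rw [φ.right_inv hv.2, coordProj_coordIncl]

variable {N d : ℕ} {M U : Set (EuclideanSpace ℝ (Fin N))} {V : Set (EuclideanSpace ℝ (Fin d))}
  {χ : EuclideanSpace ℝ (Fin N) → EuclideanSpace ℝ (Fin d)}
  {ψ : EuclideanSpace ℝ (Fin d) → EuclideanSpace ℝ (Fin N)} {x : EuclideanSpace ℝ (Fin N)}

namespace IsLocalParam

theorem contDiffAt (h : IsLocalParam M U V χ ψ) (hxU : x ∈ U) : ContDiffAt ℝ 1 χ x :=
  h.contDiffOn.contDiffAt (h.isOpen_source.mem_nhds hxU)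

theorem contDiffAt_symm (h : IsLocalParam M U V χ ψ) {v : EuclideanSpace ℝ (Fin d)} (hv : v ∈ V) :
    ContDiffAt ℝ 1 ψ v :=
  h.contDiffOn_symm.contDiffAt (h.isOpen_target.mem_nhds hv)

/-- Both `χ` and `ψ` are `C¹` on full open sets, also across the boundary, hence locally Lipschitz,
and they are inverse to each other on `M`. -/
theorem exists_isBilipschitzOn (h : IsLocalParam M U V χ ψ) (hx : x ∈ M) (hxU : x ∈ U) :
    ∃ K : ℝ≥0, 1 ≤ K ∧ ∀ᶠ r in 𝓝[>] (0 : ℝ), IsBilipschitzOn K K χ (M ∩ Metric.ball x r) ∧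
      M ∩ Metric.ball x r ⊆ U := by
  have hv := h.mem_target x ⟨hx, hxU⟩
  obtain ⟨K, s, hs, hK⟩ := (h.contDiffAt hxU).exists_lipschitzOnWith
  obtain ⟨K', s', hs', hK'⟩ := (h.contDiffAt_symm hv.2).exists_lipschitzOnWith
  have hnhds : s ∩ U ∩ χ ⁻¹' s' ∈ 𝓝 x :=
    inter_mem (inter_mem hs (h.isOpen_source.mem_nhds hxU))
      ((h.contDiffAt hxU).continuousAt.preimage_mem_nhds hs')
  obtain ⟨r₀, hr₀, hball⟩ := Metric.mem_nhds_iff.1 hnhds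
  refine ⟨max 1 (max K K'), le_max_left _ _, ?_⟩
  filter_upwards [Ioo_mem_nhdsGT hr₀] with r hr
  have hsub : Metric.ball x r ⊆ s ∩ U ∩ χ ⁻¹' s' :=
    (Metric.ball_subset_ball hr.2.le).trans hball
  refine ⟨fun y hy z hz => ⟨?_, ?_⟩, fun y hy => (hsub hy.2).1.2⟩
  · refine (hK.dist_le_mul y (hsub hy.2).1.1 z (hsub hz.2).1.1).trans ?_
    gcongr
    exact (le_max_left _ _).trans (le_max_right _ _)
  · have := hK'.dist_le_mul (χ y) (hsub hy.2).2 (χ z) (hsub hz.2).2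
    rw [h.left_inv y ⟨hy.1, (hsub hy.2).1.2⟩, h.left_inv z ⟨hz.1, (hsub hz.2).1.2⟩] at this
    refine this.trans ?_
    gcongr
    exact (le_max_right _ _).trans (le_max_right _ _)

/-- The images of small neighborhoods in `M` contain small relatively open sets. -/
theorem exists_subset_image (h : IsLocalParam M U V χ ψ) (hx : x ∈ M) (hxU : x ∈ U) {r : ℝ}
    (hr : 0 < r) : ∃ ρ > 0, halfSpace d ∩ Metric.ball (χ x) ρ ⊆ χ '' (M ∩ Metric.ball x r) := by
  have hv := h.mem_target x ⟨hx, hxU⟩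
  have hc : ψ ⁻¹' Metric.ball x r ∈ 𝓝 (χ x) := by
    refine (h.contDiffAt_symm hv.2).continuousAt.preimage_mem_nhds ?_
    rw [h.left_inv x ⟨hx, hxU⟩]
    exact Metric.ball_mem_nhds x hr
  obtain ⟨ρ, hρ, hsub⟩ := Metric.mem_nhds_iff.1 (inter_mem hc (h.isOpen_target.mem_nhds hv.2))
  refine ⟨ρ, hρ, fun v hv => ⟨ψ v, ⟨?_, (hsub hv.2).1⟩, ?_⟩⟩
  · exact (h.mem_source v ⟨hv.1, (hsub hv.2).2⟩).1
  · exact h.right_inv v ⟨hv.1, (hsub hv.2).2⟩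

end IsLocalParam

end GraphLaplacian

/-! ### Interior points and tangent coordinates. -/

namespace GraphLaplacian

open scoped NNReal ENNReal

variable {N d : ℕ} {M U : Set (EuclideanSpace ℝ (Fin N))} {V : Set (EuclideanSpace ℝ (Fin d))}
  {χ : EuclideanSpace ℝ (Fin N) → EuclideanSpace ℝ (Fin d)}
  {ψ : EuclideanSpace ℝ (Fin d) → EuclideanSpace ℝ (Fin N)} {x : EuclideanSpace ℝ (Fin N)}

/-- `x` is an interior point of the submanifold `M`. -/
def IsInteriorPoint (d : ℕ) (M : Set (EuclideanSpace ℝ (Fin N))) (x : EuclideanSpace ℝ (Fin N)) :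
    Prop :=
  x ∈ M ∧ ∃ (U : Set (EuclideanSpace ℝ (Fin N))) (V : Set (EuclideanSpace ℝ (Fin d)))
      (χ : EuclideanSpace ℝ (Fin N) → EuclideanSpace ℝ (Fin d))
      (ψ : EuclideanSpace ℝ (Fin d) → EuclideanSpace ℝ (Fin N)), x ∈ U ∧
        IsLocalParam M U V χ ψ ∧ ∀ i : Fin d, (i : ℕ) = 0 → 0 < χ x i

theorem volume_setOf_coord_eq_zero (i : Fin d) :
    volume {v : EuclideanSpace ℝ (Fin d) | v i = 0} = 0 := by
  have h : {v : EuclideanSpace ℝ (Fin d) | v i = 0} =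
      (LinearMap.ker (EuclideanSpace.proj i : EuclideanSpace ℝ (Fin d) →L[ℝ] ℝ).toLinearMap :
        Set (EuclideanSpace ℝ (Fin d))) := by
    ext v
    simp
  rw [h]
  refine Measure.addHaar_submodule _ _ fun htop => ?_
  have : EuclideanSpace.single i (1 : ℝ) ∈
      LinearMap.ker (EuclideanSpace.proj i : EuclideanSpace ℝ (Fin d) →L[ℝ] ℝ).toLinearMap := by
    rw [htop]
    trivial
  simp at this

/-- In a chart a non-interior point has vanishing coordinate of index 0, so its image lies in a
hyperplane; a bi-Lipschitz chart carries null sets back to null sets. -/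
theorem IsSubmanifoldWithBoundary.measure_not_interior (hM : IsSubmanifoldWithBoundary d M) :
    Measure.euclideanHausdorffMeasure d {x ∈ M | ¬ IsInteriorPoint d M x} = 0 := by
  refine measure_null_of_locally_null _ fun x hx => ?_
  obtain ⟨U, V, χ, ψ, hxU, h⟩ := hM.exists_isLocalParam hx.1
  obtain ⟨K, -, hK⟩ := h.exists_isBilipschitzOn hx.1 hxU
  obtain ⟨r, ⟨hbil, hrU⟩, hr⟩ := (hK.and self_mem_nhdsWithin).exists
  refine ⟨{y ∈ M | ¬ IsInteriorPoint d M y} ∩ Metric.ball x r,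
    inter_mem self_mem_nhdsWithin (nhdsWithin_le_nhds (Metric.ball_mem_nhds x hr)), ?_⟩
  have hsub : {y ∈ M | ¬ IsInteriorPoint d M y} ∩ Metric.ball x r ⊆ M ∩ Metric.ball x r :=
    Set.inter_subset_inter_left _ fun y hy => hy.1
  have hzero : volume (χ '' ({y ∈ M | ¬ IsInteriorPoint d M y} ∩ Metric.ball x r)) = 0 := by
    refine measure_mono_null (t := ⋃ i : Fin d, {v | v i = 0}) ?_
      (measure_iUnion_null fun i => volume_setOf_coord_eq_zero i)
    rintro _ ⟨y, ⟨⟨hyM, hy⟩, hyr⟩, rfl⟩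
    by_contra hcon
    simp only [Set.mem_iUnion, Set.mem_ofPred_eq, not_exists] at hcon
    refine hy ⟨hyM, U, V, χ, ψ, hrU ⟨hyM, hyr⟩, h, fun i hi => ?_⟩
    exact lt_of_le_of_ne ((h.mem_target y ⟨hyM, hrU ⟨hyM, hyr⟩⟩).1 i hi) (Ne.symm (hcon i))
  refine le_antisymm ((hbil.measure_le hsub).trans ?_) zero_le
  rw [hzero, mul_zero]

theorem IsSubmanifoldWithBoundary.measure_lt_top (hM : IsSubmanifoldWithBoundary d M)
    (hMc : IsCompact M) : Measure.euclideanHausdorffMeasure d M < ⊤ := by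
  refine hMc.measure_lt_top_of_nhdsWithin fun x hx => ?_
  obtain ⟨U, V, χ, ψ, hxU, h⟩ := hM.exists_isLocalParam hx
  obtain ⟨K, -, hK⟩ := h.exists_isBilipschitzOn hx hxU
  obtain ⟨r, ⟨hbil, hrU⟩, hr⟩ := (hK.and self_mem_nhdsWithin).exists
  refine ⟨M ∩ Metric.ball x r,
    inter_mem self_mem_nhdsWithin (nhdsWithin_le_nhds (Metric.ball_mem_nhds x hr)), ?_⟩
  refine (hbil.measure_le le_rfl).trans_lt (ENNReal.mul_lt_top (by finiteness) ?_)
  refine (measure_mono (t := Metric.closedBall (χ x) (K * r)) ?_).trans_lt measure_closedBall_lt_top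
  rintro _ ⟨y, hy, rfl⟩
  refine ((hbil y hy x ⟨hx, Metric.mem_ball_self hr⟩).1).trans ?_
  have := Metric.mem_ball.1 hy.2
  gcongr

theorem interior_mem_nhds {v : EuclideanSpace ℝ (Fin d)}
    (hv : ∀ i : Fin d, (i : ℕ) = 0 → 0 < v i) : halfSpace d ∈ 𝓝 v := by
  have : ∀ᶠ u in 𝓝 v, ∀ i : Fin d, (i : ℕ) = 0 → 0 ≤ u i := by
    rw [eventually_all]
    intro i
    by_cases hi : (i : ℕ) = 0
    · have hc : ContinuousAt (fun u : EuclideanSpace ℝ (Fin d) => u i) v := by fun_prop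
      filter_upwards [hc.eventually (lt_mem_nhds (hv i hi))] with u hu _ using hu.le
    · exact Eventually.of_forall fun u h => absurd h hi
  exact this

namespace IsLocalParam

/-- Identifies the span of the tangent cone with the range of the derivative of the parametrization.
At an interior point the parameters fill a neighborhood, so every direction is tangent there and is
mapped to a tangent direction of `M`. Conversely `ψ ∘ χ` is the identity on `M`, so its derivative
fixes the tangent cone. -/
theorem exists_hasStrictFDerivAt (h : IsLocalParam M U V χ ψ) (hx : x ∈ M) (hxU : x ∈ U)
    (hint : ∀ i : Fin d, (i : ℕ) = 0 → 0 < χ x i) :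
    ∃ A : EuclideanSpace ℝ (Fin d) →L[ℝ] EuclideanSpace ℝ (Fin N),
      HasStrictFDerivAt ψ A (χ x) ∧ Function.Injective A ∧
        LinearMap.range A.toLinearMap = tangentSpace M x := by
  have hv := h.mem_target x ⟨hx, hxU⟩
  have hA := (h.contDiffAt_symm hv.2).hasStrictFDerivAt one_ne_zero
  have hB := (h.contDiffAt hxU).hasStrictFDerivAt one_ne_zero
  set A := fderiv ℝ ψ (χ x)
  set B := fderiv ℝ χ x
  have hW : halfSpace d ∩ V ∈ 𝓝 (χ x) :=
    inter_mem (interior_mem_nhds hint) (h.isOpen_target.mem_nhds hv.2)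
  have hBA : B.comp A = ContinuousLinearMap.id ℝ _ := by
    have hB' : HasFDerivAt χ B (ψ (χ x)) := by
      rw [h.left_inv x ⟨hx, hxU⟩]
      exact hB.hasFDerivAt
    have h1 := hB'.comp (χ x) hA.hasFDerivAt
    have h2 : HasFDerivAt (χ ∘ ψ) (ContinuousLinearMap.id ℝ _) (χ x) :=
      (hasFDerivAt_id _).congr_of_eventuallyEq
        (by filter_upwards [hW] with u hu using h.right_inv u hu)
    exact h1.unique h2
  have hinj : Function.LeftInverse B A := fun v => congr($hBA v)
  refine ⟨A, hA, hinj.injective, le_antisymm ?_ ?_⟩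
  · rintro _ ⟨v, rfl⟩
    refine Submodule.subset_span ?_
    have h1 := hA.hasFDerivAt.hasFDerivWithinAt (s := halfSpace d ∩ V)
    have hcone : v ∈ tangentConeAt ℝ (halfSpace d ∩ V) (χ x) := by
      rw [tangentConeAt_of_mem_nhds hW]
      trivial
    have h2 := h1.mapsTo_tangent_cone hcone
    rw [h.left_inv x ⟨hx, hxU⟩] at h2
    refine tangentConeAt_mono ?_ h2
    rintro _ ⟨u, hu, rfl⟩
    exact (h.mem_source u hu).1
  · refine Submodule.span_le.2 fun v hv' => ?_
    have h1 := (hA.hasFDerivAt.comp x hB.hasFDerivAt).hasFDerivWithinAt (s := M)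
    have h2 : HasFDerivWithinAt (ψ ∘ χ) (ContinuousLinearMap.id ℝ _) M x := by
      refine (hasFDerivWithinAt_id x M).congr_of_eventuallyEq ?_ (h.left_inv x ⟨hx, hxU⟩)
      filter_upwards [self_mem_nhdsWithin, nhdsWithin_le_nhds (h.isOpen_source.mem_nhds hxU)]
        with y hyM hyU using h.left_inv y ⟨hyM, hyU⟩
    have h3 := h1.unique_on h2 hv'
    exact ⟨B v, h3⟩

end IsLocalParam

/-- Near an interior point, `M` is almost isometric to its orthogonal projection on the tangent
space, and this projection contains a neighborhood. -/
theorem IsInteriorPoint.exists_tangent_coordinates (hx : IsInteriorPoint d M x) :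
    ∃ (L : EuclideanSpace ℝ (Fin N) →L[ℝ] EuclideanSpace ℝ (Fin d))
      (J : EuclideanSpace ℝ (Fin d) ≃ₗᵢ[ℝ] tangentSpace M x),
      (∀ y, ‖L y‖ ≤ ‖y‖) ∧
      (∀ ε > 0, ∀ᶠ z in 𝓝[M] x ×ˢ 𝓝[M] x,
        ‖z.1 - z.2 - (J (L (z.1 - z.2)) : EuclideanSpace ℝ (Fin N))‖ ≤ ε * ‖z.1 - z.2‖) ∧
      ∀ r > 0, L '' (M ∩ Metric.ball x r) ∈ 𝓝 (L x) := by
  obtain ⟨hxM, U, V, χ, ψ, hxU, h, hint⟩ := hx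
  obtain ⟨A, hA, hAinj, hrange⟩ := h.exists_hasStrictFDerivAt hxM hxU hint
  have hv := h.mem_target x ⟨hxM, hxU⟩
  have hfin : Module.finrank ℝ (tangentSpace M x) = d := by
    rw [← hrange, LinearMap.finrank_range_of_inj hAinj]
    simp
  let e : tangentSpace M x ≃ₗᵢ[ℝ] EuclideanSpace ℝ (Fin d) :=
    ((stdOrthonormalBasis ℝ (tangentSpace M x)).reindex (finCongr hfin)).repr
  let L : EuclideanSpace ℝ (Fin N) →L[ℝ] EuclideanSpace ℝ (Fin d) :=
    (e.toContinuousLinearEquiv : tangentSpace M x →L[ℝ] EuclideanSpace ℝ (Fin d)).comp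
      (tangentSpace M x).orthogonalProjectionOnto
  have hJL : ∀ y, e.symm (L y) = (tangentSpace M x).orthogonalProjectionOnto y := fun y =>
    e.symm_apply_apply _
  have hLA : ∀ v, (e.symm (L (A v)) : EuclideanSpace ℝ (Fin N)) = A v := fun v => by
    rw [hJL]
    have : A v ∈ tangentSpace M x := hrange ▸ ⟨v, rfl⟩
    exact Submodule.starProjection_eq_self_iff.2 this
  refine ⟨L, e.symm, fun y => ?_, fun ε hε => ?_, fun r hr => ?_⟩
  · change ‖e _‖ ≤ _
    rw [e.norm_map]
    exact Submodule.norm_orthogonalProjectionOnto_apply_le _ y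
  · obtain ⟨K, s, hs, hK⟩ := (h.contDiffAt hxU).exists_lipschitzOnWith
    have hδ : 0 < ε / (K + 1) := by positivity
    have h1 := (Asymptotics.isLittleO_iff.1 hA.isLittleO hδ)
    have hχ : Tendsto (fun z : EuclideanSpace ℝ (Fin N) × EuclideanSpace ℝ (Fin N) =>
        (χ z.1, χ z.2)) (𝓝[M] x ×ˢ 𝓝[M] x) (𝓝 (χ x, χ x)) := by
      rw [nhds_prod_eq]
      have := (h.contDiffAt hxU).continuousAt.tendsto.mono_left
        (nhdsWithin_le_nhds (s := M))
      exact (this.comp tendsto_fst).prodMk (this.comp tendsto_snd)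
    have hmem : ∀ᶠ y in 𝓝[M] x, y ∈ M ∩ U ∧ y ∈ s := by
      filter_upwards [self_mem_nhdsWithin, nhdsWithin_le_nhds (h.isOpen_source.mem_nhds hxU),
        nhdsWithin_le_nhds hs] with y h1 h2 h3 using ⟨⟨h1, h2⟩, h3⟩
    filter_upwards [hχ.eventually h1, hmem.prod_mk hmem] with z hz hm
    obtain ⟨⟨m1, s1⟩, ⟨m2, s2⟩⟩ := hm
    rw [h.left_inv _ m1, h.left_inv _ m2] at hz
    set w := z.1 - z.2
    set v := A (χ z.1 - χ z.2)
    -- The projection of `w` is its best tangent approximation, hence at least as good as the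
    -- tangent vector `v` supplied by strict differentiability, which allows both points of the pair
    -- to vary.
    have hproj : ‖w - e.symm (L w)‖ ≤ ‖w - v‖ := by
      have : w - e.symm (L w) = (tangentSpace M x)ᗮ.starProjection (w - v) := by
        have h3 := hLA (χ z.1 - χ z.2)
        rw [hJL] at h3
        rw [Submodule.starProjection_orthogonal_val, hJL, map_sub (tangentSpace M x).starProjection]
        rw [show (tangentSpace M x).starProjection v = v from h3]
        simp
      rw [this]
      exact Submodule.norm_starProjection_apply_le _ _
    refine hproj.trans (hz.trans ?_)
    have hlip := hK.norm_sub_le s1 s2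
    calc ε / (K + 1) * ‖χ z.1 - χ z.2‖ ≤ ε / (K + 1) * (K * ‖w‖) := by gcongr
      _ = ε * ‖w‖ * (K / (K + 1)) := by ring
      _ ≤ ε * ‖w‖ * 1 := by
        gcongr
        rw [div_le_one (by positivity)]
        linarith
      _ = _ := mul_one _
  · have hLA' : ∀ v, L (A v) = 0 → v = 0 := fun v hv => by
      have := hLA v
      rw [hv, map_zero] at this
      exact hAinj (by rw [map_zero]; exact this.symm)
    have hsurj : LinearMap.range (L.comp A).toLinearMap = ⊤ := by
      refine LinearMap.range_eq_top.2 (LinearMap.injective_iff_surjective.1 ?_)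
      refine (injective_iff_map_eq_zero _).2 fun v hv => hLA' v hv
    -- The map `L ∘ ψ` is open at `χ x`, because its strict derivative is onto.
    have hmap := (L.hasStrictFDerivAt.comp (χ x) hA).map_nhds_eq_of_surj hsurj
    simp only [h.left_inv x ⟨hxM, hxU⟩] at hmap
    rw [← hmap, mem_map]
    have hcont : ψ ⁻¹' Metric.ball x r ∈ 𝓝 (χ x) := by
      refine (h.contDiffAt_symm hv.2).continuousAt.preimage_mem_nhds ?_
      rw [h.left_inv x ⟨hxM, hxU⟩]
      exact Metric.ball_mem_nhds x hr
    filter_upwards [hcont, interior_mem_nhds hint, h.isOpen_target.mem_nhds hv.2]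
      with v hv1 hv2 hv3
    exact ⟨ψ v, ⟨(h.mem_source v ⟨hv2, hv3⟩).1, hv1⟩, rfl⟩

/-- With normal error at most `(K - 1) / K * ‖w‖`, the triangle inequality gives `‖w‖ ≤ K * ‖L w‖`.
The constant `K` may be as close to 1 as desired, which makes the comparison with `ℝ^d` sharp in the
limit. -/
theorem eventually_isBilipschitzOn_tangent {L : EuclideanSpace ℝ (Fin N) →L[ℝ] EuclideanSpace ℝ (Fin d)}
    {J : EuclideanSpace ℝ (Fin d) ≃ₗᵢ[ℝ] tangentSpace M x}
    (hL : ∀ y, ‖L y‖ ≤ ‖y‖) (hLJ : ∀ ε > 0, ∀ᶠ z in 𝓝[M] x ×ˢ 𝓝[M] x,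
        ‖z.1 - z.2 - (J (L (z.1 - z.2)) : EuclideanSpace ℝ (Fin N))‖ ≤ ε * ‖z.1 - z.2‖) {K : ℝ≥0} (hK : 1 < K) :
    ∀ᶠ r in 𝓝[>] (0 : ℝ), IsBilipschitzOn 1 K L (M ∩ Metric.ball x r) := by
  have hε : 0 < (K - 1 : ℝ) / K := by
    have : (1 : ℝ) < K := by exact_mod_cast hK
    exact div_pos (by linarith) (by linarith)
  obtain ⟨p, hp, q, hq, hpq⟩ := eventually_prod_iff.1 (hLJ _ hε)
  obtain ⟨r₀, hr₀, hball⟩ := Metric.mem_nhdsWithin_iff.1 (inter_mem hp hq)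
  filter_upwards [Ioo_mem_nhdsGT hr₀] with r hr
  have hsub : M ∩ Metric.ball x r ⊆ {y | p y} ∩ {y | q y} := fun y hy =>
    hball ⟨Metric.ball_subset_ball hr.2.le hy.2, hy.1⟩
  refine fun y hy z hz => ⟨?_, ?_⟩
  · rw [dist_eq_norm, dist_eq_norm, ← map_sub]
    simpa using hL (y - z)
  · have h1 := hpq (hsub hy).1 (hsub hz).2
    rw [dist_eq_norm, dist_eq_norm, ← map_sub]
    simp only at h1
    set w := y - z
    have hJ : ‖(J (L w) : EuclideanSpace ℝ (Fin N))‖ = ‖L w‖ := J.norm_map (L w)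
    have h2 : ‖w‖ ≤ ‖w - J (L w)‖ + ‖L w‖ := by
      rw [← hJ]
      exact norm_le_norm_sub_add _ _
    have hKpos : (0 : ℝ) < K := by
      have : (1 : ℝ) < K := by exact_mod_cast hK
      linarith
    have h3 : ‖w‖ ≤ (K - 1 : ℝ) / K * ‖w‖ + ‖L w‖ := by linarith
    have h4 : (K : ℝ) * ‖w‖ ≤ (K - 1 : ℝ) * ‖w‖ + K * ‖L w‖ := by
      have := mul_le_mul_of_nonneg_left h3 hKpos.le
      rw [mul_add, ← mul_assoc, mul_div_cancel₀ _ hKpos.ne'] at this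
      exact this
    linarith

end GraphLaplacian

/-! ### Uniform bounds for Gaussian integrals on the submanifold. -/

namespace GraphLaplacian

open scoped NNReal ENNReal

variable {N d : ℕ} {M : Set (EuclideanSpace ℝ (Fin N))} {x : EuclideanSpace ℝ (Fin N)}

theorem lintegral_comp_rescale {t : ℝ} (ht : 0 < t) (v₀ : EuclideanSpace ℝ (Fin d))
    {F : EuclideanSpace ℝ (Fin d) → ℝ≥0∞} (hF : Measurable F) :
    ∫⁻ v, ENNReal.ofReal (1 / t ^ ((d : ℝ) / 2)) * F ((√t)⁻¹ • (v - v₀)) = ∫⁻ v, F v := by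
  have hs : (√t)⁻¹ ≠ 0 := inv_ne_zero (Real.sqrt_pos.2 ht).ne'
  rw [lintegral_const_mul _ (by fun_prop),
    lintegral_sub_right_eq_self (fun v => F ((√t)⁻¹ • v)) v₀,
    ← lintegral_map (μ := volume) hF (measurable_const_smul (√t)⁻¹),
    Measure.map_addHaar_smul volume hs, lintegral_smul_measure, smul_eq_mul, ← mul_assoc,
    ← ENNReal.ofReal_mul (by positivity)]
  rw [finrank_euclideanSpace_fin, inv_pow, inv_inv, abs_of_nonneg (by positivity),
    Real.sqrt_eq_rpow, ← Real.rpow_natCast, ← Real.rpow_mul ht.le,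
    show 1 / 2 * (d : ℝ) = (d : ℝ) / 2 by ring, one_div_mul_cancel (by positivity)]
  simp

theorem tendsto_one_div_rpow_mul_exp (k : ℝ) {c : ℝ} (hc : 0 < c) :
    Tendsto (fun t : ℝ => 1 / t ^ k * Real.exp (-(c / t))) (𝓝[>] 0) (𝓝 0) := by
  refine ((tendsto_rpow_mul_exp_neg_mul_atTop_nhds_zero k c hc).comp
    tendsto_inv_nhdsGT_zero).congr' ?_
  filter_upwards [self_mem_nhdsWithin] with t ht
  rw [Function.comp_apply, Real.inv_rpow (le_of_lt ht), one_div, neg_mul, div_eq_mul_inv]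

theorem gaussianWeight_le_of_le_norm {t r : ℝ} (ht : 0 < t) (hr : 0 ≤ r)
    {y z : EuclideanSpace ℝ (Fin N)} (h : r ≤ ‖y - z‖) :
    gaussianWeight d t y z ≤ 1 / t ^ ((d : ℝ) / 2) * Real.exp (-(r ^ 2 / t)) := by
  unfold gaussianWeight
  gcongr

theorem gaussianWeight_nonneg {t : ℝ} (ht : 0 < t) (y z : EuclideanSpace ℝ (Fin N)) :
    0 ≤ gaussianWeight d t y z := by
  unfold gaussianWeight
  positivity

theorem norm_inv_sqrt_smul_sq {t : ℝ} (ht : 0 < t) (v : EuclideanSpace ℝ (Fin d)) :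
    ‖(√t)⁻¹ • v‖ ^ 2 = ‖v‖ ^ 2 / t := by
  rw [norm_smul, mul_pow, norm_inv, Real.norm_of_nonneg (Real.sqrt_nonneg t), inv_pow,
    Real.sq_sqrt ht.le, inv_mul_eq_div]

theorem gaussianWeight_le_rescale {t : ℝ} (ht : 0 < t) {L : ℝ} {y z : EuclideanSpace ℝ (Fin N)}
    {u v : EuclideanSpace ℝ (Fin d)} (hL : 0 < L) (h : dist u v ≤ L * dist y z) :
    gaussianWeight d t y z ≤ 1 / t ^ ((d : ℝ) / 2) *
      Real.exp (-(L ^ 2)⁻¹ * ‖(√t)⁻¹ • (v - u)‖ ^ 2) := by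
  unfold gaussianWeight
  rw [norm_inv_sqrt_smul_sq ht, neg_mul]
  gcongr
  rw [dist_eq_norm', dist_eq_norm] at h
  rw [← mul_div_assoc]
  gcongr
  rw [inv_mul_le_iff₀ (by positivity), ← mul_pow]
  gcongr

theorem rescale_le_gaussianWeight {t : ℝ} (ht : 0 < t) {L : ℝ} {y z : EuclideanSpace ℝ (Fin N)}
    {u v : EuclideanSpace ℝ (Fin d)} (h : dist y z ≤ L * dist u v) :
    1 / t ^ ((d : ℝ) / 2) * Real.exp (-L ^ 2 * ‖(√t)⁻¹ • (v - u)‖ ^ 2) ≤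
      gaussianWeight d t y z := by
  unfold gaussianWeight
  rw [norm_inv_sqrt_smul_sq ht, neg_mul]
  gcongr
  rw [dist_eq_norm, dist_eq_norm'] at h
  rw [← mul_div_assoc]
  gcongr
  rw [← mul_pow]
  gcongr

theorem integrable_exp_neg_mul_sq_norm (d : ℕ) {b : ℝ} (hb : 0 < b) :
    Integrable fun v : EuclideanSpace ℝ (Fin d) => Real.exp (-b * ‖v‖ ^ 2) := by
  -- The integral of a non-integrable function is 0 by convention, whereas the Gaussian integral is
  -- positive.
  refine not_imp_comm.1 integral_undef ?_
  rw [GaussianFourier.integral_rexp_neg_mul_sq_norm hb]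
  positivity

theorem lintegral_exp_neg_mul_sq_norm_lt_top (d : ℕ) {b : ℝ} (hb : 0 < b) :
    ∫⁻ v : EuclideanSpace ℝ (Fin d), ENNReal.ofReal (Real.exp (-b * ‖v‖ ^ 2)) < ⊤ :=
  (integrable_exp_neg_mul_sq_norm d hb).lintegral_lt_top

/-- Gaussian integrals over a compact submanifold are bounded, uniformly in the center. -/
theorem IsSubmanifoldWithBoundary.exists_lintegral_gaussianWeight_le
    (hM : IsSubmanifoldWithBoundary d M) (hMc : IsCompact M) :
    ∃ C : ℝ≥0, ∀ᶠ t in 𝓝[>] (0 : ℝ), ∀ x ∈ M,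
      ∫⁻ y in M, ENNReal.ofReal (gaussianWeight d t x y)
        ∂Measure.euclideanHausdorffMeasure d ≤ C := by
  have hfin := hM.measure_lt_top hMc
  refine hMc.induction_on (p := fun s => ∃ C : ℝ≥0, ∀ᶠ t in 𝓝[>] (0 : ℝ), ∀ x ∈ s,
      ∫⁻ y in M, ENNReal.ofReal (gaussianWeight d t x y)
        ∂Measure.euclideanHausdorffMeasure d ≤ C) ⟨0, by simp⟩ ?_ ?_ ?_
  · rintro s s' hs ⟨C, hC⟩
    exact ⟨C, hC.mono fun t h x hx => h x (hs hx)⟩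
  · rintro s s' ⟨C, hC⟩ ⟨C', hC'⟩
    refine ⟨max C C', ?_⟩
    filter_upwards [hC, hC'] with t h h' x hx
    rcases hx with hx | hx
    · exact (h x hx).trans (by exact_mod_cast le_max_left _ _)
    · exact (h' x hx).trans (by exact_mod_cast le_max_right _ _)
  · intro x₀ hx₀
    obtain ⟨U, V, χ, ψ, hxU, h⟩ := hM.exists_isLocalParam hx₀
    obtain ⟨K, hK1, hK⟩ := h.exists_isBilipschitzOn hx₀ hxU
    obtain ⟨r, ⟨hbil, hrU⟩, hr⟩ := (hK.and self_mem_nhdsWithin).exists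
    have hr : 0 < r := hr
    have hKpos : (0 : ℝ) < K := lt_of_lt_of_le one_pos (by exact_mod_cast hK1)
    have hA : MeasurableSet (M ∩ Metric.ball x₀ r) := hMc.measurableSet.inter measurableSet_ball
    set I := ∫⁻ v : EuclideanSpace ℝ (Fin d),
      ENNReal.ofReal (Real.exp (-((K : ℝ) ^ 2)⁻¹ * ‖v‖ ^ 2)) with hI
    have hIfin : I < ⊤ := lintegral_exp_neg_mul_sq_norm_lt_top d (by positivity)
    obtain ⟨C, hC⟩ : ∃ C : ℝ≥0, (C : ℝ≥0∞) =
        (K : ℝ≥0∞) ^ d * I + Measure.euclideanHausdorffMeasure d M :=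
      ENNReal.canLift.prf _ (by finiteness)
    -- Centres are kept in the half ball, so that points outside the ball of radius `r` are at
    -- distance at least `r / 2`, where the weight is at most 1 for small `t`.
    refine ⟨M ∩ Metric.ball x₀ (r / 2), inter_mem self_mem_nhdsWithin
      (nhdsWithin_le_nhds (Metric.ball_mem_nhds _ (by positivity))), C, ?_⟩
    have hdec := tendsto_one_div_rpow_mul_exp ((d : ℝ) / 2)
      (by positivity : 0 < (r / 2) ^ 2)
    filter_upwards [self_mem_nhdsWithin, hdec.eventually (ge_mem_nhds one_pos)] with t ht hdt x hx
    have ht : 0 < t := ht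
    rw [← lintegral_add_compl (μ := (Measure.euclideanHausdorffMeasure d).restrict M) _
      (measurableSet_ball (x := x₀) (ε := r)), hC, Measure.restrict_restrict measurableSet_ball,
      Set.inter_comm]
    refine add_le_add ?_ ?_
    · calc _ ≤ ∫⁻ y in M ∩ Metric.ball x₀ r, (fun v => ENNReal.ofReal (1 / t ^ ((d : ℝ) / 2)) *
            ENNReal.ofReal (Real.exp (-((K : ℝ) ^ 2)⁻¹ * ‖(√t)⁻¹ • (v - χ x)‖ ^ 2))) (χ y)
              ∂Measure.euclideanHausdorffMeasure d := by
            refine setLIntegral_mono' hA fun y hy => ?_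
            beta_reduce
            rw [← ENNReal.ofReal_mul (by positivity)]
            refine ENNReal.ofReal_le_ofReal (gaussianWeight_le_rescale ht hKpos ?_)
            exact (hbil x ⟨hx.1, Metric.ball_subset_ball (by linarith) hx.2⟩ y hy).1
        _ ≤ (K : ℝ≥0∞) ^ d * I := by
            refine (hbil.lintegral_comp_le hA (F := fun v => ENNReal.ofReal (1 / t ^ ((d : ℝ) / 2)) *
              ENNReal.ofReal (Real.exp (-((K : ℝ) ^ 2)⁻¹ * ‖(√t)⁻¹ • (v - χ x)‖ ^ 2)))
              (by fun_prop)).trans (le_of_eq ?_)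
            rw [lintegral_comp_rescale ht (χ x)
              (F := fun v => ENNReal.ofReal (Real.exp (-((K : ℝ) ^ 2)⁻¹ * ‖v‖ ^ 2)))
              (by fun_prop)]
    · calc _ ≤ ∫⁻ y in (Metric.ball x₀ r)ᶜ, 1
              ∂(Measure.euclideanHausdorffMeasure d).restrict M := by
            refine setLIntegral_mono' measurableSet_ball.compl fun y hy => ?_
            rw [← ENNReal.ofReal_one]
            refine ENNReal.ofReal_le_ofReal
              ((gaussianWeight_le_of_le_norm ht (by positivity : 0 ≤ r / 2) ?_).trans hdt)
            have h1 := Metric.mem_ball.1 hx.2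
            have h2 : r ≤ dist y x₀ := not_lt.1 hy
            have h3 := dist_triangle y x x₀
            rw [← dist_eq_norm, dist_comm]
            linarith
        _ ≤ _ := by
            rw [setLIntegral_one]
            refine (measure_mono (Set.subset_univ _)).trans (le_of_eq ?_)
            rw [Measure.restrict_apply_univ]

/-- The half space is a convex cone. Hence around any of its points, on the boundary or not, it
contains a translated half ball of every size, which makes the lower bound for degrees uniform up to
the boundary. -/
theorem add_smul_mem_halfSpace {v u : EuclideanSpace ℝ (Fin d)} (hv : v ∈ halfSpace d)
    (hu : u ∈ halfSpace d) {c : ℝ} (hc : 0 ≤ c) : v + c • u ∈ halfSpace d := fun i hi => by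
  simp only [PiLp.add_apply, PiLp.smul_apply, smul_eq_mul]
  exact add_nonneg (hv i hi) (mul_nonneg hc (hu i hi))

theorem measurableSet_halfSpace (d : ℕ) : MeasurableSet (halfSpace d) := by
  have : halfSpace d = ⋂ i : Fin d, {v | (i : ℕ) = 0 → 0 ≤ v i} := by
    ext v
    simp [halfSpace]
  rw [this]
  refine MeasurableSet.iInter fun i => ?_
  by_cases hi : (i : ℕ) = 0
  · simp only [hi, true_imp_iff]
    exact measurableSet_le measurable_const (by fun_prop)
  · simp [hi]

theorem volume_halfSpace_inter_ball_pos (d : ℕ) :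
    0 < volume (halfSpace d ∩ Metric.ball 0 1) := by
  set o : EuclideanSpace ℝ (Fin d) := WithLp.toLp 2 fun _ => 1
  set p := (‖o‖ + 1)⁻¹ • o
  have hpos : 0 < (‖o‖ + 1)⁻¹ := by positivity
  refine Measure.measure_pos_of_mem_nhds volume (x := p) (inter_mem (interior_mem_nhds fun i _ => ?_)
    (Metric.isOpen_ball.mem_nhds ?_))
  · simpa [p, o] using hpos
  · rw [mem_ball_zero_iff, norm_smul, Real.norm_of_nonneg hpos.le, inv_mul_lt_iff₀ (by positivity)]
    linarith

/-- Gaussian integrals over a compact submanifold are bounded below, uniformly in the center. -/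
theorem IsSubmanifoldWithBoundary.exists_le_lintegral_gaussianWeight
    (hM : IsSubmanifoldWithBoundary d M) (hMc : IsCompact M) :
    ∃ c : ℝ≥0, 0 < c ∧ ∀ᶠ t in 𝓝[>] (0 : ℝ), ∀ x ∈ M,
      c ≤ ∫⁻ y in M, ENNReal.ofReal (gaussianWeight d t x y)
        ∂Measure.euclideanHausdorffMeasure d := by
  refine hMc.induction_on (p := fun s => ∃ c : ℝ≥0, 0 < c ∧ ∀ᶠ t in 𝓝[>] (0 : ℝ), ∀ x ∈ s,
      c ≤ ∫⁻ y in M, ENNReal.ofReal (gaussianWeight d t x y)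
        ∂Measure.euclideanHausdorffMeasure d) ⟨1, by simp⟩ ?_ ?_ ?_
  · rintro s s' hs ⟨C, h0, hC⟩
    exact ⟨C, h0, hC.mono fun t h x hx => h x (hs hx)⟩
  · rintro s s' ⟨C, h0, hC⟩ ⟨C', h0', hC'⟩
    refine ⟨min C C', lt_min h0 h0', ?_⟩
    filter_upwards [hC, hC'] with t h h' x hx
    rcases hx with hx | hx
    · exact le_trans (by exact_mod_cast min_le_left _ _) (h x hx)
    · exact le_trans (by exact_mod_cast min_le_right _ _) (h' x hx)
  · intro x₀ hx₀
    obtain ⟨U, V, χ, ψ, hxU, h⟩ := hM.exists_isLocalParam hx₀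
    obtain ⟨K, hK1, hK⟩ := h.exists_isBilipschitzOn hx₀ hxU
    obtain ⟨r, ⟨hbil, hrU⟩, hr⟩ := (hK.and self_mem_nhdsWithin).exists
    have hr : 0 < r := hr
    have hKpos : (0 : ℝ) < K := lt_of_lt_of_le one_pos (by exact_mod_cast hK1)
    have hA : MeasurableSet (M ∩ Metric.ball x₀ r) := hMc.measurableSet.inter measurableSet_ball
    obtain ⟨ρ, hρ, himg⟩ := h.exists_subset_image hx₀ hxU hr
    set S : Set (EuclideanSpace ℝ (Fin d)) := halfSpace d ∩ Metric.ball 0 1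
    have hS : MeasurableSet S := (measurableSet_halfSpace d).inter measurableSet_ball
    set F : EuclideanSpace ℝ (Fin d) → ℝ≥0∞ := fun v =>
      ENNReal.ofReal (Real.exp (-(K : ℝ) ^ 2 * ‖v‖ ^ 2)) with hF
    set I := ∫⁻ v in S, F v with hI
    have hIpos : I ≠ 0 := by
      rw [hI, Ne, lintegral_eq_zero_iff (by fun_prop)]
      intro h0
      have h1 : (volume.restrict S) Set.univ = 0 := by
        refine measure_mono_null (fun v _ => ?_) (ae_iff.1 h0)
        simp [F, Real.exp_pos]
      rw [Measure.restrict_apply_univ] at h1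
      exact (volume_halfSpace_inter_ball_pos d).ne' h1
    have hIfin : I ≠ ⊤ := ((setLIntegral_le_lintegral _ _).trans_lt
      (lintegral_exp_neg_mul_sq_norm_lt_top d (by positivity))).ne
    have hKd : (K : ℝ≥0∞) ^ d ≠ 0 := pow_ne_zero _ (by
      rw [ENNReal.coe_ne_zero]
      exact_mod_cast hKpos.ne')
    obtain ⟨c, hc⟩ : ∃ c : ℝ≥0, (c : ℝ≥0∞) = I / (K : ℝ≥0∞) ^ d :=
      ENNReal.canLift.prf _ (ENNReal.div_ne_top hIfin hKd)
    have hcont : ∀ᶠ x in 𝓝[M] x₀, dist (χ x) (χ x₀) < ρ / 2 :=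
      ((h.contDiffAt hxU).continuousAt.eventually
        (Metric.ball_mem_nhds _ (by positivity : 0 < ρ / 2))).filter_mono nhdsWithin_le_nhds
    refine ⟨{x | x ∈ M ∩ Metric.ball x₀ r ∧ dist (χ x) (χ x₀) < ρ / 2}, ?_, c, ?_, ?_⟩
    · filter_upwards [hcont, self_mem_nhdsWithin,
        nhdsWithin_le_nhds (Metric.ball_mem_nhds x₀ hr)] with x h1 h2 h3 using ⟨⟨h2, h3⟩, h1⟩
    · rw [← ENNReal.coe_pos, hc]
      exact ENNReal.div_pos hIpos (by finiteness)
    have hsqrt : ∀ᶠ t in 𝓝[>] (0 : ℝ), √t < ρ / 2 := by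
      have : Tendsto (fun t => √t) (𝓝[>] 0) (𝓝 0) := by
        simpa using (Real.continuous_sqrt.tendsto 0).mono_left nhdsWithin_le_nhds
      exact this.eventually (gt_mem_nhds (by positivity))
    filter_upwards [self_mem_nhdsWithin, hsqrt] with t ht hts x hx
    have ht : 0 < t := ht
    obtain ⟨hxA, hxρ⟩ := hx
    have hxH : χ x ∈ halfSpace d := (h.mem_target x ⟨hxA.1, hrU hxA⟩).1
    set V' := halfSpace d ∩ Metric.ball (χ x₀) ρ
    have hV'm : MeasurableSet V' := (measurableSet_halfSpace d).inter measurableSet_ball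
    rw [hc]
    refine ENNReal.div_le_of_le_mul' ?_
    -- Unscaling by `√t` places the unit half ball `S` at `χ x`: it stays in the half space by the
    -- cone property, and within `ρ` of `χ x₀` because `√t` and the distance from `χ x` to `χ x₀`
    -- are below `ρ / 2`.
    calc I = ∫⁻ v, S.indicator F v := (lintegral_indicator hS _).symm
      _ = ∫⁻ v, ENNReal.ofReal (1 / t ^ ((d : ℝ) / 2)) * S.indicator F ((√t)⁻¹ • (v - χ x)) :=
        (lintegral_comp_rescale ht (χ x) (by measurability)).symm
      _ ≤ ∫⁻ v, V'.indicator (fun v => ENNReal.ofReal (1 / t ^ ((d : ℝ) / 2)) *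
            F ((√t)⁻¹ • (v - χ x))) v := by
        refine lintegral_mono fun v => ?_
        by_cases hv : (√t)⁻¹ • (v - χ x) ∈ S
        · rw [Set.indicator_of_mem hv, Set.indicator_of_mem]
          have hst := Real.sqrt_pos.2 ht
          have hveq : v = χ x + √t • ((√t)⁻¹ • (v - χ x)) := by
            rw [smul_inv_smul₀ hst.ne', add_sub_cancel]
          constructor
          · rw [hveq]
            exact add_smul_mem_halfSpace hxH hv.1 hst.le
          · have h1 := hv.2
            rw [mem_ball_zero_iff, norm_smul, norm_inv, Real.norm_of_nonneg hst.le,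
              inv_mul_lt_iff₀ hst, mul_one, ← dist_eq_norm] at h1
            have := dist_triangle v (χ x) (χ x₀)
            rw [Metric.mem_ball]
            linarith
        · rw [Set.indicator_of_notMem hv, mul_zero]
          exact zero_le
      _ = ∫⁻ v in V', ENNReal.ofReal (1 / t ^ ((d : ℝ) / 2)) * F ((√t)⁻¹ • (v - χ x)) :=
        lintegral_indicator hV'm _
      _ ≤ (K : ℝ≥0∞) ^ d * ∫⁻ y in M ∩ Metric.ball x₀ r,
            ENNReal.ofReal (1 / t ^ ((d : ℝ) / 2)) * F ((√t)⁻¹ • (χ y - χ x))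
              ∂Measure.euclideanHausdorffMeasure d := by
        exact hbil.setLIntegral_le hA himg (F := fun v => ENNReal.ofReal (1 / t ^ ((d : ℝ) / 2)) *
            F ((√t)⁻¹ • (v - χ x))) (by fun_prop)
      _ ≤ (K : ℝ≥0∞) ^ d * ∫⁻ y in M ∩ Metric.ball x₀ r, ENNReal.ofReal (gaussianWeight d t x y)
              ∂Measure.euclideanHausdorffMeasure d := by
        refine mul_le_mul_right ?_ _
        refine setLIntegral_mono' hA fun y hy => ?_
        rw [hF, ← ENNReal.ofReal_mul (by positivity)]
        exact ENNReal.ofReal_le_ofReal (rescale_le_gaussianWeight ht (hbil x hxA y hy).2)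
      _ ≤ _ := by
        refine mul_le_mul_right ?_ _
        exact lintegral_mono_set Set.inter_subset_left

end GraphLaplacian

/-! ### Blow-up limits at interior points. -/

namespace GraphLaplacian

open scoped NNReal ENNReal

/-- Half of the exponent absorbs the linear factor. This turns kernels of quadratic growth in the
rescaled distance into Gaussian ones. -/
theorem one_add_mul_exp_neg_le {s : ℝ} : (1 + s) * Real.exp (-s) ≤ 2 * Real.exp (-(s / 2)) := by
  have h1 : 1 + s ≤ 2 * Real.exp (s / 2) := by
    have := Real.add_one_le_exp (s / 2)
    have := Real.exp_pos (s / 2)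
    linarith
  calc (1 + s) * Real.exp (-s) ≤ 2 * Real.exp (s / 2) * Real.exp (-s) := by gcongr
    _ = _ := by
      rw [mul_assoc, ← Real.exp_add]
      congr 2
      ring

/-- The data of a rescaled integrand near the point `x` of `M`: in the limit `t → 0`, `y → x`,
the function `g` becomes the profile `Q` in the coordinates `(L z - L y) / √t`. -/
structure IsBlowUp {N d : ℕ} (M : Set (EuclideanSpace ℝ (Fin N))) (x : EuclideanSpace ℝ (Fin N))
    (L : EuclideanSpace ℝ (Fin N) → EuclideanSpace ℝ (Fin d)) {ι : Type*} (l : Filter ι)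
    (t : ι → ℝ) (y : ι → EuclideanSpace ℝ (Fin N)) (g : ι → EuclideanSpace ℝ (Fin N) → ℝ)
    (Q : EuclideanSpace ℝ (Fin d) → ℝ) (C : ℝ) : Prop where
  tendsto_time : Tendsto t l (𝓝[>] 0)
  tendsto_center : Tendsto y l (𝓝[M] x)
  le_bound : ∀ᶠ i in l, ∀ z ∈ M, g i z ≤ C * (1 + ‖y i - z‖ ^ 2 / t i)
  measurable_profile : Measurable Q
  profile_nonneg : ∀ u, 0 ≤ Q u
  profile_le : ∀ u, Q u ≤ C * (1 + ‖u‖ ^ 2)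
  approx : ∀ ε > 0, ∀ᶠ p in l ×ˢ 𝓝[M] x,
    |g p.1 p.2 - Q ((√(t p.1))⁻¹ • (L p.2 - L (y p.1)))| ≤ ε * (1 + ‖y p.1 - p.2‖ ^ 2 / t p.1)

variable {N d : ℕ} {M : Set (EuclideanSpace ℝ (Fin N))} {x : EuclideanSpace ℝ (Fin N)}
  {L : EuclideanSpace ℝ (Fin N) → EuclideanSpace ℝ (Fin d)} {ι : Type*} {l : Filter ι}
  {t : ι → ℝ} {y : ι → EuclideanSpace ℝ (Fin N)} {g : ι → EuclideanSpace ℝ (Fin N) → ℝ}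
  {Q : EuclideanSpace ℝ (Fin d) → ℝ} {C : ℝ}

namespace IsBlowUp

theorem bound_nonneg (h : IsBlowUp M x L l t y g Q C) : 0 ≤ C := by
  have h1 := (h.profile_nonneg 0).trans (h.profile_le 0)
  simpa using h1

theorem exists_radius (h : IsBlowUp M x L l t y g Q C) {K : ℝ≥0}
    (hbil : ∀ᶠ r in 𝓝[>] (0 : ℝ), IsBilipschitzOn 1 K L (M ∩ Metric.ball x r))
    {ε : ℝ} (hε : 0 < ε) :
    ∃ r > 0, IsBilipschitzOn 1 K L (M ∩ Metric.ball x r) ∧ ∀ᶠ i in l, 0 < t i ∧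
      y i ∈ M ∩ Metric.ball x (r / 2) ∧ ∀ z ∈ M ∩ Metric.ball x r,
        |g i z - Q ((√(t i))⁻¹ • (L z - L (y i)))| ≤ ε * (1 + ‖y i - z‖ ^ 2 / t i) := by
  obtain ⟨p, hp, q, hq, hpq⟩ := eventually_prod_iff.1 (h.approx ε hε)
  obtain ⟨r₀, hr₀, hball⟩ := Metric.mem_nhdsWithin_iff.1 hq
  obtain ⟨r, hbr, hr⟩ := (hbil.and (Ioo_mem_nhdsGT hr₀)).exists
  refine ⟨r, hr.1, hbr, ?_⟩
  have hy := h.tendsto_center.eventually (inter_mem (self_mem_nhdsWithin (s := M) (a := x))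
    (nhdsWithin_le_nhds (Metric.ball_mem_nhds x (half_pos hr.1))))
  have ht := h.tendsto_time.eventually self_mem_nhdsWithin
  filter_upwards [hp, hy, ht] with i h1 h2 h3
  exact ⟨h3, h2, fun z hz => hpq h1 (hball ⟨Metric.ball_subset_ball hr.2.le hz.2, hz.1⟩)⟩

theorem one_add_sq_div_le {K : ℝ≥0} (hK : 1 ≤ K) {t : ℝ} (ht : 0 < t)
    {a b : EuclideanSpace ℝ (Fin N)} (h : dist a b ≤ K * dist (L a) (L b)) :
    1 + ‖a - b‖ ^ 2 / t ≤ (K : ℝ) ^ 2 * (1 + ‖(√t)⁻¹ • (L b - L a)‖ ^ 2) := by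
  have hK' : (1 : ℝ) ≤ K := by exact_mod_cast hK
  rw [norm_inv_sqrt_smul_sq ht, mul_add, mul_one, ← mul_div_assoc, ← mul_pow]
  rw [dist_eq_norm, dist_eq_norm'] at h
  gcongr
  nlinarith

/-- As `L` is 1-Lipschitz, passing to `ℝ^d` only increases the weight; the measure costs `K ^ d`.
Away from `x`, quadratic growth of `g` loses against the exponential decay. -/
theorem eventually_lintegral_le (h : IsBlowUp M x L l t y g Q C) (hMc : IsCompact M)
    (hfin : Measure.euclideanHausdorffMeasure d M < ⊤) {K : ℝ≥0} (hK : 1 ≤ K)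
    (hbil : ∀ᶠ r in 𝓝[>] (0 : ℝ), IsBilipschitzOn 1 K L (M ∩ Metric.ball x r))
    {ε : ℝ} (hε : 0 < ε) : ∀ᶠ i in l,
    ∫⁻ z in M, ENNReal.ofReal (gaussianWeight d (t i) (y i) z * g i z)
        ∂Measure.euclideanHausdorffMeasure d ≤
      (K : ℝ≥0∞) ^ d * (∫⁻ u : EuclideanSpace ℝ (Fin d),
        ENNReal.ofReal (Real.exp (-‖u‖ ^ 2) * (Q u + ε * (K ^ 2 * (1 + ‖u‖ ^ 2))))) +
        ENNReal.ofReal ε := by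
  have hQm := h.measurable_profile
  have hC := h.bound_nonneg
  obtain ⟨r, hr, hbil, hnear⟩ := h.exists_radius hbil hε
  have hA : MeasurableSet (M ∩ Metric.ball x r) := hMc.measurableSet.inter measurableSet_ball
  set m := (Measure.euclideanHausdorffMeasure d M).toReal with hm
  have hdec := ((tendsto_one_div_rpow_mul_exp ((d : ℝ) / 2)
      (by positivity : 0 < (r / 2) ^ 2 / 2)).const_mul (2 * C)).comp h.tendsto_time
  rw [mul_zero] at hdec
  have hεm : 0 < ε / (m + 1) := by positivity
  filter_upwards [hnear, h.le_bound, hdec.eventually (ge_mem_nhds hεm)] with i hi hgC hd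
  obtain ⟨ht, hyi, hgQ⟩ := hi
  have hyr : y i ∈ M ∩ Metric.ball x r := ⟨hyi.1, Metric.ball_subset_ball (by linarith) hyi.2⟩
  rw [← lintegral_add_compl (μ := (Measure.euclideanHausdorffMeasure d).restrict M) _
      (measurableSet_ball (x := x) (ε := r)), Measure.restrict_restrict measurableSet_ball,
      Set.inter_comm]
  refine add_le_add ?_ ?_
  · set F : EuclideanSpace ℝ (Fin d) → ℝ≥0∞ := fun u =>
        ENNReal.ofReal (Real.exp (-‖u‖ ^ 2) * (Q u + ε * (K ^ 2 * (1 + ‖u‖ ^ 2)))) with hF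
    have hFm : Measurable F := by fun_prop
    calc _ ≤ ∫⁻ z in M ∩ Metric.ball x r, (fun v => ENNReal.ofReal (1 / t i ^ ((d : ℝ) / 2)) *
            F ((√(t i))⁻¹ • (v - L (y i)))) (L z) ∂Measure.euclideanHausdorffMeasure d := by
          refine setLIntegral_mono' hA fun z hz => ?_
          beta_reduce
          rw [hF, ← ENNReal.ofReal_mul (by positivity)]
          refine ENNReal.ofReal_le_ofReal ?_
          obtain ⟨b1, b2⟩ := hbil _ hyr z hz
          have h1 := gaussianWeight_le_rescale (d := d) ht one_pos (by simpa using b1)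
          have h2 := one_add_sq_div_le hK ht b2
          have h3 := (abs_le.1 (hgQ z hz)).2
          rw [← mul_assoc]
          simp only [one_pow, inv_one, neg_mul, one_mul] at h1
          have h4 := h.profile_nonneg ((√(t i))⁻¹ • (L z - L (y i)))
          refine mul_le_mul_of_nonneg h1 ?_ (gaussianWeight_nonneg ht _ _) (by positivity)
          have := mul_le_mul_of_nonneg_left h2 hε.le
          linarith
      _ ≤ (K : ℝ≥0∞) ^ d * ∫⁻ u, F u := by
          refine (hbil.lintegral_comp_le hA (F := fun v =>
            ENNReal.ofReal (1 / t i ^ ((d : ℝ) / 2)) * F ((√(t i))⁻¹ • (v - L (y i))))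
              (by fun_prop)).trans (le_of_eq ?_)
          rw [lintegral_comp_rescale ht _ hFm]
  · calc _ ≤ ∫⁻ z in (Metric.ball x r)ᶜ, ENNReal.ofReal (ε / (m + 1))
              ∂(Measure.euclideanHausdorffMeasure d).restrict M := by
            refine lintegral_mono_ae ?_
            rw [Measure.restrict_restrict measurableSet_ball.compl]
            refine ae_restrict_of_forall_mem
              (measurableSet_ball.compl.inter hMc.measurableSet) fun z hz => ?_
            refine ENNReal.ofReal_le_ofReal (le_trans ?_ hd)
            have h1 := Metric.mem_ball.1 hyi.2
            have h2 : r ≤ dist z x := not_lt.1 hz.1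
            have h3 := dist_triangle z (y i) x
            have h4 : r / 2 ≤ ‖y i - z‖ := by
              rw [← dist_eq_norm, dist_comm]
              linarith
            calc gaussianWeight d (t i) (y i) z * g i z
                ≤ gaussianWeight d (t i) (y i) z * (C * (1 + ‖y i - z‖ ^ 2 / t i)) :=
                  mul_le_mul_of_nonneg_left (hgC z hz.2) (gaussianWeight_nonneg ht _ _)
              _ = 1 / t i ^ ((d : ℝ) / 2) * C * ((1 + ‖y i - z‖ ^ 2 / t i) *
                    Real.exp (-(‖y i - z‖ ^ 2 / t i))) := by
                  unfold gaussianWeight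
                  ring
              _ ≤ 1 / t i ^ ((d : ℝ) / 2) * C * (2 * Real.exp (-(‖y i - z‖ ^ 2 / t i / 2))) := 
                  mul_le_mul_of_nonneg_left one_add_mul_exp_neg_le (by positivity)
              _ ≤ 1 / t i ^ ((d : ℝ) / 2) * C * (2 * Real.exp (-((r / 2) ^ 2 / t i / 2))) := by
                  gcongr
              _ = _ := by
                  rw [Function.comp_apply, div_right_comm ((r / 2) ^ 2)]
                  ring
      _ ≤ ENNReal.ofReal (ε / (m + 1)) * Measure.euclideanHausdorffMeasure d M := by
            rw [setLIntegral_const]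
            refine mul_le_mul_right ((measure_mono (Set.subset_univ _)).trans (le_of_eq ?_)) _
            rw [Measure.restrict_apply_univ]
      _ ≤ ENNReal.ofReal ε := by
            rw [← ENNReal.ofReal_toReal hfin.ne, ← ENNReal.ofReal_mul hεm.le, ← hm]
            refine ENNReal.ofReal_le_ofReal ?_
            rw [div_mul_eq_mul_div, div_le_iff₀ (by positivity)]
            nlinarith

/-- Here the measure comparison is free, since `L` is 1-Lipschitz, and the factor `K ^ 2` enters the
exponent. The window of radius `R` shrinks to size `√t * R < ρ / 2` and so fits into the image of
`M`. -/
theorem eventually_le_lintegral (h : IsBlowUp M x L l t y g Q C) (hMc : IsCompact M)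
    (hx : x ∈ M) {K : ℝ≥0} (hK : 1 ≤ K)
    (hbil : ∀ᶠ r in 𝓝[>] (0 : ℝ), IsBilipschitzOn 1 K L (M ∩ Metric.ball x r))
    (himg : ∀ r > 0, L '' (M ∩ Metric.ball x r) ∈ 𝓝 (L x))
    {ε : ℝ} (hε : 0 < ε) {R : ℝ} (hR : 0 < R) : ∀ᶠ i in l,
      ∫⁻ u in Metric.ball (0 : EuclideanSpace ℝ (Fin d)) R,
        ENNReal.ofReal (Real.exp (-K ^ 2 * ‖u‖ ^ 2) * (Q u - ε * (K ^ 2 * (1 + ‖u‖ ^ 2)))) ≤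
    ∫⁻ z in M, ENNReal.ofReal (gaussianWeight d (t i) (y i) z * g i z)
        ∂Measure.euclideanHausdorffMeasure d := by
  have hQm := h.measurable_profile
  obtain ⟨r, hr, hbil, hnear⟩ := h.exists_radius hbil hε
  have hA : MeasurableSet (M ∩ Metric.ball x r) := hMc.measurableSet.inter measurableSet_ball
  obtain ⟨ρ, hρ, hball⟩ := Metric.mem_nhds_iff.1 (himg r hr)
  have hsqrt : ∀ᶠ i in l, √(t i) < ρ / 2 / R := by
    have : Tendsto (fun t => √t) (𝓝[>] 0) (𝓝 0) := by
      simpa using (Real.continuous_sqrt.tendsto 0).mono_left nhdsWithin_le_nhds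
    exact (this.comp h.tendsto_time).eventually (gt_mem_nhds (by positivity))
  have hyρ : ∀ᶠ i in l, dist (y i) x < ρ / 2 :=
    (h.tendsto_center.mono_right nhdsWithin_le_nhds).eventually
      (Metric.ball_mem_nhds x (half_pos hρ))
  filter_upwards [hnear, hsqrt, hyρ] with i hi hs hyρ
  obtain ⟨ht, hyi, hgQ⟩ := hi
  have hyr : y i ∈ M ∩ Metric.ball x r := ⟨hyi.1, Metric.ball_subset_ball (by linarith) hyi.2⟩
  have hst := Real.sqrt_pos.2 ht
  have hLy : dist (L (y i)) (L x) < ρ / 2 := by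
    have := (hbil _ hyr x ⟨hx, Metric.mem_ball_self hr⟩).1
    rw [NNReal.coe_one, one_mul] at this
    exact this.trans_lt hyρ
  set F : EuclideanSpace ℝ (Fin d) → ℝ≥0∞ := fun u =>
    ENNReal.ofReal (Real.exp (-K ^ 2 * ‖u‖ ^ 2) * (Q u - ε * (K ^ 2 * (1 + ‖u‖ ^ 2)))) with hF
  have hFm : Measurable F := by fun_prop
  set B : Set (EuclideanSpace ℝ (Fin d)) := Metric.ball 0 R
  calc ∫⁻ u in B, F u = ∫⁻ u, B.indicator F u := (lintegral_indicator measurableSet_ball _).symm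
    _ = ∫⁻ v, ENNReal.ofReal (1 / t i ^ ((d : ℝ) / 2)) *
          B.indicator F ((√(t i))⁻¹ • (v - L (y i))) :=
      (lintegral_comp_rescale ht _ (hFm.indicator measurableSet_ball)).symm
    _ ≤ ∫⁻ v, (Metric.ball (L x) ρ).indicator (fun v => ENNReal.ofReal (1 / t i ^ ((d : ℝ) / 2)) *
          F ((√(t i))⁻¹ • (v - L (y i)))) v := by
      refine lintegral_mono fun v => ?_
      by_cases hv : (√(t i))⁻¹ • (v - L (y i)) ∈ B
      · rw [Set.indicator_of_mem hv, Set.indicator_of_mem]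
        rw [mem_ball_zero_iff, norm_smul, norm_inv, Real.norm_of_nonneg hst.le,
            inv_mul_lt_iff₀ hst, ← dist_eq_norm] at hv
        rw [lt_div_iff₀ hR] at hs
        have := dist_triangle v (L (y i)) (L x)
        rw [Metric.mem_ball]
        linarith
      · rw [Set.indicator_of_notMem hv, mul_zero]
        exact zero_le
    _ = ∫⁻ v in Metric.ball (L x) ρ, ENNReal.ofReal (1 / t i ^ ((d : ℝ) / 2)) *
          F ((√(t i))⁻¹ • (v - L (y i))) := lintegral_indicator measurableSet_ball _
    _ ≤ (1 : ℝ≥0) ^ d * ∫⁻ z in M ∩ Metric.ball x r, ENNReal.ofReal (1 / t i ^ ((d : ℝ) / 2)) *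
            F ((√(t i))⁻¹ • (L z - L (y i))) ∂Measure.euclideanHausdorffMeasure d :=
      hbil.setLIntegral_le hA hball (F := fun v => ENNReal.ofReal (1 / t i ^ ((d : ℝ) / 2)) *
            F ((√(t i))⁻¹ • (v - L (y i)))) (by fun_prop)
    _ = ∫⁻ z in M ∩ Metric.ball x r, ENNReal.ofReal (1 / t i ^ ((d : ℝ) / 2)) *
            F ((√(t i))⁻¹ • (L z - L (y i))) ∂Measure.euclideanHausdorffMeasure d := by simp
    _ ≤ ∫⁻ z in M ∩ Metric.ball x r, ENNReal.ofReal (gaussianWeight d (t i) (y i) z * g i z)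
            ∂Measure.euclideanHausdorffMeasure d := by
      refine setLIntegral_mono' hA fun z hz => ?_
      rw [hF, ← ENNReal.ofReal_mul (by positivity), ← mul_assoc]
      obtain ⟨b1, b2⟩ := hbil _ hyr z hz
      have h1 := rescale_le_gaussianWeight (d := d) ht b2
      have h2 := mul_le_mul_of_nonneg_left (one_add_sq_div_le hK ht b2) hε.le
      have h3 := (abs_le.1 (hgQ z hz)).1
      set u := (√(t i))⁻¹ • (L z - L (y i))
      rcases le_total 0 (Q u - ε * (K ^ 2 * (1 + ‖u‖ ^ 2))) with h4 | h4
      · refine ENNReal.ofReal_le_ofReal (mul_le_mul h1 (by linarith) h4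
          (gaussianWeight_nonneg ht _ _))
      · rw [ENNReal.ofReal_of_nonpos]
        · exact zero_le
        · exact mul_nonpos_of_nonneg_of_nonpos (by positivity) h4
    _ ≤ _ := lintegral_mono_set Set.inter_subset_left

theorem lintegral_profile_lt_top (h : IsBlowUp M x L l t y g Q C) {a : ℝ} (ha : 0 ≤ a) :
    ∫⁻ u : EuclideanSpace ℝ (Fin d),
      ENNReal.ofReal (Real.exp (-‖u‖ ^ 2) * (Q u + a * (1 + ‖u‖ ^ 2))) < ⊤ := by
  have hC := h.bound_nonneg
  have hle : ∀ u : EuclideanSpace ℝ (Fin d),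
      Real.exp (-‖u‖ ^ 2) * (Q u + a * (1 + ‖u‖ ^ 2)) ≤
        (C + a) * 2 * Real.exp (-(1 / 2) * ‖u‖ ^ 2) := fun u => by
    calc _ ≤ Real.exp (-‖u‖ ^ 2) * (C * (1 + ‖u‖ ^ 2) + a * (1 + ‖u‖ ^ 2)) := by
          gcongr
          exact h.profile_le u
      _ = (C + a) * ((1 + ‖u‖ ^ 2) * Real.exp (-‖u‖ ^ 2)) := by ring
      _ ≤ (C + a) * (2 * Real.exp (-(‖u‖ ^ 2 / 2))) := 
          mul_le_mul_of_nonneg_left one_add_mul_exp_neg_le (by positivity)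
      _ = _ := by
          rw [mul_assoc]
          congr 3
          ring
  refine (lintegral_mono fun u => ENNReal.ofReal_le_ofReal (hle u)).trans_lt ?_
  exact ((integrable_exp_neg_mul_sq_norm d (by norm_num : (0 : ℝ) < 1 / 2)).const_mul
    _).lintegral_lt_top

theorem tendsto_lintegral (h : IsBlowUp M x L l t y g Q C) (hMc : IsCompact M)
    (hfin : Measure.euclideanHausdorffMeasure d M < ⊤) (hx : x ∈ M)
    (hbil : ∀ K : ℝ≥0, 1 < K →
      ∀ᶠ r in 𝓝[>] (0 : ℝ), IsBilipschitzOn 1 K L (M ∩ Metric.ball x r))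
    (himg : ∀ r > 0, L '' (M ∩ Metric.ball x r) ∈ 𝓝 (L x)) :
    Tendsto (fun i => ∫⁻ z in M, ENNReal.ofReal (gaussianWeight d (t i) (y i) z * g i z)
        ∂Measure.euclideanHausdorffMeasure d) l
      (𝓝 (∫⁻ u : EuclideanSpace ℝ (Fin d), ENNReal.ofReal (Real.exp (-‖u‖ ^ 2) * Q u))) := by
  have hQm := h.measurable_profile
  have hQ0 := h.profile_nonneg
  have hC := h.bound_nonneg
  -- For each `n` take error `1 / (n + 1)`, bi-Lipschitz constant `1 + 1 / (n + 1)` and window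
  -- radius `n + 1`. Both bounds then tend to the profile integral by dominated convergence. Each
  -- holds eventually along `l` for fixed `n`, so `n` is chosen before passing to the limit in `l`.
  set e : ℕ → ℝ := fun n => 1 / ((n : ℝ) + 1) with he
  have he0 : ∀ n, 0 < e n := fun n => by positivity
  have he1 : ∀ n, e n ≤ 1 := fun n => by
    rw [he, div_le_one (by positivity)]
    have : (0 : ℝ) ≤ n := Nat.cast_nonneg n
    linarith
  have helim : Tendsto e atTop (𝓝 0) := tendsto_one_div_add_atTop_nhds_zero_nat
  set K : ℕ → ℝ≥0 := fun n => 1 + ⟨e n, (he0 n).le⟩ with hKdef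
  have hKr : ∀ n, (K n : ℝ) = 1 + e n := fun n => rfl
  have hK1 : ∀ n, 1 < K n := fun n => by
    rw [← NNReal.coe_lt_coe, hKr, NNReal.coe_one]
    linarith [he0 n]
  have hKlim : Tendsto (fun n => (K n : ℝ)) atTop (𝓝 1) := by
    simp_rw [hKr]
    simpa using helim.const_add 1
  have hεK : Tendsto (fun n => e n * (K n : ℝ) ^ 2) atTop (𝓝 0) := by
    simpa using helim.mul (hKlim.pow 2)
  have hεK4 : ∀ n, e n * (K n : ℝ) ^ 2 ≤ 4 := fun n => by
    rw [hKr]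
    nlinarith [he0 n, he1 n, mul_pos (he0 n) (he0 n)]
  have hlimU : Tendsto (fun n => (K n : ℝ≥0∞) ^ d * (∫⁻ u : EuclideanSpace ℝ (Fin d),
        ENNReal.ofReal (Real.exp (-‖u‖ ^ 2) * (Q u + e n * (K n ^ 2 * (1 + ‖u‖ ^ 2))))) +
        ENNReal.ofReal (e n)) atTop
      (𝓝 (∫⁻ u : EuclideanSpace ℝ (Fin d), ENNReal.ofReal (Real.exp (-‖u‖ ^ 2) * Q u))) := by
    have h1 : Tendsto (fun n => (K n : ℝ≥0∞) ^ d) atTop (𝓝 1) := by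
      have : Tendsto (fun n => (K n : ℝ≥0∞)) atTop (𝓝 ((1 : ℝ≥0) : ℝ≥0∞)) := by
        rw [ENNReal.tendsto_coe, ← NNReal.tendsto_coe]
        exact hKlim
      simpa using ENNReal.Tendsto.pow (n := d) this
    have h2 : Tendsto (fun n => ∫⁻ u : EuclideanSpace ℝ (Fin d),
        ENNReal.ofReal (Real.exp (-‖u‖ ^ 2) * (Q u + e n * (K n ^ 2 * (1 + ‖u‖ ^ 2))))) atTop
        (𝓝 (∫⁻ u : EuclideanSpace ℝ (Fin d), ENNReal.ofReal (Real.exp (-‖u‖ ^ 2) * Q u))) := by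
      refine tendsto_lintegral_of_dominated_convergence
        (fun u => ENNReal.ofReal (Real.exp (-‖u‖ ^ 2) * (Q u + 4 * (1 + ‖u‖ ^ 2))))
        (fun n => by fun_prop) (fun n => ae_of_all _ fun u => ?_)
        (h.lintegral_profile_lt_top (by norm_num)).ne (ae_of_all _ fun u => ?_)
      · refine ENNReal.ofReal_le_ofReal ?_
        rw [← mul_assoc (e n)]
        gcongr
        exact hεK4 n
      · refine ENNReal.tendsto_ofReal ?_
        have := ((hεK.mul_const (1 + ‖u‖ ^ 2)).const_add (Q u)).const_mul (Real.exp (-‖u‖ ^ 2))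
        simpa [mul_assoc] using this
    have h3 : Tendsto (fun n => ENNReal.ofReal (e n)) atTop (𝓝 0) := by
      simpa using ENNReal.tendsto_ofReal helim
    simpa using (ENNReal.Tendsto.mul h1 (Or.inl one_ne_zero) h2 (Or.inr ENNReal.one_ne_top)).add h3
  have hlimL : Tendsto (fun n : ℕ => ∫⁻ u in Metric.ball (0 : EuclideanSpace ℝ (Fin d)) ((n : ℝ) + 1),
        ENNReal.ofReal (Real.exp (-K n ^ 2 * ‖u‖ ^ 2) *
          (Q u - e n * (K n ^ 2 * (1 + ‖u‖ ^ 2))))) atTop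
      (𝓝 (∫⁻ u : EuclideanSpace ℝ (Fin d), ENNReal.ofReal (Real.exp (-‖u‖ ^ 2) * Q u))) := by
    simp_rw [← lintegral_indicator measurableSet_ball]
    refine tendsto_lintegral_of_dominated_convergence
        (fun u => ENNReal.ofReal (Real.exp (-‖u‖ ^ 2) * (Q u + 0 * (1 + ‖u‖ ^ 2))))
        (fun n => Measurable.indicator (by fun_prop) measurableSet_ball)
        (fun n => ae_of_all _ fun u => ?_)
        (h.lintegral_profile_lt_top le_rfl).ne (ae_of_all _ fun u => ?_)
    · refine (Set.indicator_le_self _ _ u).trans (ENNReal.ofReal_le_ofReal ?_)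
      rw [zero_mul, add_zero]
      calc _ ≤ Real.exp (-K n ^ 2 * ‖u‖ ^ 2) * Q u := by
            gcongr
            have := he0 n
            exact sub_le_self _ (by positivity)
        _ ≤ _ := by
            have := hQ0 u
            gcongr
            have : (1 : ℝ) ≤ K n := by exact_mod_cast (hK1 n).le
            rw [neg_mul, neg_le_neg_iff]
            exact le_mul_of_one_le_left (sq_nonneg _) (one_le_pow₀ this)
    · have h1 : Tendsto (fun n => ENNReal.ofReal (Real.exp (-K n ^ 2 * ‖u‖ ^ 2) *
          (Q u - e n * (K n ^ 2 * (1 + ‖u‖ ^ 2))))) atTop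
          (𝓝 (ENNReal.ofReal (Real.exp (-‖u‖ ^ 2) * Q u))) := by
        refine ENNReal.tendsto_ofReal ?_
        have a1 : Tendsto (fun n => Real.exp (-(K n : ℝ) ^ 2 * ‖u‖ ^ 2)) atTop
            (𝓝 (Real.exp (-‖u‖ ^ 2))) := by
          refine (Real.continuous_exp.tendsto _).comp ?_
          simpa using ((hKlim.pow 2).neg).mul_const (‖u‖ ^ 2)
        have a2 := (hεK.mul_const (1 + ‖u‖ ^ 2)).const_sub (Q u)
        simpa [mul_assoc] using a1.mul a2
      refine h1.congr' ?_
      obtain ⟨m, hm⟩ := exists_nat_gt ‖u‖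
      filter_upwards [eventually_ge_atTop m] with n hn
      rw [Set.indicator_of_mem]
      rw [mem_ball_zero_iff]
      have : (m : ℝ) ≤ n := by exact_mod_cast hn
      linarith
  refine tendsto_order.2 ⟨fun a ha => ?_, fun b hb => ?_⟩
  · obtain ⟨n, hn⟩ := (hlimL.eventually (lt_mem_nhds ha)).exists
    filter_upwards [h.eventually_le_lintegral hMc hx (hK1 n).le (hbil _ (hK1 n)) himg (he0 n)
      (by positivity : (0 : ℝ) < n + 1)] with i hi using hn.trans_le hi
  · obtain ⟨n, hn⟩ := (hlimU.eventually (gt_mem_nhds hb)).exists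
    filter_upwards [h.eventually_lintegral_le hMc hfin (hK1 n).le (hbil _ (hK1 n)) (he0 n)]
      with i hi using hi.trans_lt hn

end IsBlowUp

end GraphLaplacian

/-! ### Gaussian moments. -/

namespace GraphLaplacian

theorem integrable_pow_mul_exp_neg_sq (m : ℕ) :
    Integrable fun s : ℝ => s ^ m * Real.exp (-s ^ 2) := by
  have := integrable_rpow_mul_exp_neg_mul_sq one_pos (s := (m : ℝ))
    (by linarith [Nat.cast_nonneg (α := ℝ) m])
  simpa using this

theorem integral_mul_exp_neg_sq : ∫ s : ℝ, s * Real.exp (-s ^ 2) = 0 := by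
  have h := integral_neg_eq_self (fun s : ℝ => s * Real.exp (-s ^ 2)) volume
  simp only [neg_sq, neg_mul, integral_neg] at h
  linarith

theorem integral_sq_mul_exp_neg_sq : ∫ s : ℝ, s ^ 2 * Real.exp (-s ^ 2) = √Real.pi / 2 := by
  have h1 := integral_comp_abs (f := fun s : ℝ => s ^ 2 * Real.exp (-s ^ 2))
  simp only [sq_abs] at h1
  rw [h1]
  have h2 := integral_rpow_mul_exp_neg_mul_rpow (p := 2) (q := 2) (b := 1)
    two_pos (by norm_num) one_pos
  have h3 : ∫ s in Set.Ioi (0 : ℝ), s ^ 2 * Real.exp (-s ^ 2) =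
      1 / 2 * Real.Gamma (1 / 2 + 1) := by
    rw [show (1 / 2 + 1 : ℝ) = (2 + 1) / 2 by norm_num]
    simpa using h2
  rw [h3, Real.Gamma_add_one (by norm_num), Real.Gamma_one_half_eq]
  ring

theorem integral_exp_neg_sq_norm (d : ℕ) :
    ∫ u : EuclideanSpace ℝ (Fin d), Real.exp (-‖u‖ ^ 2) = Real.pi ^ ((d : ℝ) / 2) := by
  have := GaussianFourier.integral_rexp_neg_mul_sq_norm (V := EuclideanSpace ℝ (Fin d)) one_pos
  simpa using this

/-- The exponents of the monomial `u_i u_j`. -/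
def monomialExponent {d : ℕ} (i j k : Fin d) : ℕ := (if k = i then 1 else 0) + if k = j then 1 else 0

theorem prod_pow_monomialExponent {d : ℕ} (i j : Fin d) (u : Fin d → ℝ) :
    ∏ k, u k ^ monomialExponent i j k = u i * u j := by
  simp_rw [monomialExponent, pow_add, Finset.prod_mul_distrib, pow_ite, pow_one, pow_zero]
  simp

/-- The integrand is a product over coordinates. For `i ≠ j` the factor at `i` is odd and integrates
to zero; for `i = j` that factor has half the Gaussian mass. -/
theorem integral_monomial_mul_exp_neg_sq {d : ℕ} (i j : Fin d) :
    ∫ u : Fin d → ℝ, ∏ k, (u k ^ monomialExponent i j k * Real.exp (-u k ^ 2)) =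
      if i = j then Real.pi ^ ((d : ℝ) / 2) / 2 else 0 := by
  rw [integral_fintype_prod_volume_eq_prod
    (fun k (s : ℝ) => s ^ monomialExponent i j k * Real.exp (-s ^ 2))]
  split_ifs with hij
  · subst hij
    have h : ∀ k, ∫ s : ℝ, s ^ monomialExponent i i k * Real.exp (-s ^ 2) =
        √Real.pi * if k = i then 1 / 2 else 1 := fun k => by
      by_cases hk : k = i
      · simp only [monomialExponent, hk, if_true]
        rw [integral_sq_mul_exp_neg_sq]
        ring
      · have := integral_gaussian 1
        simpa [monomialExponent, hk] using this
    simp_rw [h, Finset.prod_mul_distrib]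
    rw [Finset.prod_const, Finset.card_univ, Fintype.card_fin, Finset.prod_ite_eq' Finset.univ i,
      if_pos (Finset.mem_univ i), Real.sqrt_eq_rpow, ← Real.rpow_natCast,
      ← Real.rpow_mul Real.pi_pos.le]
    rw [show (1 / 2 * (d : ℝ)) = d / 2 by ring]
    ring
  · refine Finset.prod_eq_zero (Finset.mem_univ i) ?_
    simp only [monomialExponent, if_true, if_neg hij, add_zero, pow_one]
    exact integral_mul_exp_neg_sq

/-- The Gaussian second moment of a linear form. -/
theorem integral_exp_neg_sq_norm_mul_sq {d : ℕ} (ℓ : EuclideanSpace ℝ (Fin d) →L[ℝ] ℝ) :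
    ∫ u : EuclideanSpace ℝ (Fin d), Real.exp (-‖u‖ ^ 2) * ℓ u ^ 2 =
      Real.pi ^ ((d : ℝ) / 2) / 2 * ‖ℓ‖ ^ 2 := by
  set a := (InnerProductSpace.toDual ℝ (EuclideanSpace ℝ (Fin d))).symm ℓ with ha
  have hℓ : ∀ u, ℓ u = ∑ i, a i * u i := fun u => by
    rw [← InnerProductSpace.toDual_symm_apply (x := u) (y := ℓ), ← ha, PiLp.inner_apply]
    simp [mul_comm]
  have hn : ‖ℓ‖ ^ 2 = ∑ i, a i * a i := by
    rw [← LinearIsometryEquiv.norm_map (InnerProductSpace.toDual ℝ _).symm ℓ, ← ha,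
      EuclideanSpace.real_norm_sq_eq]
    simp_rw [sq]
  have hpt : ∀ u : EuclideanSpace ℝ (Fin d), Real.exp (-‖u‖ ^ 2) * ℓ u ^ 2 =
      (fun v : Fin d → ℝ => ∑ i, ∑ j, a i * a j *
        ∏ k, (v k ^ monomialExponent i j k * Real.exp (-v k ^ 2))) (WithLp.ofLp u) := fun u => by
    simp_rw [Finset.prod_mul_distrib, prod_pow_monomialExponent, ← Real.exp_sum]
    rw [hℓ, EuclideanSpace.real_norm_sq_eq, Finset.sum_neg_distrib, sq, Finset.sum_mul_sum,
      Finset.mul_sum]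
    refine Finset.sum_congr rfl fun i _ => ?_
    rw [Finset.mul_sum]
    refine Finset.sum_congr rfl fun j _ => ?_
    ring
  have hint : ∀ i j, Integrable fun v : Fin d → ℝ => a i * a j *
      ∏ k, (v k ^ monomialExponent i j k * Real.exp (-v k ^ 2)) := fun i j =>
    (Integrable.fintype_prod (f := fun k (s : ℝ) => s ^ monomialExponent i j k * Real.exp (-s ^ 2))
      fun k => integrable_pow_mul_exp_neg_sq _).const_mul _
  simp_rw [hpt]
  rw [(PiLp.volume_preserving_ofLp (Fin d)).integral_comp
    (MeasurableEquiv.toLp 2 (Fin d → ℝ)).symm.measurableEmbedding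
    (fun v : Fin d → ℝ => ∑ i, ∑ j, a i * a j *
        ∏ k, (v k ^ monomialExponent i j k * Real.exp (-v k ^ 2))),
    integral_finsetSum _ fun i _ => integrable_finsetSum _ fun j _ => hint i j]
  simp_rw [integral_finsetSum _ fun j _ => hint _ j, integral_const_mul,
    integral_monomial_mul_exp_neg_sq]
  rw [hn, Finset.mul_sum]
  refine Finset.sum_congr rfl fun i _ => ?_
  simp [mul_comm]

end GraphLaplacian

/-! ### Degrees and local energies. -/

namespace GraphLaplacian

open scoped NNReal ENNReal

variable {N d : ℕ} {M : Set (EuclideanSpace ℝ (Fin N))} {x : EuclideanSpace ℝ (Fin N)}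
  {f p : EuclideanSpace ℝ (Fin N) → ℝ}

/-- A `C¹` function on a compact submanifold is Lipschitz for the distance of `ℝ^N`. -/
theorem IsSubmanifoldWithBoundary.exists_lipschitzOnWith (hM : IsSubmanifoldWithBoundary d M)
    (hMc : IsCompact M) (hf : ContDiffOn ℝ 1 f M) : ∃ K, LipschitzOnWith K f M := by
  refine LocallyLipschitzOn.exists_lipschitzOnWith_of_compact hMc fun x hx => ?_
  obtain ⟨U, V, χ, ψ, hxU, h⟩ := hM.exists_isLocalParam hx
  have hv := h.mem_target x ⟨hx, hxU⟩
  obtain ⟨ρ, hρ, hball⟩ := Metric.isOpen_iff.1 h.isOpen_target _ hv.2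
  -- Since `f` is `C¹` only within `M`, a Lipschitz bound from derivatives needs a convex domain;
  -- the chart provides a half ball.
  set s := halfSpace d ∩ Metric.ball (χ x) ρ with hs
  have hfψ : ContDiffWithinAt ℝ 1 (f ∘ ψ) s (χ x) := by
    have h1 : ContDiffWithinAt ℝ 1 f M (ψ (χ x)) := by
      rw [h.left_inv x ⟨hx, hxU⟩]
      exact hf x hx
    exact h1.comp (χ x) (h.contDiffAt_symm hv.2).contDiffWithinAt fun v hv =>
      (h.mem_source v ⟨hv.1, hball hv.2⟩).1
  obtain ⟨K, T, hT, hKT⟩ :=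
    hfψ.exists_lipschitzOnWith ((convex_halfSpace d).inter (convex_ball _ _))
  obtain ⟨K', S, hS, hKS⟩ := (h.contDiffAt hxU).exists_lipschitzOnWith
  have hχ : Tendsto χ (𝓝[M] x) (𝓝[s] (χ x)) := by
    refine tendsto_nhdsWithin_iff.2
      ⟨(h.contDiffAt hxU).continuousAt.tendsto.mono_left nhdsWithin_le_nhds, ?_⟩
    filter_upwards [self_mem_nhdsWithin, nhdsWithin_le_nhds (h.isOpen_source.mem_nhds hxU),
      nhdsWithin_le_nhds ((h.contDiffAt hxU).continuousAt.preimage_mem_nhds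
        (Metric.ball_mem_nhds _ hρ))] with y h1 h2 h3
    exact ⟨(h.mem_target y ⟨h1, h2⟩).1, h3⟩
  refine ⟨K * K', M ∩ U ∩ S ∩ χ ⁻¹' T, ?_, ?_⟩
  · filter_upwards [self_mem_nhdsWithin, nhdsWithin_le_nhds (h.isOpen_source.mem_nhds hxU),
      nhdsWithin_le_nhds hS, hχ hT] with y h1 h2 h3 h4 using ⟨⟨⟨h1, h2⟩, h3⟩, h4⟩
  · have h1 : LipschitzOnWith (K * K') ((f ∘ ψ) ∘ χ) (M ∩ U ∩ S ∩ χ ⁻¹' T) :=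
      hKT.comp (hKS.mono fun y hy => hy.1.2) fun y hy => hy.2
    intro y hy z hz
    have := h1 hy hz
    simpa only [Function.comp_apply, h.left_inv y hy.1.1, h.left_inv z hz.1.1] using this

theorem IsBlowUp.tendsto_toReal_lintegral
    {L : EuclideanSpace ℝ (Fin N) → EuclideanSpace ℝ (Fin d)} {ι : Type*} {l : Filter ι}
    {t : ι → ℝ} {y : ι → EuclideanSpace ℝ (Fin N)} {g : ι → EuclideanSpace ℝ (Fin N) → ℝ}
    {Q : EuclideanSpace ℝ (Fin d) → ℝ} {C : ℝ}
    (h : IsBlowUp M x L l t y g Q C) (hMc : IsCompact M)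
    (hfin : Measure.euclideanHausdorffMeasure d M < ⊤) (hx : x ∈ M)
    (hbil : ∀ K : ℝ≥0, 1 < K →
      ∀ᶠ r in 𝓝[>] (0 : ℝ), IsBilipschitzOn 1 K L (M ∩ Metric.ball x r))
    (himg : ∀ r > 0, L '' (M ∩ Metric.ball x r) ∈ 𝓝 (L x)) :
    Tendsto (fun i => (∫⁻ z in M, ENNReal.ofReal (gaussianWeight d (t i) (y i) z * g i z)
        ∂Measure.euclideanHausdorffMeasure d).toReal) l
      (𝓝 (∫ u : EuclideanSpace ℝ (Fin d), Real.exp (-‖u‖ ^ 2) * Q u)) := by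
  have hQm := h.measurable_profile
  rw [integral_eq_lintegral_of_nonneg_ae
    (ae_of_all _ fun u => mul_nonneg (Real.exp_pos _).le (h.profile_nonneg u))
    (by fun_prop)]
  refine (ENNReal.tendsto_toReal ?_).comp (h.tendsto_lintegral hMc hfin hx hbil himg)
  simpa using (h.lintegral_profile_lt_top le_rfl).ne

/-- The law of a random point of density `p` on `M`. -/
noncomputable def densityMeasure (d : ℕ) (M : Set (EuclideanSpace ℝ (Fin N)))
    (p : EuclideanSpace ℝ (Fin N) → ℝ) : Measure (EuclideanSpace ℝ (Fin N)) :=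
  (riemannianVolume d M).withDensity fun x => ENNReal.ofReal (p x)

theorem integral_densityMeasure (hp : Measurable p) {g : EuclideanSpace ℝ (Fin N) → ℝ}
    (hg : Measurable g) (hg0 : ∀ z, 0 ≤ g z) :
    ∫ z, g z ∂densityMeasure d M p = (∫⁻ z in M, ENNReal.ofReal (p z * g z)
      ∂Measure.euclideanHausdorffMeasure d).toReal := by
  rw [integral_eq_lintegral_of_nonneg_ae (ae_of_all _ hg0) hg.aestronglyMeasurable,
    densityMeasure, lintegral_withDensity_eq_lintegral_mul _ hp.ennreal_ofReal hg.ennreal_ofReal]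
  simp only [Pi.mul_apply, ENNReal.ofReal_mul' (hg0 _), riemannianVolume]

theorem measurable_gaussianWeight (d : ℕ) (t : ℝ) :
    Measurable (Function.uncurry (gaussianWeight (N := N) d t)) := by
  unfold gaussianWeight Function.uncurry
  fun_prop

theorem measurable_gaussianWeight_right (d : ℕ) (t : ℝ) (x : EuclideanSpace ℝ (Fin N)) :
    Measurable (gaussianWeight d t x) := (measurable_gaussianWeight d t).of_uncurry_left

theorem gaussianWeight_le (d : ℕ) {t : ℝ} (ht : 0 < t) (y z : EuclideanSpace ℝ (Fin N)) :
    gaussianWeight d t y z ≤ 1 / t ^ ((d : ℝ) / 2) := by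
  have := gaussianWeight_le_of_le_norm (d := d) ht le_rfl (norm_nonneg (y - z))
  simpa using this

/-- The energy density of the pair `x, y` (truncated outside of the Lipschitz range). -/
noncomputable def energyKernel (d : ℕ) (K t : ℝ) (f : EuclideanSpace ℝ (Fin N) → ℝ)
    (x y : EuclideanSpace ℝ (Fin N)) : ℝ :=
  gaussianWeight d t x y * (min ((f x - f y) ^ 2) (K ^ 2 * ‖x - y‖ ^ 2) / (2 * t))

theorem measurable_energyKernel (d : ℕ) (K t : ℝ) (hf : Measurable f) :
    Measurable (Function.uncurry (energyKernel d K t f)) := by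
  have := measurable_gaussianWeight (N := N) d t
  unfold energyKernel
  unfold Function.uncurry at this ⊢
  fun_prop

theorem measurable_energyKernel_right (d : ℕ) (K t : ℝ) (hf : Measurable f)
    (x : EuclideanSpace ℝ (Fin N)) : Measurable (energyKernel d K t f x) :=
  (measurable_energyKernel d K t hf).of_uncurry_left

theorem energyKernel_nonneg (K : ℝ) {t : ℝ} (ht : 0 < t) (x y : EuclideanSpace ℝ (Fin N)) :
    0 ≤ energyKernel d K t f x y :=
  mul_nonneg (gaussianWeight_nonneg ht x y)
    (div_nonneg (le_min (sq_nonneg _) (by positivity)) (by positivity))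

theorem energyKernel_le (K : ℝ) {t : ℝ} (ht : 0 < t) (x y : EuclideanSpace ℝ (Fin N)) :
    energyKernel d K t f x y ≤
      K ^ 2 * (1 / t ^ ((d : ℝ) / 2) * Real.exp (-(‖x - y‖ ^ 2 / t / 2))) := by
  set s := ‖x - y‖ ^ 2 / t with hs
  have hs0 : 0 ≤ s := by positivity
  calc energyKernel d K t f x y
      ≤ gaussianWeight d t x y * (K ^ 2 * ‖x - y‖ ^ 2 / (2 * t)) := by
        unfold energyKernel
        have := gaussianWeight_nonneg (d := d) ht x y
        gcongr
        exact min_le_right _ _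
    _ = K ^ 2 / 2 * (1 / t ^ ((d : ℝ) / 2)) * (s * Real.exp (-s)) := by
        unfold gaussianWeight
        rw [hs]
        field_simp
    _ ≤ K ^ 2 / 2 * (1 / t ^ ((d : ℝ) / 2)) * (2 * Real.exp (-(s / 2))) := by
        refine mul_le_mul_of_nonneg_left (le_trans ?_ one_add_mul_exp_neg_le) (by positivity)
        gcongr
        linarith
    _ = _ := by ring

/-- Giving up half of the exponent amounts to doubling the time, so the uniform bound for degrees,
applied at `2 * t`, also bounds the local energies. -/
theorem energyKernel_le_gaussianWeight (K : ℝ) {t : ℝ} (ht : 0 < t)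
    (x y : EuclideanSpace ℝ (Fin N)) :
    energyKernel d K t f x y ≤ K ^ 2 * 2 ^ ((d : ℝ) / 2) * gaussianWeight d (2 * t) x y := by
  refine (energyKernel_le K ht x y).trans (le_of_eq ?_)
  unfold gaussianWeight
  rw [Real.mul_rpow two_pos.le ht.le, div_div, mul_comm t 2]
  have : (0 : ℝ) < 2 ^ ((d : ℝ) / 2) := by positivity
  field_simp

theorem toReal_lintegral_mul_le {b : ℝ} (hb : 0 ≤ b) (hpb : ∀ z ∈ M, p z ≤ b)
    (hMm : MeasurableSet M) {g G : EuclideanSpace ℝ (Fin N) → ℝ} (hg0 : ∀ z, 0 ≤ g z)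
    {A : ℝ} (hA : 0 ≤ A) (hgG : ∀ z, g z ≤ A * G z) (hGm : Measurable G) {C : ℝ≥0}
    (hC : ∫⁻ z in M, ENNReal.ofReal (G z) ∂Measure.euclideanHausdorffMeasure d ≤ C) :
    (∫⁻ z in M, ENNReal.ofReal (p z * g z)
      ∂Measure.euclideanHausdorffMeasure d).toReal ≤ b * A * C := by
  refine ENNReal.toReal_le_of_le_ofReal (by positivity) ?_
  calc _ ≤ ∫⁻ z in M, ENNReal.ofReal (b * A) * ENNReal.ofReal (G z)
        ∂Measure.euclideanHausdorffMeasure d := by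
        refine setLIntegral_mono' hMm fun z hz => ?_
        rw [← ENNReal.ofReal_mul (by positivity), mul_assoc]
        refine ENNReal.ofReal_le_ofReal ?_
        calc p z * g z ≤ b * g z := mul_le_mul_of_nonneg_right (hpb z hz) (hg0 z)
          _ ≤ _ := mul_le_mul_of_nonneg_left (hgG z) hb
    _ = ENNReal.ofReal (b * A) * ∫⁻ z in M, ENNReal.ofReal (G z)
        ∂Measure.euclideanHausdorffMeasure d := lintegral_const_mul _ (by fun_prop)
    _ ≤ ENNReal.ofReal (b * A) * C := mul_le_mul_right hC _
    _ = _ := by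
        rw [ENNReal.ofReal_mul (by positivity : 0 ≤ b * A), ENNReal.ofReal_coe_nnreal]

/-- Uniform bounds for the degrees and for the local energies. -/
theorem IsSubmanifoldWithBoundary.exists_degree_bounds (hM : IsSubmanifoldWithBoundary d M)
    (hMc : IsCompact M) (hf : Measurable f) (hp : Measurable p) {a b : ℝ} (ha : 0 < a) (hb : 0 < b)
    (hab : ∀ x ∈ M, a ≤ p x ∧ p x ≤ b) (K : ℝ) :
    ∃ c C : ℝ, 0 < c ∧ 1 ≤ C ∧ K ^ 2 ≤ C ∧ ∀ᶠ t in 𝓝[>] (0 : ℝ), ∀ x ∈ M,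
      (c ≤ ∫ y, gaussianWeight d t x y ∂densityMeasure d M p) ∧
      (∫ y, gaussianWeight d t x y ∂densityMeasure d M p ≤ C) ∧
      ∫ y, energyKernel d K t f x y ∂densityMeasure d M p ≤ C := by
  obtain ⟨C, hC⟩ := hM.exists_lintegral_gaussianWeight_le hMc
  obtain ⟨c, hc, hc'⟩ := hM.exists_le_lintegral_gaussianWeight hMc
  have h2 : Tendsto (fun t : ℝ => 2 * t) (𝓝[>] 0) (𝓝[>] 0) := by
    refine tendsto_nhdsWithin_iff.2 ⟨?_, ?_⟩
    · have : Continuous fun t : ℝ => 2 * t := by fun_prop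
      simpa using (this.tendsto 0).mono_left nhdsWithin_le_nhds
    · filter_upwards [self_mem_nhdsWithin] with t ht
      have : 0 < t := ht
      simp [this]
  refine ⟨a * c, max (max 1 (K ^ 2)) (max (b * 1 * C) (b * (K ^ 2 * 2 ^ ((d : ℝ) / 2)) * C)),
    by positivity, (le_max_left _ _).trans (le_max_left _ _),
    (le_max_right _ _).trans (le_max_left _ _), ?_⟩
  filter_upwards [hC, hc', h2.eventually hC, self_mem_nhdsWithin] with t h1 h2 h3 ht x hx
  have ht : 0 < t := ht
  have hwm : ∀ t, Measurable (gaussianWeight d t x) := fun t =>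
    measurable_gaussianWeight_right d t x
  have hw0 : ∀ z, 0 ≤ gaussianWeight d t x z := gaussianWeight_nonneg ht x
  have hem : Measurable (energyKernel d K t f x) :=
    measurable_energyKernel_right d K t hf x
  have hup := toReal_lintegral_mul_le hb.le (fun z hz => (hab z hz).2) hMc.measurableSet hw0
    zero_le_one (fun z => (one_mul _).ge) (hwm t) (h1 x hx)
  rw [integral_densityMeasure hp (hwm t) hw0,
    integral_densityMeasure hp hem (energyKernel_nonneg K ht x)]
  refine ⟨?_, hup.trans ((le_max_left _ _).trans (le_max_right _ _)), ?_⟩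
  · refine (ENNReal.ofReal_le_iff_le_toReal ?_).1 ?_
    · refine ne_top_of_le_ne_top (b := ENNReal.ofReal b * C) (by finiteness) ?_
      refine le_trans ?_ (mul_le_mul_right (h1 x hx) _)
      rw [← lintegral_const_mul _ (hwm t).ennreal_ofReal]
      refine setLIntegral_mono' hMc.measurableSet fun z hz => ?_
      rw [← ENNReal.ofReal_mul hb.le]
      exact ENNReal.ofReal_le_ofReal (mul_le_mul_of_nonneg_right (hab z hz).2 (hw0 z))
    · rw [ENNReal.ofReal_mul ha.le, ENNReal.ofReal_coe_nnreal]
      refine (mul_le_mul_right (h2 x hx) _).trans ?_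
      rw [← lintegral_const_mul _ (hwm t).ennreal_ofReal]
      refine setLIntegral_mono' hMc.measurableSet fun z hz => ?_
      rw [← ENNReal.ofReal_mul ha.le]
      exact ENNReal.ofReal_le_ofReal (mul_le_mul_of_nonneg_right (hab z hz).1 (hw0 z))
  · exact (toReal_lintegral_mul_le hb.le (fun z hz => (hab z hz).2) hMc.measurableSet
      (energyKernel_nonneg K ht x) (by positivity) (energyKernel_le_gaussianWeight K ht x)
      (hwm (2 * t)) (h3 x hx)).trans ((le_max_right _ _).trans (le_max_right _ _))

/-- The degree at time `t` of `y` tends to `π^{d/2} p(x)` when `t → 0`, `y → x`, at an interior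
point `x`. -/
theorem IsInteriorPoint.tendsto_degree (hx : IsInteriorPoint d M x) (hMc : IsCompact M)
    (hfin : Measure.euclideanHausdorffMeasure d M < ⊤) (hp : Measurable p)
    (hpc : ContinuousWithinAt p M x) {b : ℝ} (hp0 : ∀ x ∈ M, 0 ≤ p x) (hpb : ∀ x ∈ M, p x ≤ b) :
    Tendsto (fun z : ℝ × EuclideanSpace ℝ (Fin N) =>
      ∫ y, gaussianWeight d z.1 z.2 y ∂densityMeasure d M p) (𝓝[>] 0 ×ˢ 𝓝[M] x)
      (𝓝 (Real.pi ^ ((d : ℝ) / 2) * p x)) := by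
  obtain ⟨L, J, hL, hLJ, himg⟩ := hx.exists_tangent_coordinates
  have hb : 0 ≤ b := (hp0 x hx.1).trans (hpb x hx.1)
  -- The centre moves along with the time: the renormalized kernel at `x` involves the degrees of
  -- all nearby points, not only of `x`.
  have hblow : IsBlowUp M x L (𝓝[>] (0 : ℝ) ×ˢ 𝓝[M] x) Prod.fst Prod.snd (fun _ => p)
      (fun _ : EuclideanSpace ℝ (Fin d) => p x) b := by
    refine ⟨tendsto_fst, tendsto_snd, ?_, measurable_const, fun _ => hp0 x hx.1, fun u => ?_, ?_⟩
    · filter_upwards [tendsto_fst.eventually self_mem_nhdsWithin] with i hi z hz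
      have hi : 0 < i.1 := hi
      refine (hpb z hz).trans (le_mul_of_one_le_right hb ?_)
      have : 0 ≤ ‖i.2 - z‖ ^ 2 / i.1 := by positivity
      linarith
    · refine (hpb x hx.1).trans (le_mul_of_one_le_right hb ?_)
      nlinarith [sq_nonneg ‖u‖]
    · intro ε hε
      have h1 : ∀ᶠ z in 𝓝[M] x, |p z - p x| < ε := hpc.eventually (Metric.ball_mem_nhds _ hε)
      filter_upwards [tendsto_snd.eventually h1,
        (tendsto_fst.comp tendsto_fst).eventually self_mem_nhdsWithin] with i h2 h3
      have h3 : 0 < i.1.1 := h3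
      refine h2.le.trans (le_mul_of_one_le_right hε.le ?_)
      have : 0 ≤ ‖i.1.2 - i.2‖ ^ 2 / i.1.1 := by positivity
      linarith
  have := hblow.tendsto_toReal_lintegral hMc hfin hx.1
    (fun K hK => eventually_isBilipschitzOn_tangent hL hLJ hK) himg
  rw [integral_mul_const, integral_exp_neg_sq_norm] at this
  refine this.congr' ?_
  filter_upwards [tendsto_fst.eventually self_mem_nhdsWithin] with i hi
  rw [integral_densityMeasure (g := gaussianWeight d i.1 i.2) hp (measurable_gaussianWeight_right d i.1 i.2)
    (gaussianWeight_nonneg hi i.2)]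
  simp_rw [mul_comm]

theorem norm_gradientOn (M : Set (EuclideanSpace ℝ (Fin N))) (f : EuclideanSpace ℝ (Fin N) → ℝ)
    (x : EuclideanSpace ℝ (Fin N)) : ‖gradientOn M f x‖ =
      ‖(fderivWithin ℝ f M x).comp (tangentSpace M x).subtypeL‖ :=
  LinearIsometryEquiv.norm_map _ _

/-- The local renormalized energy at an interior point. -/
theorem IsInteriorPoint.tendsto_integral_renormKernel (hx : IsInteriorPoint d M x)
    (hMc : IsCompact M) (hfin : Measure.euclideanHausdorffMeasure d M < ⊤)
    (hf : Measurable f) {K : ℝ≥0} (hK : LipschitzOnWith K f M)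
    {f' : EuclideanSpace ℝ (Fin N) →L[ℝ] ℝ} (hf' : HasFDerivWithinAt f f' M x)
    (hp : Measurable p) (hpc : ContinuousWithinAt p M x)
    {b c C α : ℝ} (hp0 : ∀ x ∈ M, 0 ≤ p x) (hpb : ∀ x ∈ M, p x ≤ b) (hc : 0 < c)
    (hcC : c ≤ C)
    (hdeg : ∀ᶠ t in 𝓝[>] (0 : ℝ), ∀ x ∈ M,
      (c ≤ ∫ y, gaussianWeight d t x y ∂densityMeasure d M p) ∧
      (∫ y, gaussianWeight d t x y ∂densityMeasure d M p ≤ C)) (hpx : 0 < p x) :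
    Tendsto (fun t : ℝ => ∫ y, renormKernel (densityMeasure d M p) (gaussianWeight d t)
        (energyKernel d K t f) α c C x y ∂densityMeasure d M p) (𝓝[>] 0)
      (𝓝 (p x * ((Real.pi ^ ((d : ℝ) / 2) * p x) ^ (-α) * (Real.pi ^ ((d : ℝ) / 2) * p x) ^ (-α)) / 2
        * (Real.pi ^ ((d : ℝ) / 2) / 2 * ‖f'.comp (tangentSpace M x).subtypeL‖ ^ 2))) := by
  obtain ⟨L, J, hL, hLJ, himg⟩ := hx.exists_tangent_coordinates
  have hxM := hx.1
  obtain ⟨D, hD1, hD⟩ := exists_rpow_le (C := C) hc α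
  set ν := densityMeasure d M p with hν
  set P := Real.pi ^ ((d : ℝ) / 2) * p x with hP
  have hPpos : 0 < P := by positivity
  obtain ⟨s, hs⟩ : ∃ s : ℝ → EuclideanSpace ℝ (Fin N) → ℝ, ∀ t z,
    s t z = clamp c C (∫ y, gaussianWeight d t z y ∂ν) ^ (-α) := ⟨_, fun _ _ => rfl⟩
  have hs0 : ∀ t z, 0 ≤ s t z := fun t z => by
    rw [hs]
    exact Real.rpow_nonneg (hc.le.trans (le_clamp _ _ _)) _
  have hsD : ∀ t z, s t z ≤ D := fun t z => by
    rw [hs]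
    exact hD _ (le_clamp _ _ _) (clamp_le hcC _)
  have hslim : Tendsto (fun z : ℝ × EuclideanSpace ℝ (Fin N) => s z.1 z.2)
      (𝓝[>] 0 ×ˢ 𝓝[M] x) (𝓝 (P ^ (-α))) := by
    refine ((hx.tendsto_degree hMc hfin hp hpc hp0 hpb).rpow_const
      (p := -α) (Or.inl hPpos.ne')).congr' ?_
    filter_upwards [tendsto_fst.eventually hdeg, tendsto_snd.eventually self_mem_nhdsWithin]
      with z h1 h2
    rw [hs, clamp_of_mem (h1 z.2 h2).1 (h1 z.2 h2).2]
  have hconst : Tendsto (fun _ : ℝ => x) (𝓝[>] 0) (𝓝[M] x) :=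
    tendsto_const_pure.mono_right (pure_le_nhdsWithin hxM)
  set G : ℝ → EuclideanSpace ℝ (Fin N) → ℝ := fun t z => p z * (s t x * s t z)
    with hG
  set G₀ := p x * (P ^ (-α) * P ^ (-α)) with hG₀
  have hG₀0 : 0 ≤ G₀ := by positivity
  have hGlim : Tendsto (fun z : ℝ × EuclideanSpace ℝ (Fin N) => G z.1 z.2)
      (𝓝[>] 0 ×ˢ 𝓝[M] x) (𝓝 G₀) := by
    have h1 : Tendsto (fun z : ℝ × EuclideanSpace ℝ (Fin N) => s z.1 x)
        (𝓝[>] 0 ×ˢ 𝓝[M] x) (𝓝 (P ^ (-α))) :=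
      hslim.comp (tendsto_fst.prodMk (hconst.comp tendsto_fst))
    have h2 : Tendsto (fun z : ℝ × EuclideanSpace ℝ (Fin N) => p z.2)
        (𝓝[>] 0 ×ˢ 𝓝[M] x) (𝓝 (p x)) := hpc.tendsto.comp tendsto_snd
    exact h2.mul (h1.mul hslim)
  have hGle : ∀ t, ∀ z ∈ M, G t z ≤ b * D ^ 2 := fun t z hz => by
    rw [sq]
    exact mul_le_mul (hpb z hz) (mul_le_mul (hsD _ _) (hsD _ _) (hs0 _ _) (by linarith))
      (mul_nonneg (hs0 _ _) (hs0 _ _)) ((hp0 x hxM).trans (hpb x hxM))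
  have hG0 : ∀ t, ∀ z ∈ M, 0 ≤ G t z := fun t z hz =>
    mul_nonneg (hp0 z hz) (mul_nonneg (hs0 _ _) (hs0 _ _))
  set φ : tangentSpace M x →L[ℝ] ℝ := f'.comp (tangentSpace M x).subtypeL with hφ
  set ℓ : EuclideanSpace ℝ (Fin d) →L[ℝ] ℝ :=
    φ.comp (J.toContinuousLinearEquiv : EuclideanSpace ℝ (Fin d) →L[ℝ] tangentSpace M x) with hℓ
  have hℓn : ‖ℓ‖ = ‖φ‖ := ContinuousLinearMap.opNorm_comp_linearIsometryEquiv φ J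
  have hℓv : ∀ v, ℓ v = f' (J v) := fun v => rfl
  set Δ : EuclideanSpace ℝ (Fin N) → ℝ := fun z =>
    min ((f x - f z) ^ 2) ((K : ℝ) ^ 2 * ‖x - z‖ ^ 2)
  have hΔ0 : ∀ z, 0 ≤ Δ z := fun z => le_min (sq_nonneg _) (by positivity)
  have hΔle : ∀ z, Δ z ≤ K ^ 2 * ‖x - z‖ ^ 2 := fun z => min_le_right _ _
  have hlip : ∀ z ∈ M, |f x - f z| ≤ K * ‖x - z‖ := fun z hz => by
    have := hK.norm_sub_le hxM hz
    rwa [Real.norm_eq_abs] at this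
  have hΔeq : ∀ z ∈ M, Δ z = (f x - f z) ^ 2 := fun z hz => min_eq_left (by
    rw [← mul_pow, ← sq_abs]
    exact pow_le_pow_left₀ (abs_nonneg _) (hlip z hz) 2)
  have hb : 0 ≤ b := (hp0 x hxM).trans (hpb x hxM)
  -- To first order the increment of `f` is `ℓ (L z - L x)`, so the squared increment over `2 * t`
  -- becomes `ℓ u ^ 2 / 2` in the rescaled variable, while density and degree factors freeze to
  -- `G₀`.
  have hblow : IsBlowUp M x L (𝓝[>] (0 : ℝ)) (fun t => t) (fun _ => x)
      (fun t z => Δ z / (2 * t) * G t z) (fun u => G₀ / 2 * ℓ u ^ 2)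
      (K ^ 2 * (b * D ^ 2) + G₀ / 2 * ‖ℓ‖ ^ 2) := by
    refine ⟨tendsto_id, hconst, ?_, by fun_prop, fun u => by positivity, fun u => ?_, ?_⟩
    · filter_upwards [self_mem_nhdsWithin] with t ht z hz
      have ht : 0 < t := ht
      calc Δ z / (2 * t) * G t z ≤ K ^ 2 * ‖x - z‖ ^ 2 / (1 * t) * (b * D ^ 2) := by
            have := hΔle z
            have := hΔ0 z
            have := hGle t z hz
            have := hG0 t z hz
            gcongr
            norm_num
        _ = K ^ 2 * (b * D ^ 2) * (‖x - z‖ ^ 2 / t) := by ring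
        _ ≤ _ := by
            gcongr
            · exact le_add_of_nonneg_right (by positivity)
            · linarith
    · calc G₀ / 2 * ℓ u ^ 2 ≤ G₀ / 2 * (‖ℓ‖ * ‖u‖) ^ 2 := by
            rw [← sq_abs (ℓ u)]
            gcongr
            exact ℓ.le_opNorm u
        _ = G₀ / 2 * ‖ℓ‖ ^ 2 * ‖u‖ ^ 2 := by ring
        _ ≤ _ := by
            gcongr
            · exact le_add_of_nonneg_left (by positivity)
            · linarith
    · intro ε hε
      -- The first summand comes from linearizing `f`, by factoring a difference of squares; the
      -- second from freezing `G`, multiplied by the Lipschitz bound of `Δ`.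
      set κ := (1 + ‖f'‖) * (K + ‖f'‖) * G₀ + K ^ 2 with hκ
      have hκ0 : 0 ≤ κ := by positivity
      set δ := ε / (κ + 1) with hδdef
      have hδ : 0 < δ := by positivity
      have hδκ : δ * κ ≤ ε := by
        rw [hδdef, div_mul_eq_mul_div, div_le_iff₀ (by positivity)]
        nlinarith
      have e1 : ∀ᶠ i : ℝ × EuclideanSpace ℝ (Fin N) in 𝓝[>] 0 ×ˢ 𝓝[M] x,
          |G i.1 i.2 - G₀| < δ := hGlim.eventually (Metric.ball_mem_nhds _ hδ)
      have e2 : ∀ᶠ z in 𝓝[M] x, ‖f z - f x - f' (z - x)‖ ≤ δ * ‖z - x‖ :=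
        Asymptotics.isLittleO_iff.1 hf'.isLittleO hδ
      have e3 : ∀ᶠ z in 𝓝[M] x, ‖z - x - (J (L (z - x)) : EuclideanSpace ℝ (Fin N))‖ ≤
          δ * ‖z - x‖ :=
        (tendsto_id.prodMk (tendsto_const_pure.mono_right (pure_le_nhdsWithin hxM))).eventually
          (hLJ δ hδ)
      filter_upwards [e1, tendsto_snd.eventually e2, tendsto_snd.eventually e3,
        tendsto_snd.eventually self_mem_nhdsWithin,
        tendsto_fst.eventually self_mem_nhdsWithin] with i h1 h2 h3 h4 ht
      obtain ⟨t, z⟩ := i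
      simp only at h1 h2 h3 h4 ht ⊢
      have ht : 0 < t := ht
      have hzx : ‖x - z‖ = ‖z - x‖ := norm_sub_rev _ _
      set ρ := ‖z - x‖ with hρ
      have hρ0 : 0 ≤ ρ := norm_nonneg _
      have hscale : ℓ ((√t)⁻¹ • (L z - L x)) ^ 2 = ℓ (L (z - x)) ^ 2 / t := by
        rw [map_smul, smul_eq_mul, mul_pow, inv_pow, Real.sq_sqrt ht.le, inv_mul_eq_div, map_sub L]
      have hmain : |Δ z * G t z - G₀ * ℓ (L (z - x)) ^ 2| ≤ δ * κ * ρ ^ 2 := by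
        have hA : |f z - f x| ≤ K * ρ := by
          rw [abs_sub_comm, ← hzx]
          exact hlip z h4
        have hJn : ‖(J (L (z - x)) : EuclideanSpace ℝ (Fin N))‖ ≤ ρ :=
          (J.norm_map (L (z - x))).le.trans (hL _)
        have hB : |ℓ (L (z - x))| ≤ ‖f'‖ * ρ := by
          rw [hℓv]
          exact (f'.le_opNorm _).trans (by gcongr)
        have hAB : |f z - f x - ℓ (L (z - x))| ≤ δ * (1 + ‖f'‖) * ρ := by
          have e : f z - f x - ℓ (L (z - x)) = (f z - f x - f' (z - x)) +
              f' (z - x - (J (L (z - x)) : EuclideanSpace ℝ (Fin N))) := by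
            rw [hℓv, map_sub f' (z - x)]
            ring
          rw [e]
          refine (abs_add_le _ _).trans ?_
          have h5 : |f' (z - x - (J (L (z - x)) : EuclideanSpace ℝ (Fin N)))| ≤
              ‖f'‖ * (δ * ρ) := (f'.le_opNorm _).trans (by gcongr)
          rw [Real.norm_eq_abs] at h2
          calc _ ≤ δ * ρ + ‖f'‖ * (δ * ρ) := add_le_add h2 h5
            _ = _ := by ring
        have hsq : |(f z - f x) ^ 2 - ℓ (L (z - x)) ^ 2| ≤
            δ * (1 + ‖f'‖) * ρ * ((K + ‖f'‖) * ρ) := by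
          rw [sq_sub_sq, abs_mul, mul_comm]
          refine mul_le_mul hAB ?_ (abs_nonneg _) (by positivity)
          refine (abs_add_le _ _).trans ?_
          rw [add_mul]
          exact add_le_add hA hB
        have hΔz : Δ z = (f z - f x) ^ 2 := by
          rw [hΔeq z h4]
          ring
        have e : Δ z * G t z - G₀ * ℓ (L (z - x)) ^ 2 =
            Δ z * (G t z - G₀) + G₀ * ((f z - f x) ^ 2 - ℓ (L (z - x)) ^ 2) := by
          rw [hΔz]
          ring
        rw [e]
        refine (abs_add_le _ _).trans ?_
        rw [abs_mul, abs_mul, abs_of_nonneg (hΔ0 z), abs_of_nonneg hG₀0]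
        have hΔρ := hΔle z
        rw [hzx] at hΔρ
        calc _ ≤ K ^ 2 * ρ ^ 2 * δ + G₀ * (δ * (1 + ‖f'‖) * ρ * ((K + ‖f'‖) * ρ)) := by
              gcongr
          _ = _ := by
              rw [hκ]
              ring
      rw [hscale, hzx]
      have e : Δ z / (2 * t) * G t z - G₀ / 2 * (ℓ (L (z - x)) ^ 2 / t) =
          (Δ z * G t z - G₀ * ℓ (L (z - x)) ^ 2) / (2 * t) := by
        field_simp
      rw [e, abs_div, abs_of_pos (by positivity : 0 < 2 * t)]
      calc _ ≤ δ * κ * ρ ^ 2 / (2 * t) := by gcongr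
        _ ≤ ε * ρ ^ 2 / (1 * t) := by
            gcongr
            norm_num
        _ = ε * (ρ ^ 2 / t) := by ring
        _ ≤ _ := by
            gcongr
            linarith
  have hlim := hblow.tendsto_toReal_lintegral hMc hfin hxM
    (fun K hK => eventually_isBilipschitzOn_tangent hL hLJ hK) himg
  simp_rw [mul_left_comm _ (G₀ / 2)] at hlim
  rw [integral_const_mul, integral_exp_neg_sq_norm_mul_sq, hℓn] at hlim
  refine hlim.congr' ?_
  have : SFinite ν := by
    rw [hν, densityMeasure, riemannianVolume]
    have : IsFiniteMeasure ((Measure.euclideanHausdorffMeasure d).restrict M) := ⟨by simpa using hfin⟩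
    infer_instance
  filter_upwards [self_mem_nhdsWithin] with t ht
  rw [integral_densityMeasure hp]
  · congr 1
    refine lintegral_congr fun z => ?_
    simp only [renormKernel, energyKernel, hG, Δ, ← hs]
    congr 1
    ring
  · exact (measurable_renormKernel ν (measurable_gaussianWeight d t)
      (measurable_energyKernel d K t hf) α c C).of_uncurry_left
  · intro z
    refine mul_nonneg (energyKernel_nonneg _ ht x z) ?_
    rw [← hs, ← hs]
    exact mul_nonneg (hs0 _ _) (hs0 _ _)

end GraphLaplacian

/-! ### The quadratic form, the scaling of the sample size, and convergence. -/

namespace GraphLaplacian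

open scoped NNReal ENNReal

variable {N d : ℕ} {M : Set (EuclideanSpace ℝ (Fin N))} {f p : EuclideanSpace ℝ (Fin N) → ℝ}

theorem dotProduct_laplacian_mulVec {ι : Type*} [Fintype ι] [DecidableEq ι] {W : Matrix ι ι ℝ}
    (hW : ∀ i j, W i j = W j i) (v : ι → ℝ) :
    v ⬝ᵥ ((Matrix.diagonal (fun i => ∑ j, W i j) - W) *ᵥ v) =
      1 / 2 * ∑ i, ∑ j, W i j * (v i - v j) ^ 2 := by
  have h1 : v ⬝ᵥ ((Matrix.diagonal (fun i => ∑ j, W i j) - W) *ᵥ v) =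
      ∑ i, ∑ j, (W i j * v i ^ 2 - W i j * (v i * v j)) := by
    rw [Matrix.sub_mulVec]
    simp only [dotProduct, Pi.sub_apply, Matrix.mulVec_diagonal]
    refine Finset.sum_congr rfl fun i _ => ?_
    have hi : (W *ᵥ v) i = ∑ j, W i j * v j := rfl
    rw [hi, Finset.sum_sub_distrib, mul_sub, ← Finset.sum_mul, Finset.mul_sum]
    congr 1
    · ring
    · exact Finset.sum_congr rfl fun j _ => by ring
  have h2 : ∑ i, ∑ j, W i j * v j ^ 2 = ∑ i, ∑ j, W i j * v i ^ 2 := by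
    rw [Finset.sum_comm]
    exact Finset.sum_congr rfl fun i _ => Finset.sum_congr rfl fun j _ => by rw [hW]
  have h3 : ∑ i, ∑ j, W i j * (v i - v j) ^ 2 = ∑ i, ∑ j, W i j * v i ^ 2 +
      ∑ i, ∑ j, W i j * v j ^ 2 - 2 * ∑ i, ∑ j, W i j * (v i * v j) := by
    simp only [Finset.mul_sum, ← Finset.sum_add_distrib, ← Finset.sum_sub_distrib]
    exact Finset.sum_congr rfl fun i _ => Finset.sum_congr rfl fun j _ => by ring
  rw [h1, h3, h2]
  simp only [Finset.sum_sub_distrib]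
  ring

theorem normalizedWeightMatrix_apply {n : ℕ} (d : ℕ) (α t : ℝ)
    (x : Fin n → EuclideanSpace ℝ (Fin N)) (i j : Fin n) :
    normalizedWeightMatrix d α t x i j = gaussianWeight d t (x i) (x j) *
      ((1 / (n : ℝ) * ∑ k, gaussianWeight d t (x i) (x k)) ^ (-α) *
        (1 / (n : ℝ) * ∑ k, gaussianWeight d t (x j) (x k)) ^ (-α)) := by
  simp only [normalizedWeightMatrix, Matrix.mul_diagonal, Matrix.diagonal_mul, empiricalDegree,
    weightMatrix, Matrix.of_apply]
  ring

/-- The regularizer of a sample of `M` is a sum of renormalized pair energies. -/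
theorem regularizer_eq {n : ℕ} (d : ℕ) (α : ℝ) {t : ℝ} (ht : 0 < t) {K : ℝ≥0}
    (hK : LipschitzOnWith K f M) {x : Fin n → EuclideanSpace ℝ (Fin N)} (hx : ∀ i, x i ∈ M) :
    1 / ((n : ℝ) ^ 2 * t) * regularizer d α t f x = 1 / (n : ℝ) ^ 2 * ∑ i, ∑ j,
      energyKernel d K t f (x i) (x j) *
        ((1 / (n : ℝ) * ∑ k, gaussianWeight d t (x i) (x k)) ^ (-α) *
          (1 / (n : ℝ) * ∑ k, gaussianWeight d t (x j) (x k)) ^ (-α)) := by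
  have hsymm : ∀ i j, normalizedWeightMatrix d α t x i j = normalizedWeightMatrix d α t x j i := by
    intro i j
    rw [normalizedWeightMatrix_apply, normalizedWeightMatrix_apply]
    unfold gaussianWeight
    rw [norm_sub_rev (x i) (x j)]
    ring
  unfold regularizer unnormalizedLaplacian
  rw [dotProduct_laplacian_mulVec hsymm]
  have key : 1 / 2 * ∑ i, ∑ j, normalizedWeightMatrix d α t x i j * (f (x i) - f (x j)) ^ 2 =
      t * ∑ i, ∑ j, energyKernel d K t f (x i) (x j) *
        ((1 / (n : ℝ) * ∑ k, gaussianWeight d t (x i) (x k)) ^ (-α) *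
          (1 / (n : ℝ) * ∑ k, gaussianWeight d t (x j) (x k)) ^ (-α)) := by
    rw [Finset.mul_sum, Finset.mul_sum]
    refine Finset.sum_congr rfl fun i _ => ?_
    rw [Finset.mul_sum, Finset.mul_sum]
    refine Finset.sum_congr rfl fun j _ => ?_
    rw [normalizedWeightMatrix_apply, energyKernel, min_eq_left]
    · field_simp
    · have h := hK.norm_sub_le (hx i) (hx j)
      rw [← mul_pow, ← sq_abs]
      exact pow_le_pow_left₀ (abs_nonneg _) h 2
  rw [key]
  field_simp

theorem eventually_one_le_mul {t : ℕ → ℝ} (htpos : ∀ n, 0 < t n)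
    (hnt : Tendsto (fun n : ℕ => (n : ℝ) ^ 2 * t n ^ (d + 2)) atTop atTop) :
    ∀ᶠ n : ℕ in atTop, 1 ≤ (n : ℝ) * t n ^ ((d : ℝ) / 2) * t n := by
  filter_upwards [hnt.eventually_ge_atTop 1] with n hn
  have ht := htpos n
  have h : (n : ℝ) ^ 2 * t n ^ (d + 2) = ((n : ℝ) * t n ^ ((d : ℝ) / 2) * t n) ^ 2 := by
    rw [mul_pow, mul_pow, ← Real.rpow_natCast (t n ^ ((d : ℝ) / 2)), ← Real.rpow_mul ht.le, pow_add]
    norm_num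
    ring
  rw [h] at hn
  exact (one_le_sq_iff₀ (by positivity)).1 hn

/-- The quantity `n * t ^ (d / 2)` is the order of the number of sample points within `√t` of a
given one; it eventually exceeds `1 / t`. -/
theorem tendsto_sample_size {t : ℕ → ℝ} (htpos : ∀ n, 0 < t n) (ht0 : Tendsto t atTop (𝓝 0))
    (hnt : Tendsto (fun n : ℕ => (n : ℝ) ^ 2 * t n ^ (d + 2)) atTop atTop) :
    Tendsto (fun n : ℕ => (n : ℝ) * t n ^ ((d : ℝ) / 2)) atTop atTop := by
  have hinv : Tendsto (fun n => (t n)⁻¹) atTop atTop :=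
    tendsto_inv_nhdsGT_zero.comp (tendsto_nhdsWithin_iff.2 ⟨ht0, Eventually.of_forall htpos⟩)
  refine tendsto_atTop_mono' _ ?_ hinv
  filter_upwards [eventually_one_le_mul htpos hnt] with n hn
  rwa [inv_le_iff_one_le_mul₀ (htpos n)]

/-- With `m = n * t ^ (d / 2)` and `1 / t ≤ m` one has `n = m * t ^ (-d / 2) ≤ m ^ (1 + d / 2)`. The
union-bound factor is thus polynomial in `m`, against `exp (-κ m)`. -/
theorem tendsto_mul_exp_sample_size {t : ℕ → ℝ} (htpos : ∀ n, 0 < t n)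
    (ht0 : Tendsto t atTop (𝓝 0))
    (hnt : Tendsto (fun n : ℕ => (n : ℝ) ^ 2 * t n ^ (d + 2)) atTop atTop)
    {κ : ℝ} (hκ : 0 < κ) :
    Tendsto (fun n : ℕ => n * Real.exp (-(κ * (n * t n ^ ((d : ℝ) / 2))))) atTop (𝓝 0) := by
  have h1 := (tendsto_rpow_mul_exp_neg_mul_atTop_nhds_zero (1 + (d : ℝ) / 2) κ hκ).comp
    (tendsto_sample_size htpos ht0 hnt)
  refine squeeze_zero' (Eventually.of_forall fun n => by positivity) ?_ h1
  filter_upwards [eventually_one_le_mul htpos hnt, eventually_gt_atTop 0] with n hn hn0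
  have ht := htpos n
  have hn0 : (0 : ℝ) < n := by exact_mod_cast hn0
  rw [Function.comp_apply, neg_mul]
  set m := (n : ℝ) * t n ^ ((d : ℝ) / 2) with hm
  have hm0 : 0 < m := by positivity
  gcongr
  rw [Real.rpow_add hm0, Real.rpow_one]
  calc (n : ℝ) = m * (t n ^ ((d : ℝ) / 2))⁻¹ := by
        rw [hm]
        field_simp
    _ = m * ((t n)⁻¹) ^ ((d : ℝ) / 2) := by rw [Real.inv_rpow ht.le]
    _ ≤ m * m ^ ((d : ℝ) / 2) := by
        gcongr
        rwa [inv_le_iff_one_le_mul₀ ht]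

/-- The limit of the local renormalized energies. -/
noncomputable def localEnergy (d : ℕ) (M : Set (EuclideanSpace ℝ (Fin N)))
    (f' : EuclideanSpace ℝ (Fin N) → EuclideanSpace ℝ (Fin N) →L[ℝ] ℝ)
    (p : EuclideanSpace ℝ (Fin N) → ℝ) (α : ℝ) (x : EuclideanSpace ℝ (Fin N)) : ℝ :=
  p x * ((Real.pi ^ ((d : ℝ) / 2) * p x) ^ (-α) * (Real.pi ^ ((d : ℝ) / 2) * p x) ^ (-α)) / 2
    * (Real.pi ^ ((d : ℝ) / 2) / 2 * ‖(f' x).comp (tangentSpace M x).subtypeL‖ ^ 2)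

theorem mul_localEnergy (f' : EuclideanSpace ℝ (Fin N) → EuclideanSpace ℝ (Fin N) →L[ℝ] ℝ)
    (α : ℝ) {x : EuclideanSpace ℝ (Fin N)} (hp : 0 < p x) :
    p x * localEnergy d M f' p α x = 1 / 4 * Real.pi ^ ((d : ℝ) * (1 / 2 - α)) *
      (‖(f' x).comp (tangentSpace M x).subtypeL‖ ^ 2 * p x ^ (2 - 2 * α)) := by
  have hπ := Real.pi_pos
  have h1 : Real.pi ^ ((d : ℝ) * (1 / 2 - α)) = Real.pi ^ ((d : ℝ) / 2) *
      (Real.pi ^ ((d : ℝ) / 2 * (-α)) * Real.pi ^ ((d : ℝ) / 2 * (-α))) := by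
    rw [← Real.rpow_add hπ, ← Real.rpow_add hπ]
    congr 1
    ring
  have h2 : p x ^ (2 - 2 * α) = p x * p x * (p x ^ (-α) * p x ^ (-α)) := by
    rw [← Real.rpow_add hp, show 2 - 2 * α = 1 + (1 + (-α + -α)) by ring, Real.rpow_add hp,
      Real.rpow_add hp, Real.rpow_one]
    ring
  rw [localEnergy, Real.mul_rpow (by positivity) hp.le, ← Real.rpow_mul hπ.le, h1, h2]
  ring

theorem ae_densityMeasure_of_ae (p : EuclideanSpace ℝ (Fin N) → ℝ)
    {Q : EuclideanSpace ℝ (Fin N) → Prop}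
    (h : ∀ᵐ x ∂riemannianVolume d M, Q x) : ∀ᵐ x ∂densityMeasure d M p, Q x :=
  (withDensity_absolutelyContinuous _ _).ae_le h

theorem IsSubmanifoldWithBoundary.ae_isInteriorPoint (hM : IsSubmanifoldWithBoundary d M)
    (hMc : IsCompact M) : ∀ᵐ x ∂riemannianVolume d M, IsInteriorPoint d M x := by
  rw [riemannianVolume, ae_restrict_iff' hMc.measurableSet, ae_iff]
  refine measure_mono_null (fun x hx => ?_) hM.measure_not_interior
  rw [Set.mem_ofPred_eq, Classical.not_imp] at hx
  exact hx

/-- Convergence of the renormalized energies of random samples, for a measurable Lipschitz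
function `f` and a measurable density. -/
theorem IsSubmanifoldWithBoundary.integrable_and_tendsto (hM : IsSubmanifoldWithBoundary d M)
    (hMc : IsCompact M) (hf : Measurable f) {K : ℝ≥0} (hK : LipschitzOnWith K f M)
    {f' : EuclideanSpace ℝ (Fin N) → EuclideanSpace ℝ (Fin N) →L[ℝ] ℝ}
    (hf' : ∀ x ∈ M, HasFDerivWithinAt f (f' x) M x) (hp : Measurable p)
    (hpc : ContinuousOn p M) {a b : ℝ} (ha : 0 < a) (hb : 0 < b)
    (hab : ∀ x ∈ M, a ≤ p x ∧ p x ≤ b) [IsProbabilityMeasure (densityMeasure d M p)] (α : ℝ)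
    {t : ℕ → ℝ} (htpos : ∀ n, 0 < t n) (ht0 : Tendsto t atTop (𝓝 0))
    (hnt : Tendsto (fun n : ℕ => (n : ℝ) ^ 2 * t n ^ (d + 2)) atTop atTop) :
    Integrable (fun x => ‖(f' x).comp (tangentSpace M x).subtypeL‖ ^ 2 * p x ^ (2 - 2 * α))
        (riemannianVolume d M) ∧
      ∀ θ : ℝ, 0 < θ →
        Tendsto (fun n : ℕ => (Measure.pi fun _ : Fin n => densityMeasure d M p) {x | θ ≤
          |1 / (n : ℝ) ^ 2 * ∑ i, ∑ j, energyKernel d K (t n) f (x i) (x j) *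
            ((1 / (n : ℝ) * ∑ k, gaussianWeight d (t n) (x i) (x k)) ^ (-α) *
              (1 / (n : ℝ) * ∑ k, gaussianWeight d (t n) (x j) (x k)) ^ (-α)) -
            1 / 4 * Real.pi ^ ((d : ℝ) * (1 / 2 - α)) *
              ∫ x, ‖(f' x).comp (tangentSpace M x).subtypeL‖ ^ 2 * p x ^ (2 - 2 * α)
                ∂riemannianVolume d M|}) atTop (𝓝 0) := by
  have hfin := hM.measure_lt_top hMc
  have hfinite : IsFiniteMeasure (riemannianVolume d M) :=
    ⟨by simpa [riemannianVolume] using hfin⟩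
  have hp0 : ∀ x ∈ M, 0 < p x := fun x hx => ha.trans_le (hab x hx).1
  have hMae : ∀ᵐ x ∂riemannianVolume d M, x ∈ M := ae_restrict_mem hMc.measurableSet
  obtain ⟨c, C, hc, hC1, hKC, hdeg⟩ := hM.exists_degree_bounds hMc hf hp ha hb hab K
  -- Clamping to `[c, C']` requires `c ≤ C'`, which the degree bounds do not state.
  obtain ⟨C', hC', hcC'⟩ : ∃ C', C ≤ C' ∧ c ≤ C' := ⟨max C c, le_max_left _ _, le_max_right _ _⟩
  obtain ⟨D, hD1, hD⟩ := exists_rpow_le (C := C') hc α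
  set ν := densityMeasure d M p with hν
  set F : ℝ → EuclideanSpace ℝ (Fin N) → ℝ := fun t x =>
    ∫ y, renormKernel ν (gaussianWeight d t) (energyKernel d K t f) α c C' x y ∂ν with hF
  set Λ := localEnergy d M f' p α with hΛ
  have hFm : ∀ t, Measurable (F t) := fun t =>
    ((measurable_renormKernel ν (measurable_gaussianWeight d t)
      (measurable_energyKernel d K t hf) α c C').stronglyMeasurable.integral_prod_right
        (ν := ν)).measurable
  have hlim : ∀ᵐ x ∂riemannianVolume d M, Tendsto (fun t => F t x) (𝓝[>] 0) (𝓝 (Λ x)) := by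
    filter_upwards [hM.ae_isInteriorPoint hMc] with x hx
    exact hx.tendsto_integral_renormKernel hMc hfin hf hK (hf' x hx.1) hp (hpc x hx.1)
      (fun x hx => (hp0 x hx).le) (fun x hx => (hab x hx).2) hc hcC'
      (hdeg.mono fun t h x hx => ⟨(h x hx).1, (h x hx).2.1.trans hC'⟩) (hp0 x hx.1)
  have hs : ∀ t x, 0 ≤ clamp c C' (∫ z, gaussianWeight d t x z ∂ν) ^ (-α) := fun t x =>
    Real.rpow_nonneg (hc.le.trans (le_clamp _ _ _)) _
  have hsD : ∀ t x, clamp c C' (∫ z, gaussianWeight d t x z ∂ν) ^ (-α) ≤ D := fun t x =>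
    hD _ (le_clamp _ _ _) (clamp_le hcC' _)
  have henB : ∀ t, 0 < t → ∀ x y, energyKernel d K t f x y ≤ C * (1 / t ^ ((d : ℝ) / 2)) := by
    intro t ht x y
    refine (energyKernel_le K ht x y).trans ?_
    refine mul_le_mul hKC ?_ (by positivity) (by linarith)
    refine mul_le_of_le_one_right (by positivity) ?_
    rw [Real.exp_le_one_iff, Left.neg_nonpos_iff]
    positivity
  have hF0 : ∀ t, 0 < t → ∀ x, 0 ≤ F t x := fun t ht x => integral_nonneg fun y =>
    mul_nonneg (energyKernel_nonneg _ ht x y) (mul_nonneg (hs t x) (hs t y))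
  have hFle : ∀ᶠ t in 𝓝[>] (0 : ℝ), ∀ x ∈ M, F t x ≤ C * D ^ 2 := by
    filter_upwards [hdeg, self_mem_nhdsWithin] with t h ht x hx
    have ht : 0 < t := ht
    have hint : Integrable (energyKernel d K t f x) ν := by
      refine Integrable.of_bound
        (measurable_energyKernel_right d K t hf x).aestronglyMeasurable
        (C * (1 / t ^ ((d : ℝ) / 2))) (ae_of_all _ fun y => ?_)
      rw [Real.norm_eq_abs, abs_of_nonneg (energyKernel_nonneg _ ht x y)]
      exact henB t ht x y
    calc F t x ≤ ∫ y, energyKernel d K t f x y * D ^ 2 ∂ν := by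
          refine integral_mono_of_nonneg (ae_of_all _ fun y => ?_) (hint.mul_const _)
            (ae_of_all _ fun y => ?_)
          · exact mul_nonneg (energyKernel_nonneg _ ht x y) (mul_nonneg (hs t x) (hs t y))
          · refine mul_le_mul_of_nonneg_left ?_ (energyKernel_nonneg _ ht x y)
            rw [sq]
            exact mul_le_mul (hsD t x) (hsD t y) (hs t y) (by linarith)
      _ = (∫ y, energyKernel d K t f x y ∂ν) * D ^ 2 := integral_mul_const _ _
      _ ≤ _ := mul_le_mul_of_nonneg_right (h x hx).2.2 (sq_nonneg D)
  have hΛbound : ∀ᵐ x ∂riemannianVolume d M, ‖Λ x‖ ≤ C * D ^ 2 := by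
    filter_upwards [hlim, hMae] with x hx hxM
    refine le_of_tendsto hx.norm ?_
    filter_upwards [hFle, self_mem_nhdsWithin] with t h ht
    rw [Real.norm_eq_abs, abs_of_nonneg (hF0 t ht x)]
    exact h x hxM
  -- As an almost everywhere limit of measurable functions, `Λ` is measurable without any study of
  -- how the tangent space or the chosen derivative depends on `x`. Measurability of the squared
  -- gradient follows.
  have hΛm : AEMeasurable Λ (riemannianVolume d M) :=
    aemeasurable_of_tendsto_metrizable_ae (𝓝[>] (0 : ℝ)) (fun t => (hFm t).aemeasurable) hlim
  have hprod : ∀ᵐ x ∂riemannianVolume d M, p x * Λ x =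
      1 / 4 * Real.pi ^ ((d : ℝ) * (1 / 2 - α)) *
      (‖(f' x).comp (tangentSpace M x).subtypeL‖ ^ 2 * p x ^ (2 - 2 * α)) := by
    filter_upwards [hMae] with x hx using mul_localEnergy f' α (hp0 x hx)
  have hpΛ : Integrable (fun x => p x * Λ x) (riemannianVolume d M) := by
    refine Integrable.of_bound (hp.aemeasurable.mul hΛm).aestronglyMeasurable
      (b * (C * D ^ 2)) ?_
    filter_upwards [hΛbound, hMae] with x h1 h2
    rw [norm_mul, Real.norm_of_nonneg (hp0 x h2).le]
    exact mul_le_mul (hab x h2).2 h1 (norm_nonneg _) hb.le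
  have hconst : 0 < 1 / 4 * Real.pi ^ ((d : ℝ) * (1 / 2 - α)) := by
    have := Real.pi_pos
    positivity
  have hintΛ : ∫ x, Λ x ∂ν = 1 / 4 * Real.pi ^ ((d : ℝ) * (1 / 2 - α)) *
      ∫ x, ‖(f' x).comp (tangentSpace M x).subtypeL‖ ^ 2 * p x ^ (2 - 2 * α)
        ∂riemannianVolume d M := by
    rw [hν, densityMeasure, integral_withDensity_eq_integral_toReal_smul hp.ennreal_ofReal
      (ae_of_all _ fun _ => ENNReal.ofReal_lt_top), ← integral_const_mul]
    refine integral_congr_ae ?_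
    filter_upwards [hprod, hMae] with x h1 h2
    rw [← h1, smul_eq_mul, ENNReal.toReal_ofReal (hp0 x h2).le]
  refine ⟨?_, fun θ hθ => ?_⟩
  · refine (hpΛ.const_mul (1 / 4 * Real.pi ^ ((d : ℝ) * (1 / 2 - α)))⁻¹).congr ?_
    filter_upwards [hprod] with x hx
    rw [hx, inv_mul_cancel_left₀ hconst.ne']
  have httend : Tendsto t atTop (𝓝[>] 0) :=
    tendsto_nhdsWithin_iff.2 ⟨ht0, Eventually.of_forall htpos⟩
  have hνM : ∀ᵐ x ∂ν, x ∈ M := ae_densityMeasure_of_ae p hMae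
  have hmean : Tendsto (fun n => ∫ x, F (t n) x ∂ν) atTop (𝓝 (∫ x, Λ x ∂ν)) := by
    refine (tendsto_integral_filter_of_dominated_convergence (fun _ => C * D ^ 2)
      (Eventually.of_forall fun t => (hFm t).aestronglyMeasurable) ?_ (integrable_const _)
      (ae_densityMeasure_of_ae p hlim)).comp httend
    filter_upwards [hFle, self_mem_nhdsWithin] with t h ht
    filter_upwards [hνM] with x hx
    rw [Real.norm_eq_abs, abs_of_nonneg (hF0 t ht x)]
    exact h x hx
  rw [hintΛ] at hmean
  have hdiv : ∀ n : ℕ, (n : ℝ) / (1 / t n ^ ((d : ℝ) / 2)) = n * t n ^ ((d : ℝ) / 2) := fun n => by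
    rw [div_div_eq_mul_div, div_one]
  refine tendsto_measure_pi_regularizer ν (B := fun n => 1 / t n ^ ((d : ℝ) / 2)) (c := c) (C := C')
    (fun n => measurable_gaussianWeight d (t n))
    (fun n => measurable_energyKernel d K (t n) hf) ?_ hc hcC' (hC1.trans hC')
    (fun n => gaussianWeight_nonneg (htpos n)) (fun n => gaussianWeight_le d (htpos n))
    (fun n => energyKernel_nonneg _ (htpos n))
    (fun n x y => (henB _ (htpos n) x y).trans ?_) ?_ ?_ ?_ ?_ ?_ hmean hθ
  · filter_upwards [ht0.eventually (ge_mem_nhds one_pos)] with n hn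
    have := htpos n
    rw [le_div_iff₀ (by positivity), one_mul]
    exact Real.rpow_le_one this.le hn (by positivity)
  · have := htpos n
    gcongr
  · filter_upwards [httend.eventually hdeg] with n hn
    filter_upwards [hνM] with x hx using (hn x hx).1
  · filter_upwards [httend.eventually hdeg] with n hn
    filter_upwards [hνM] with x hx using (hn x hx).2.1.trans hC'
  · filter_upwards [httend.eventually hdeg] with n hn
    filter_upwards [hνM] with x hx using (hn x hx).2.2.trans hC'
  · simp_rw [hdiv]
    exact tendsto_sample_size htpos ht0 hnt
  · intro κ hκ
    simp_rw [hdiv]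
    exact tendsto_mul_exp_sample_size htpos ht0 hnt hκ

theorem measurable_indicator_of_continuousOn (hMc : IsCompact M) (hf : ContinuousOn f M) :
    Measurable (M.indicator f) := by
  classical
  rw [← Set.piecewise_eq_indicator]
  exact ContinuousOn.measurable_piecewise hf continuousOn_const hMc.measurableSet

end GraphLaplacian

/-! ### Transfer to the random sample. -/

theorem mainTheorem2 {N d : ℕ} (M : Set (EuclideanSpace ℝ (Fin N)))
    (hM : GraphLaplacian.IsSubmanifoldWithBoundary d M) (hMc : IsCompact M)
    (f : EuclideanSpace ℝ (Fin N) → ℝ) (hf : ContDiffOn ℝ 1 f M)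
    (p : EuclideanSpace ℝ (Fin N) → ℝ) (hp : ContDiffOn ℝ ∞ p M)
    (a b : ℝ) (ha : 0 < a) (hab : ∀ x ∈ M, a ≤ p x ∧ p x ≤ b)
    {S : Type*} [MeasurableSpace S] (P : Measure S) [IsProbabilityMeasure P]
    (X : ℕ → S → EuclideanSpace ℝ (Fin N)) (hXm : ∀ i, Measurable (X i))
    (hXp : ∀ i, P.map (X i) =
      (GraphLaplacian.riemannianVolume d M).withDensity (fun x => ENNReal.ofReal (p x)))
    (hXi : iIndepFun X P)
    (α : ℝ) (t : ℕ → ℝ) (htpos : ∀ n, 0 < t n) (ht0 : Tendsto t atTop (𝓝 0))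
    (hnt : Tendsto (fun n : ℕ => (n : ℝ) ^ 2 * t n ^ (d + 2)) atTop atTop) :
    Integrable (fun x => ‖GraphLaplacian.gradientOn M f x‖ ^ 2 * p x ^ (2 - 2 * α))
        (GraphLaplacian.riemannianVolume d M) ∧
      TendstoInMeasure P
        (fun (n : ℕ) (s : S) => 1 / ((n : ℝ) ^ 2 * t n) *
          GraphLaplacian.regularizer d α (t n) f (fun i : Fin n => X i s))
        atTop
        (fun _ => 1 / 4 * Real.pi ^ ((d : ℝ) * (1 / 2 - α)) *
          ∫ x, ‖GraphLaplacian.gradientOn M f x‖ ^ 2 * p x ^ (2 - 2 * α)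
            ∂(GraphLaplacian.riemannianVolume d M)) := by
  open GraphLaplacian in
  have hMm := hMc.measurableSet
  have hMae : ∀ᵐ x ∂riemannianVolume d M, x ∈ M := ae_restrict_mem hMm
  -- Nothing is known about `f` and `p` outside `M`; extension by zero makes them measurable and
  -- changes neither the law nor the sampled values almost surely.
  set f₁ := M.indicator f with hf₁
  set p₁ := M.indicator p with hp₁
  have hff₁ : ∀ x ∈ M, f₁ x = f x := fun x hx => Set.indicator_of_mem hx f
  have hpp₁ : ∀ x ∈ M, p₁ x = p x := fun x hx => Set.indicator_of_mem hx p
  have hf₁m : Measurable f₁ := measurable_indicator_of_continuousOn hMc hf.continuousOn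
  have hp₁m : Measurable p₁ := measurable_indicator_of_continuousOn hMc hp.continuousOn
  obtain ⟨K, hK⟩ := hM.exists_lipschitzOnWith hMc (hf.congr hff₁)
  have hf' : ∀ x ∈ M, HasFDerivWithinAt f₁ (fderivWithin ℝ f M x) M x := fun x hx =>
    ((hf.differentiableOn one_ne_zero x hx).hasFDerivWithinAt).congr hff₁ (hff₁ x hx)
  have hlaw : (riemannianVolume d M).withDensity (fun x => ENNReal.ofReal (p x)) =
      densityMeasure d M p₁ := by
    refine withDensity_congr_ae ?_
    filter_upwards [hMae] with x hx
    rw [hpp₁ x hx]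
  have hprob : IsProbabilityMeasure (densityMeasure d M p₁) := by
    rw [← hlaw, ← hXp 0]
    exact Measure.isProbabilityMeasure_map (hXm 0).aemeasurable
  obtain ⟨x₀, hx₀⟩ : M.Nonempty := by
    by_contra hempty
    rw [Set.not_nonempty_iff_eq_empty] at hempty
    have h1 := hprob.measure_univ
    simp [densityMeasure, riemannianVolume, hempty] at h1
  have hb : 0 < b := ha.trans_le ((hab x₀ hx₀).1.trans (hab x₀ hx₀).2)
  obtain ⟨hint, hlim⟩ := hM.integrable_and_tendsto hMc hf₁m hK hf' hp₁m
    (hp.continuousOn.congr hpp₁) ha hb (fun x hx => by rw [hpp₁ x hx]; exact hab x hx) α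
    htpos ht0 hnt
  have hgrad : ∀ᵐ x ∂riemannianVolume d M,
      ‖(fderivWithin ℝ f M x).comp (tangentSpace M x).subtypeL‖ ^ 2 * p₁ x ^ (2 - 2 * α) =
        ‖gradientOn M f x‖ ^ 2 * p x ^ (2 - 2 * α) := by
    filter_upwards [hMae] with x hx
    rw [norm_gradientOn, hpp₁ x hx]
  rw [integral_congr_ae hgrad] at hlim
  refine ⟨hint.congr hgrad, tendstoInMeasure_iff_norm.2 fun θ hθ => ?_⟩
  refine tendsto_of_tendsto_of_tendsto_of_le_of_le tendsto_const_nhds (hlim θ hθ)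
    (fun _ => zero_le) fun n => ?_
  have hXM : ∀ᵐ s ∂P, ∀ i : Fin n, X i s ∈ M := by
    refine ae_all_iff.2 fun i => ?_
    have h1 : ∀ᵐ x ∂P.map (X i), x ∈ M := by
      rw [hXp, hlaw]
      exact ae_densityMeasure_of_ae p₁ hMae
    exact ae_of_ae_map (hXm i).aemeasurable h1
  have hjoint : P.map (fun s (i : Fin n) => X i s) =
      Measure.pi fun _ : Fin n => densityMeasure d M p₁ := by
    have h1 := (iIndepFun_iff_map_fun_eq_pi_map fun i : Fin n => (hXm i).aemeasurable).1
      (hXi.precomp Fin.val_injective)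
    simp_rw [hXp, hlaw] at h1
    exact h1
  rw [← hjoint]
  -- A preimage has measure at most the push-forward measure of the set, measurable or not, so
  -- measurability of the deviation event need not be shown.
  refine le_trans (measure_mono_ae ?_) (Measure.le_map_apply
    (f := fun s (i : Fin n) => X i s)
    (measurable_pi_lambda (fun s (i : Fin n) => X i s) fun i => hXm i).aemeasurable _)
  filter_upwards [hXM] with s hs hθs
  have hreg : regularizer d α (t n) f (fun i : Fin n => X i s) =
      regularizer d α (t n) f₁ (fun i : Fin n => X i s) := by
    unfold regularizer
    simp only [hff₁ _ (hs _)]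
  have h2 : θ ≤ ‖1 / ((n : ℝ) ^ 2 * t n) * regularizer d α (t n) f (fun i : Fin n => X i s) -
      1 / 4 * Real.pi ^ ((d : ℝ) * (1 / 2 - α)) *
          ∫ x, ‖gradientOn M f x‖ ^ 2 * p x ^ (2 - 2 * α) ∂(riemannianVolume d M)‖ := hθs
  rw [hreg, regularizer_eq d α (htpos n) hK hs] at h2
  exact h2
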